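/- **Model.** Let $(\mathsf X_n,\mathcal X_n)_{n\ge0}$ be measurable spaces with $\sigma$-finite reference measures $\mu_n$, where $\mu_n$ is a probability measure for every $n\ge1$. Let $\ell_n:\mathsf X_n\times\mathsf X_{n+1}\to[0,\infty)$ be measurable with $\sup_x\int\ell_n(x,y)\,\mu_{n+1}(dy)<\infty$, and let $\chi:\mathsf X_0\to[0,\infty)$ be measurable with $0<\int\chi\,d\mu_0<\infty$. Let $\phi_{0:n}$ be the probability distribution on $\mathsf X_0\times\cdots\times\mathsf X_n$ whose density with respect to $\mu_0\otimes\cdots\otimes\mu_n$ is proportional to $\chi(x_0)\prod_{m=0}^{n-1}\ell_m(x_m,x_{m+1})$. Additive functionals are $h_n(x_{0:n})=h_0(x_0)+\sum_{m=0}^{n-1}\tilde h_m(x_m,x_{m+1})$ with $h_0,\tilde h_m$ real-valued and measurable. **Algorithm (AdaSmooth).** Let $p_n(x,\cdot)$ be proposal transition densities with respect to $\mu_{n+1}$ dominating $\ell_n(x,\cdot)$ (that is, $p_n(x,y)=0$ implies $\ell_n(x,y)=0$), let $\vartheta_n>0$ be measurable adjustment multipliers, and let $\nu$ be a probability density with respect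 to $\mu_0$ dominating $\chi$ in the same sense. Put $w_{-1}=\chi/\nu$ and $w_n\langle\rho\rangle(x,y)=\ell_n(x,y)/(\vartheta_n(x)^{\rho}p_n(x,y))$, $\rho\in\{0,1\}$. Let $(\rho_n),(\varepsilon_n)$ be deterministic $\{0,1\}$-valued sequences with $\varepsilon_n=0$ whenever $\rho_n=0$. With $N$ particles, draw $\xi_0^1,\dots,\xi_0^N$ independently from $\nu$ and set $\tau_0^i=h_0(\xi_0^i)$, $\omega_0^i=w_{-1}(\xi_0^i)$. Given $(\xi_n^i,\tau_n^i,\omega_n^i)_{i=1}^N$, independently for each $i$: draw $I$ with $P(I=l)\propto\omega_n^l\vartheta_n(\xi_n^l)$ if $\rho_n=1$, and set $I=i$ if $\rho_n=0$; draw $\xi_{n+1}^i\sim p_n(\xi_n^{I},\cdot)$; set $\omega_{n+1}^i=w_n\langle\rho_n\rangle(\xi_n^{I},\xi_{n+1}^i)\,(\omega_n^i)^{1-\rho_n}$; if $\varepsilon_n=0$ set $\tau_{n+1}^i=\tau_n^{I}+\tilde h_n(\xi_n^{I},\xi_{n+1}^i)$, and if $\varepsilon_n=1$ draw $J$ with $P(J=j)\propto\omega_n^j\ell_n(\xi_n^j,\xi_{n+1}^i)$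 and set $$\tau_{n+1}^i=\tfrac12\big(\tau_n^{I}+\tilde h_n(\xi_n^{I},\xi_{n+1}^i)+\tau_n^{J}+\tilde h_n(\xi_n^{J},\xi_{n+1}^i)\big).$$ (If all the weights defining a categorical draw vanish, the draw is uniform.) The asymptotic variance $\sigma_n^2(h_n)\in[0,\infty)$ is the number for which, as $N\to\infty$, $$\sqrt N\Big(\frac{\sum_i\omega_n^i\tau_n^i}{\sum_i\omega_n^i}-\phi_{0:n}h_n\Big)\xrightarrow{\ \mathcal D\ }\mathcal N\big(0,\sigma_n^2(h_n)\big).$$ **Schedules.** Let $r_n=\sum_{m=0}^{n-1}\rho_m$ and $n_j=\min\{n\in\mathbb N:r_{n+1}=j+1\}$. **Theorem 3.3.** Let $0<\underline\varepsilon<\bar\varepsilon<\infty$, $\bar\delta>0$ and $d\in\mathbb N^*$. There are positive constants $C_1,C_2$ depending only on $\underline\varepsilon,\bar\varepsilon,\bar\delta,d$ such that the following holds for every model, algorithm and schedule as above and every $\bar\gamma>0$. Assume that for every $n\in\mathbb N$ there is $k\in\{1,\dots,d\}$ with $\rho_{n+k}=1$, and that, for all $n$, all $\rho\in\{0,1\}$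 and all arguments, $\underline\varepsilon\le\ell_n\le\bar\varepsilon$, $w_n\langle\rho\rangle\le\bar\delta$, $\vartheta_n\le\bar\gamma$ and $w_{-1}\le\bar\delta$. Then for all additive functionals $(h_n)$ and every $|\tilde h|_\infty>0$ such that $\sup|\tilde h_n|\le|\tilde h|_\infty$ for all $n\in\mathbb N$ and $\sup|h_0+\tilde h_0|\le|\tilde h|_\infty$, the asymptotic variances $\sigma_n^2(h_n)$ exist for all $n$ and $$\limsup_{n\to\infty}\frac{\sigma_n^2(h_n)}{n}\le d^2\,|\tilde h|_\infty^2\,\bar\gamma\Big(C_1+C_2\limsup_{n\to\infty}\frac1{r_n}\sum_{m=0}^{r_n-1}\sum_{\ell=0}^{m}\prod_{j=\ell}^{m}(1+\varepsilon_{n_j})^{-1}\Big),$$ where the right-hand side may be infinite. In particular, whenever the limit of the schedule averages on the right exists in $[0,\infty]$, the bound holds with that limit in place of the second limsup. -/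

import Mathlib

open MeasureTheory ProbabilityTheory Filter
open scoped NNReal ENNReal Topology

namespace AdaSmooth

universe u

/-! ### The path-space model, the particle-filter parameters and additive functionals -/

/-- A path-space model on measurable spaces `X 0, X 1, …`: reference measures `μ n`, unnormalized
transition densities `ell n` (with respect to `μ (n + 1)`) and a possibly unnormalized initial
density `χ` (with respect to `μ 0`). -/
structure PathModel (X : ℕ → Type u) [∀ n, MeasurableSpace (X n)] where
  μ : ∀ n, Measure (X n)
  sigmaFinite_μ : ∀ n, SigmaFinite (μ n)
  ell : ∀ n, X n → X (n + 1) → ℝ≥0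
  measurable_ell : ∀ n, Measurable (Function.uncurry (ell n))
  ell_bounded_mass : ∀ n, ∃ B : ℝ≥0, ∀ x, ∫⁻ y, (ell n x y : ℝ≥0∞) ∂(μ (n + 1)) ≤ B
  χ : X 0 → ℝ≥0
  measurable_χ : Measurable χ
  χ_mass_ne_zero : ∫⁻ x, (χ x : ℝ≥0∞) ∂(μ 0) ≠ 0
  χ_mass_ne_top : ∫⁻ x, (χ x : ℝ≥0∞) ∂(μ 0) ≠ ∞

/-- The parameters of the auxiliary particle filter: proposal transition densities `p n` such that
`p n x` dominates `ell n x`, positive adjustment multipliers `ϑ n`, and an initial proposal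
density `ν` that dominates `χ`. -/
structure Proposal {X : ℕ → Type u} [∀ n, MeasurableSpace (X n)] (M : PathModel X) where
  p : ∀ n, X n → X (n + 1) → ℝ≥0
  measurable_p : ∀ n, Measurable (Function.uncurry (p n))
  p_mass : ∀ n x, ∫⁻ y, (p n x y : ℝ≥0∞) ∂(M.μ (n + 1)) = 1
  p_dominates : ∀ n x y, p n x y = 0 → M.ell n x y = 0
  ϑ : ∀ n, X n → ℝ≥0
  measurable_ϑ : ∀ n, Measurable (ϑ n)
  ϑ_pos : ∀ n x, 0 < ϑ n x
  ν : X 0 → ℝ≥0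
  measurable_ν : Measurable ν
  ν_mass : ∫⁻ x, (ν x : ℝ≥0∞) ∂(M.μ 0) = 1
  ν_dominates : ∀ x, ν x = 0 → M.χ x = 0

/-- The terms `h₀` and `h̃ₙ` of a sequence of additive functionals. -/
structure AdditiveTerms (X : ℕ → Type u) [∀ n, MeasurableSpace (X n)] where
  init : X 0 → ℝ
  measurable_init : Measurable init
  incr : ∀ n, X n → X (n + 1) → ℝ
  measurable_incr : ∀ n, Measurable (Function.uncurry (incr n))

/-- A path `(x₀, …, xₙ)`. -/
abbrev Path (X : ℕ → Type u) (n : ℕ) : Type u := ∀ i : Fin (n + 1), X i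

/-- `hₙ(x₀, …, xₙ) = h₀(x₀) + ∑_{m < n} h̃ₘ(xₘ, xₘ₊₁)`. -/
def AdditiveTerms.functional {X : ℕ → Type u} [∀ n, MeasurableSpace (X n)]
    (h : AdditiveTerms X) (n : ℕ) (x : Path X n) : ℝ :=
  h.init (x ⟨0, n.succ_pos⟩) + ∑ m : Fin n, h.incr m (x m.castSucc) (x m.succ)

section Smoothing

variable {X : ℕ → Type u} [∀ n, MeasurableSpace (X n)] (M : PathModel X)

/-- The unnormalized path density `χ(x₀) ∏_{m < n} ellₘ(xₘ, xₘ₊₁)`. -/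
def PathModel.pathDensity (n : ℕ) (x : Path X n) : ℝ≥0 :=
  M.χ (x ⟨0, n.succ_pos⟩) * ∏ m : Fin n, M.ell m (x m.castSucc) (x m.succ)

/-- The measure with the unnormalized path density. -/
noncomputable def PathModel.unnormalizedSmoothing (n : ℕ) : Measure (Path X n) :=
  (Measure.pi fun i : Fin (n + 1) => M.μ i).withDensity fun x => (M.pathDensity n x : ℝ≥0∞)

/-- The joint-smoothing distribution `φ_{0:n}`. -/
noncomputable def PathModel.smoothing (n : ℕ) : Measure (Path X n) :=
  (M.unnormalizedSmoothing n Set.univ)⁻¹ • M.unnormalizedSmoothing n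

/-- The weight function `wₙ⟨ρ⟩(x, y) = ellₙ(x, y) / (ϑₙ(x)^ρ pₙ(x, y))`. -/
noncomputable def Proposal.weightFn {M : PathModel X} (P : Proposal M) (ρ : Bool) (n : ℕ)
    (x : X n) (y : X (n + 1)) : ℝ≥0 :=
  M.ell n x y / (P.ϑ n x ^ ρ.toNat * P.p n x y)

/-- The initial weight function `w₋₁ = χ / ν`. -/
noncomputable def Proposal.initWeightFn {M : PathModel X} (P : Proposal M) (x : X 0) : ℝ≥0 :=
  M.χ x / P.ν x

end Smoothing

/-! ### The categorical distribution -/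

/-- The probabilities of `Cat(a)`, the distribution on the indices proportional to `a`. If all
weights vanish (so that `Cat(a)` is otherwise undefined), the uniform distribution is used. -/
noncomputable def catProb {N : ℕ} (a : Fin N → ℝ≥0) (i : Fin N) : ℝ≥0 :=
  if ∑ j, a j = 0 then (N : ℝ≥0)⁻¹ else a i / ∑ j, a j

/-- The distribution `Cat(a)`. -/
noncomputable def cat {N : ℕ} (a : Fin N → ℝ≥0) : Measure (Fin N) :=
  ∑ i, (catProb a i : ℝ≥0∞) • Measure.dirac i

/-! ### The AdaSmooth algorithm with deterministic schedules -/

/-- A weighted sample `(ξᵢ, τᵢ, ωᵢ)ᵢ` of `N` particles, statistics and weights at time `n`. -/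
abbrev Sample (X : ℕ → Type u) (N n : ℕ) : Type u := Fin N → X n × ℝ × ℝ≥0

section Algorithm

variable {X : ℕ → Type u} [∀ n, MeasurableSpace (X n)] {M : PathModel X}

/-- The law of the forward index `I` of particle `i`: drawn from `Cat((ω_l ϑₙ(ξ_l))_l)` when
resampling is triggered, and equal to `i` otherwise. -/
noncomputable def selectionLaw (P : Proposal M) (ρ : Bool) (n : ℕ) {N : ℕ} (s : Sample X N n)
    (i : Fin N) : Measure (Fin N) :=
  if ρ then cat fun l => (s l).2.2 * P.ϑ n (s l).1 else Measure.dirac i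

/-- The law of the mutated particle: density `pₙ(x, ·)`. -/
noncomputable def mutationLaw (P : Proposal M) (n : ℕ) (x : X n) : Measure (X (n + 1)) :=
  (M.μ (n + 1)).withDensity fun y => (P.p n x y : ℝ≥0∞)

/-- The new weight of particle `i` with forward index `I` and new position `y`. -/
noncomputable def newWeight (P : Proposal M) (ρ : Bool) (n : ℕ) {N : ℕ} (s : Sample X N n)
    (i I : Fin N) (y : X (n + 1)) : ℝ≥0 :=
  P.weightFn ρ n (s I).1 y * (s i).2.2 ^ (1 - ρ.toNat)

/-- The statistic propagated from ancestor `I` to the new position `y`. -/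
def movedStat (h : AdditiveTerms X) (n : ℕ) {N : ℕ} (s : Sample X N n) (I : Fin N)
    (y : X (n + 1)) : ℝ :=
  (s I).2.1 + h.incr n (s I).1 y

/-- The law of the new statistic given the forward index `I` and the new position `y`: if backward
sampling is triggered, an index `J` is drawn from `Cat((ω_j ellₙ(ξ_j, y))_j)` and the statistics
moved from `I` and `J` are averaged; otherwise the statistic moved from `I` is used. -/
noncomputable def statLaw (M : PathModel X) (h : AdditiveTerms X) (ε : Bool) (n : ℕ) {N : ℕ}
    (s : Sample X N n) (I : Fin N) (y : X (n + 1)) : Measure ℝ :=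
  if ε then
    (cat fun j => (s j).2.2 * M.ell n (s j).1 y).map
      fun J => 2⁻¹ * (movedStat h n s I y + movedStat h n s J y)
  else Measure.dirac (movedStat h n s I y)

/-- The conditional law, given the sample at time `n`, of particle `i` of the sample at time
`n + 1` together with its statistic and weight. -/
noncomputable def particleLaw (P : Proposal M) (h : AdditiveTerms X) (ρ ε : Bool) (n : ℕ) {N : ℕ}
    (s : Sample X N n) (i : Fin N) : Measure (X (n + 1) × ℝ × ℝ≥0) :=
  (selectionLaw P ρ n s i).bind fun I =>
    (mutationLaw P n (s I).1).bind fun y =>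
      (statLaw M h ε n s I y).map fun t => (y, t, newWeight P ρ n s i I y)

/-- One iteration of AdaSmooth: given the sample at time `n`, the particles of the sample at time
`n + 1` are generated independently. -/
noncomputable def stepLaw (P : Proposal M) (h : AdditiveTerms X) (ρ ε : Bool) (n : ℕ) {N : ℕ}
    (s : Sample X N n) : Measure (Sample X N (n + 1)) :=
  Measure.pi fun i => particleLaw P h ρ ε n s i

/-- The law of the initial sample: independent particles with density `ν`, statistics `h₀(ξᵢ)` and
importance weights `χ(ξᵢ) / ν(ξᵢ)`. -/
noncomputable def initLaw (P : Proposal M) (h : AdditiveTerms X) (N : ℕ) :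
    Measure (Sample X N 0) :=
  Measure.pi fun _ =>
    ((M.μ 0).withDensity fun x => (P.ν x : ℝ≥0∞)).map fun x => (x, h.init x, P.initWeightFn x)

/-- The law of the weighted sample produced by `n` iterations of AdaSmooth with `N` particles,
resampling schedule `ρ` and backward-sampling schedule `ε`. -/
noncomputable def law (P : Proposal M) (h : AdditiveTerms X) (ρ ε : ℕ → Bool) (N : ℕ) :
    ∀ n, Measure (Sample X N n)
  | 0 => initLaw P h N
  | n + 1 => (law P h ρ ε N n).bind fun s => stepLaw P h (ρ n) (ε n) n s

/-- The estimator `∑ᵢ ωᵢ τᵢ / ∑ᵢ ωᵢ`. -/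
noncomputable def estimator {N n : ℕ} (s : Sample X N n) : ℝ :=
  (∑ i, ((s i).2.2 : ℝ) * (s i).2.1) / ∑ i, ((s i).2.2 : ℝ)

end Algorithm

/-! ### The sample laws are probability measures -/

section Measurability

variable {X : ℕ → Type u} [∀ n, MeasurableSpace (X n)] {M : PathModel X}

lemma sum_catProb {N : ℕ} (a : Fin N → ℝ≥0) (i₀ : Fin N) :
    ∑ i, (catProb a i : ℝ≥0∞) = 1 := by
  have hN : (N : ℝ≥0) ≠ 0 := by
    have := i₀.pos
    positivity
  rw [← ENNReal.ofNNReal_finsetSum]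
  norm_cast
  unfold catProb
  split_ifs with h
  · simp [hN]
  · rw [← Finset.sum_div, div_self h]

lemma isProbabilityMeasure_cat {N : ℕ} (a : Fin N → ℝ≥0) (i₀ : Fin N) :
    IsProbabilityMeasure (cat a) :=
  ⟨by simp [cat, Measure.finsetSum_apply, sum_catProb a i₀]⟩

lemma measurable_catProb {α : Type*} [MeasurableSpace α] {N : ℕ} {a : α → Fin N → ℝ≥0}
    (ha : ∀ j, Measurable fun x => a x j) (i : Fin N) :
    Measurable fun x => catProb (a x) i := by
  unfold catProb
  have hs : Measurable fun x => ∑ j, a x j := Finset.measurable_fun_sum _ fun j _ => ha j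
  exact Measurable.ite (hs (measurableSet_singleton 0)) measurable_const ((ha i).div hs)

lemma lintegral_cat {N : ℕ} (a : Fin N → ℝ≥0) (f : Fin N → ℝ≥0∞) :
    ∫⁻ i, f i ∂(cat a) = ∑ i, (catProb a i : ℝ≥0∞) * f i := by
  unfold cat
  rw [lintegral_finsetSum_measure]
  refine Finset.sum_congr rfl fun i _ => ?_
  rw [lintegral_smul_measure, lintegral_dirac, smul_eq_mul]

lemma measurable_cat {α : Type*} [MeasurableSpace α] {N : ℕ} {a : α → Fin N → ℝ≥0}
    (ha : ∀ j, Measurable fun x => a x j) : Measurable fun x => cat (a x) := by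
  refine Measure.measurable_of_measurable_coe _ fun s _ => ?_
  simp only [cat, Measure.finsetSum_apply, Measure.smul_apply, smul_eq_mul]
  exact Finset.measurable_fun_sum _ fun i _ =>
    ((measurable_catProb ha i).coe_nnreal_ennreal).mul_const _

lemma measurable_weightFn (P : Proposal M) (ρ : Bool) (n : ℕ) :
    Measurable (Function.uncurry (P.weightFn ρ n)) := by
  have h1 := M.measurable_ell n
  have h2 := P.measurable_p n
  have h3 : Measurable fun q : X n × X (n + 1) => P.ϑ n q.1 :=
    (P.measurable_ϑ n).comp measurable_fst
  exact h1.div ((h3.pow_const _).mul h2)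

variable {N n : ℕ}

lemma measurable_ell_sample (j : Fin N) :
    Measurable fun q : Sample X N n × X (n + 1) => M.ell n (q.1 j).1 q.2 :=
  (M.measurable_ell n).comp (f := fun q : Sample X N n × X (n + 1) => ((q.1 j).1, q.2))
    (by fun_prop)

lemma measurable_movedStat (h : AdditiveTerms X) (I : Fin N) :
    Measurable fun q : Sample X N n × X (n + 1) => movedStat h n q.1 I q.2 := by
  have := (h.measurable_incr n).comp (f := fun q : Sample X N n × X (n + 1) => ((q.1 I).1, q.2))
    (by fun_prop)
  unfold movedStat
  exact Measurable.add (by fun_prop) this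

lemma measurable_newWeight (P : Proposal M) (ρ : Bool) (i I : Fin N) :
    Measurable fun q : Sample X N n × X (n + 1) => newWeight P ρ n q.1 i I q.2 := by
  have := (measurable_weightFn P ρ n).comp
    (f := fun q : Sample X N n × X (n + 1) => ((q.1 I).1, q.2)) (by fun_prop)
  unfold newWeight
  exact Measurable.mul this (by fun_prop)

lemma isProbabilityMeasure_statLaw (h : AdditiveTerms X) (ε : Bool) (s : Sample X N n)
    (I : Fin N) (y : X (n + 1)) : IsProbabilityMeasure (statLaw M h ε n s I y) := by
  unfold statLaw
  split_ifs
  · have := isProbabilityMeasure_cat (fun j => (s j).2.2 * M.ell n (s j).1 y) I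
    exact Measure.isProbabilityMeasure_map (measurable_of_finite _).aemeasurable
  · infer_instance

lemma isProbabilityMeasure_selectionLaw (P : Proposal M) (ρ : Bool) (s : Sample X N n)
    (i : Fin N) : IsProbabilityMeasure (selectionLaw P ρ n s i) := by
  unfold selectionLaw
  split_ifs
  · exact isProbabilityMeasure_cat _ i
  · infer_instance

instance isProbabilityMeasure_mutationLaw (P : Proposal M) (x : X n) :
    IsProbabilityMeasure (mutationLaw P n x) :=
  ⟨by simp [mutationLaw, P.p_mass]⟩

lemma measurable_statLaw (h : AdditiveTerms X) (ε : Bool) (I : Fin N) :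
    Measurable fun q : Sample X N n × X (n + 1) => statLaw M h ε n q.1 I q.2 := by
  refine Measure.measurable_of_measurable_coe _ fun A hA => ?_
  unfold statLaw
  split_ifs
  · have : ∀ q : Sample X N n × X (n + 1),
        ((cat fun j => (q.1 j).2.2 * M.ell n (q.1 j).1 q.2).map
          fun J => 2⁻¹ * (movedStat h n q.1 I q.2 + movedStat h n q.1 J q.2)) A
        = ∑ J, (catProb (fun j => (q.1 j).2.2 * M.ell n (q.1 j).1 q.2) J : ℝ≥0∞) *
          A.indicator 1 (2⁻¹ * (movedStat h n q.1 I q.2 + movedStat h n q.1 J q.2)) := by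
      intro q
      rw [← lintegral_indicator_one hA, lintegral_map (measurable_one.indicator hA)
        (measurable_of_finite _), lintegral_cat]
    simp_rw [this]
    refine Finset.measurable_fun_sum _ fun J _ => Measurable.mul ?_ ?_
    · refine (measurable_catProb (fun j => ?_) J).coe_nnreal_ennreal
      exact Measurable.mul (by fun_prop) (measurable_ell_sample j)
    · exact (measurable_one.indicator hA).comp
        (((measurable_movedStat h I).add (measurable_movedStat h J)).const_mul _)
  · exact (Measure.measurable_coe hA).comp
      (Measure.measurable_dirac.comp (measurable_movedStat h I))

lemma measurable_map_statLaw (P : Proposal M) (h : AdditiveTerms X) (ρ ε : Bool) (i I : Fin N) :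
    Measurable fun q : Sample X N n × X (n + 1) =>
      (statLaw M h ε n q.1 I q.2).map fun t => (q.2, t, newWeight P ρ n q.1 i I q.2) := by
  refine Measure.measurable_of_measurable_coe _ fun A hA => ?_
  let κ : Kernel (Sample X N n × X (n + 1)) ℝ := ⟨_, measurable_statLaw (M := M) h ε I⟩
  have : IsMarkovKernel κ := ⟨fun q => isProbabilityMeasure_statLaw h ε q.1 I q.2⟩
  have hm : Measurable fun r : (Sample X N n × X (n + 1)) × ℝ =>
      (r.1.2, r.2, newWeight P ρ n r.1.1 i I r.1.2) :=
    (by fun_prop : Measurable fun r : (Sample X N n × X (n + 1)) × ℝ => r.1.2).prodMk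
      (measurable_snd.prodMk ((measurable_newWeight P ρ i I).comp measurable_fst))
  have h2 := Kernel.measurable_kernel_prodMk_left (κ := κ) (hm hA)
  convert h2 using 1
  funext q
  exact Measure.map_apply (hm.comp (measurable_prodMk_left (x := q))) hA

lemma measurable_inner (P : Proposal M) (h : AdditiveTerms X) (ρ ε : Bool) (i I : Fin N) :
    Measurable fun s : Sample X N n =>
      (mutationLaw P n (s I).1).bind fun y =>
        (statLaw M h ε n s I y).map fun t => (y, t, newWeight P ρ n s i I y) := by
  have := M.sigmaFinite_μ (n + 1)
  have hK := measurable_map_statLaw (n := n) P h ρ ε i I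
  have hp : Measurable fun q : Sample X N n × X (n + 1) => P.p n (q.1 I).1 q.2 :=
    (P.measurable_p n).comp (f := fun q : Sample X N n × X (n + 1) => ((q.1 I).1, q.2))
      (by fun_prop)
  refine Measure.measurable_of_measurable_coe _ fun A hA => ?_
  have hKA := (Measure.measurable_coe hA).comp hK
  convert Measurable.lintegral_prod_right' (ν := M.μ (n + 1))
    (hp.coe_nnreal_ennreal.mul hKA) using 1
  funext s
  refine (Measure.bind_apply hA (hK.comp (measurable_prodMk_left (x := s))).aemeasurable).trans ?_
  exact lintegral_withDensity_eq_lintegral_mul _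
    ((hp.comp (measurable_prodMk_left (x := s))).coe_nnreal_ennreal)
    (hKA.comp (measurable_prodMk_left (x := s)))

lemma isProbabilityMeasure_inner (P : Proposal M) (h : AdditiveTerms X) (ρ ε : Bool)
    (s : Sample X N n) (i I : Fin N) :
    IsProbabilityMeasure ((mutationLaw P n (s I).1).bind fun y =>
      (statLaw M h ε n s I y).map fun t => (y, t, newWeight P ρ n s i I y)) := by
  refine isProbabilityMeasure_bind
    ((measurable_map_statLaw P h ρ ε i I).comp measurable_prodMk_left).aemeasurable
    (ae_of_all _ fun y => ?_)
  have := isProbabilityMeasure_statLaw (M := M) h ε s I y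
  exact Measure.isProbabilityMeasure_map (by fun_prop)

instance isProbabilityMeasure_particleLaw (P : Proposal M) (h : AdditiveTerms X) (ρ ε : Bool)
    (s : Sample X N n) (i : Fin N) : IsProbabilityMeasure (particleLaw P h ρ ε n s i) := by
  have := isProbabilityMeasure_selectionLaw P ρ s i
  exact isProbabilityMeasure_bind (measurable_of_finite _).aemeasurable
    (ae_of_all _ fun I => isProbabilityMeasure_inner P h ρ ε s i I)

lemma measurable_particleLaw (P : Proposal M) (h : AdditiveTerms X) (ρ ε : Bool) (i : Fin N) :
    Measurable fun s : Sample X N n => particleLaw P h ρ ε n s i := by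
  refine Measure.measurable_of_measurable_coe _ fun A hA => ?_
  have hI := fun I => (Measure.measurable_coe hA).comp (measurable_inner (n := n) P h ρ ε i I)
  simp only [particleLaw, Measure.bind_apply hA (measurable_of_finite _).aemeasurable]
  unfold selectionLaw
  split_ifs
  · simp only [lintegral_cat]
    refine Finset.measurable_fun_sum _ fun I _ => Measurable.mul ?_ (hI I)
    refine (measurable_catProb (fun j => ?_) I).coe_nnreal_ennreal
    exact Measurable.mul (by fun_prop) ((P.measurable_ϑ n).comp (by fun_prop))
  · simp only [lintegral_dirac]
    exact hI i

instance isProbabilityMeasure_stepLaw (P : Proposal M) (h : AdditiveTerms X) (ρ ε : Bool)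
    (s : Sample X N n) : IsProbabilityMeasure (stepLaw P h ρ ε n s) := by
  unfold stepLaw
  infer_instance

lemma measurable_stepLaw (P : Proposal M) (h : AdditiveTerms X) (ρ ε : Bool) :
    Measurable fun s : Sample X N n => stepLaw P h ρ ε n s := by
  refine Measurable.measure_of_isPiSystem_of_isProbabilityMeasure generateFrom_pi.symm
    isPiSystem_pi ?_
  rintro _ ⟨A, hA, rfl⟩
  simp only [stepLaw, Measure.pi_pi]
  exact Finset.measurable_fun_prod _ fun i _ =>
    (Measure.measurable_coe (show MeasurableSet (A i) from hA i (Set.mem_univ i))).comp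
      (measurable_particleLaw P h ρ ε i)

instance isProbabilityMeasure_initLaw (P : Proposal M) (h : AdditiveTerms X) (N : ℕ) :
    IsProbabilityMeasure (initLaw P h N) := by
  have h0 : IsProbabilityMeasure ((M.μ 0).withDensity fun x => (P.ν x : ℝ≥0∞)) :=
    ⟨by simp [P.ν_mass]⟩
  have hm : Measurable fun x => (x, h.init x, P.initWeightFn x) :=
    measurable_id.prodMk (h.measurable_init.prodMk (M.measurable_χ.div P.measurable_ν))
  have := Measure.isProbabilityMeasure_map (μ := (M.μ 0).withDensity fun x => (P.ν x : ℝ≥0∞))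
    hm.aemeasurable
  unfold initLaw
  infer_instance

instance isProbabilityMeasure_law (P : Proposal M) (h : AdditiveTerms X) (ρ ε : ℕ → Bool)
    (N n : ℕ) : IsProbabilityMeasure (law P h ρ ε N n) := by
  induction n with
  | zero => exact isProbabilityMeasure_initLaw P h N
  | succ n ih =>
    exact isProbabilityMeasure_bind (measurable_stepLaw P h (ρ n) (ε n)).aemeasurable
      (ae_of_all _ fun s => isProbabilityMeasure_stepLaw P h (ρ n) (ε n) s)

end Measurability

/-! ### Asymptotic variance and schedules -/

/-- `v` is the asymptotic variance `σₙ²⟨ρ, ε⟩(hₙ)` of the AdaSmooth estimator at time `n`: as the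
number `N` of particles tends to infinity, `√N (estimator - φ_{0:n} hₙ)` converges in distribution
to the centred Gaussian distribution with variance `v`. -/
def IsAsymptoticVariance {X : ℕ → Type u} [∀ n, MeasurableSpace (X n)] {M : PathModel X}
    (P : Proposal M) (h : AdditiveTerms X) (ρ ε : ℕ → Bool) (n : ℕ) (v : ℝ≥0) : Prop :=
  TendstoInDistribution
    (fun (N : ℕ) (s : Sample X N n) =>
      Real.sqrt N * (estimator s - ∫ x, h.functional n x ∂(M.smoothing n)))
    atTop (fun z : ℝ => z) (fun N => law P h ρ ε N n) (gaussianReal 0 v)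

/-- `rₙ`, the number of selection operations before time `n`. -/
def numSelections (ρ : ℕ → Bool) (n : ℕ) : ℕ := ∑ m ∈ Finset.range n, (ρ m).toNat

/-- `nⱼ = min {n : rₙ₊₁ = j + 1}`, the time of the `(j + 1)`-th selection operation. -/
noncomputable def selectionTime (ρ : ℕ → Bool) (j : ℕ) : ℕ :=
  sInf {n | numSelections ρ (n + 1) = j + 1}

/-- `(1 / rₙ) ∑_{m < rₙ} ∑_{l ≤ m} ∏_{j = l}^{m} (1 + ε_{nⱼ})⁻¹`. -/
noncomputable def scheduleAverage (ρ ε : ℕ → Bool) (n : ℕ) : ℝ≥0 :=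
  (numSelections ρ n : ℝ≥0)⁻¹ *
    ∑ m ∈ Finset.range (numSelections ρ n), ∑ l ∈ Finset.range (m + 1),
      ∏ j ∈ Finset.Icc l m, (1 + ((ε (selectionTime ρ j)).toNat : ℝ≥0))⁻¹

/-- Strong mixing with constants `εl ≤ εu`, weight bound `δ` and adjustment-multiplier
bound `γ`. -/
structure StrongMixing {X : ℕ → Type u} [∀ n, MeasurableSpace (X n)] {M : PathModel X}
    (P : Proposal M) (εl εu δ γ : ℝ≥0) : Prop where
  ell_lower : ∀ n x y, εl ≤ M.ell n x y
  ell_upper : ∀ n x y, M.ell n x y ≤ εu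
  weight_bound : ∀ ρ n x y, P.weightFn ρ n x y ≤ δ
  ϑ_bound : ∀ n x, P.ϑ n x ≤ γ
  initWeight_bound : ∀ x, P.initWeightFn x ≤ δ

end AdaSmooth

/-! The proof follows test functions of the form `ω (τ g(ξ) + ψ(ξ))`. Given the sample at time `n`,
the mean of such a function over the offspring is a particle average of a function of the same form,
with `(g, ψ)` replaced by `(pullFst, pullSnd)`; at a selection step this average is divided by the
mean of `ω ϑ(ξ)`. Backward sampling does not change this. Once the importance weight is taken into
account, the forward index has the same law as the backward index, proportional to `ω_j ellₙ(ξ_j,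
y)`, so averaging the two statistics leaves the conditional mean alone. What changes is the
conditional variance of the statistic given the position: in the limit the statistic is a mean of
two independent draws from the backward kernel, and `condVar` is halved (`backMass_mul_condVar`).

Law of large numbers: weighted particle averages converge in mean square at rate `1 / N`, uniformly
over bounded families of test functions (`positionRates`, `weightRates`). The limits are expressed
through the unnormalized marginals `fwd` and the limiting conditional moments `mom`. The rate, and
not mere convergence, is what permits replacing random normalizers by their limits on the scale
`√N`.

Central limit theorem: given the past, the particles are independent and bounded, so the
characteristic function of the scaled mean is close to that of a Gaussian with the conditional mean
and variance (`norm_integral_cis_emp_sub_le`, `tendsto_cis_succ`). Without selection the conditional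
variance is the difference of two successive limiting second moments and the sum telescopes. At a
selection the offspring are conditionally iid, nothing cancels, and the past second moment stays.
The variance is therefore the current second moment plus one nonnegative term for each past
selection (`exists_asympNormal`). Slutsky's argument passes to the self-normalized estimator.

Bounds: strong mixing gives a Doeblin contraction (`exists_center_contraction`). It keeps the
oscillation of the conditional means, and that of `ψ / g` for pulled-back pairs, below one constant
`oscBound` independent of time (`exists_center_mom`, `tame_pull`). Hence each term is at most a
constant times the conditional variance plus one (`secondMoment_le`, `stepBound_le`). The
conditional variances satisfy `s' ≤ (s + b) / (1 + ε)`. Sampled at the selection times this is the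
recursion of the inner sums of the schedule average (`condVarBound_le`,
`selectionWeight_succ_eq_sum`), with at most `d + 1` copies of `b` per selection. Summing over the
at most `n` selections and dividing by `n` gives the theorem. -/

namespace AdaSmooth

universe u

/-! ### Bounded measurable functions and the Doeblin contraction. -/

section BoundedMeasurable

/-- Bounded measurable real functions. -/
def BM {α : Type*} [MeasurableSpace α] (f : α → ℝ) : Prop :=
  Measurable f ∧ ∃ C, ∀ x, |f x| ≤ C

variable {α β : Type*} [MeasurableSpace α] [MeasurableSpace β]

lemma BM.exists_pos {f : α → ℝ} (hf : BM f) : ∃ C, 0 < C ∧ ∀ x, |f x| ≤ C := by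
  obtain ⟨C, hC⟩ := hf.2
  exact ⟨max C 1, by positivity, fun x => (hC x).trans (le_max_left _ _)⟩

lemma BM.const (c : ℝ) : BM fun _ : α => c := ⟨measurable_const, |c|, fun _ => le_rfl⟩

lemma BM.add {f g : α → ℝ} (hf : BM f) (hg : BM g) : BM fun x => f x + g x := by
  obtain ⟨C, hC⟩ := hf.2
  obtain ⟨D, hD⟩ := hg.2
  exact ⟨hf.1.add hg.1, C + D, fun x => (abs_add_le _ _).trans (add_le_add (hC x) (hD x))⟩

lemma BM.mul {f g : α → ℝ} (hf : BM f) (hg : BM g) : BM fun x => f x * g x := by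
  obtain ⟨C, hC0, hC⟩ := hf.exists_pos
  obtain ⟨D, hD⟩ := hg.2
  refine ⟨hf.1.mul hg.1, C * D, fun x => ?_⟩
  rw [abs_mul]
  exact mul_le_mul (hC x) (hD x) (abs_nonneg _) hC0.le

lemma BM.sub {f g : α → ℝ} (hf : BM f) (hg : BM g) : BM fun x => f x - g x := by
  simpa [sub_eq_add_neg] using hf.add ((BM.const (-1)).mul hg)

lemma BM.pow {f : α → ℝ} (hf : BM f) (k : ℕ) : BM fun x => f x ^ k := by
  obtain ⟨C, hC0, hC⟩ := hf.exists_pos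
  refine ⟨hf.1.pow_const k, C ^ k, fun x => ?_⟩
  rw [abs_pow]
  exact pow_le_pow_left₀ (abs_nonneg _) (hC x) k

lemma BM.sum {ι : Type*} (s : Finset ι) {f : ι → α → ℝ} (hf : ∀ i ∈ s, BM (f i)) :
    BM fun x => ∑ i ∈ s, f i x := by
  induction s using Finset.cons_induction with
  | empty => simpa using BM.const 0
  | cons a s ha ih =>
    simp only [Finset.sum_cons]
    exact (hf a (by simp)).add (ih fun i hi => hf i (by simp [hi]))

lemma BM.comp {f : β → ℝ} (hf : BM f) {g : α → β} (hg : Measurable g) : BM fun x => f (g x) :=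
  ⟨hf.1.comp hg, hf.2.imp fun _ hC x => hC (g x)⟩

lemma BM.div {f g : α → ℝ} (hf : BM f) (hg : Measurable g) {b : ℝ} (hb : 0 < b)
    (h : ∀ x, b ≤ g x) : BM fun x => f x / g x := by
  obtain ⟨C, hC0, hC⟩ := hf.exists_pos
  refine ⟨hf.1.div hg, C / b, fun x => ?_⟩
  rw [abs_div, abs_of_pos (hb.trans_le (h x))]
  exact div_le_div₀ hC0.le (hC x) hb (h x)

lemma BM.integrable {f : α → ℝ} (hf : BM f) (m : Measure α) [IsFiniteMeasure m] :
    Integrable f m := by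
  obtain ⟨C, hC⟩ := hf.2
  exact Integrable.of_bound hf.1.aestronglyMeasurable C (ae_of_all _ fun x => by simpa using hC x)

lemma BM.integral_right {f : α → β → ℝ} (hf : BM (Function.uncurry f)) (m : Measure β)
    [IsFiniteMeasure m] : BM fun x => ∫ y, f x y ∂m := by
  obtain ⟨C, hC⟩ := hf.2
  refine ⟨(StronglyMeasurable.integral_prod_right hf.1.stronglyMeasurable).measurable,
    C * m.real Set.univ, fun x => ?_⟩
  exact norm_integral_le_of_norm_le_const (f := fun y => f x y) (C := C)
    (ae_of_all _ fun y => hC (x, y))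

lemma BM.swap {f : α → β → ℝ} (hf : BM (Function.uncurry f)) :
    BM (Function.uncurry fun y x => f x y) :=
  hf.comp (g := Prod.swap) measurable_swap

lemma BM.curry_left {f : α → β → ℝ} (hf : BM (Function.uncurry f)) (x : α) : BM (f x) :=
  hf.comp (g := Prod.mk x) measurable_prodMk_left

lemma BM.curry_right {f : α → β → ℝ} (hf : BM (Function.uncurry f)) (y : β) :
    BM fun x => f x y :=
  hf.comp (g := fun x => (x, y)) measurable_prodMk_right

/-- Contraction of oscillations under a kernel density with values in `[lo, hi]`. -/
lemma exists_center_contraction (m : Measure α) [IsFiniteMeasure m] {f : α → ℝ} (hf : BM f)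
    {c a lo hi : ℝ} (hlo : 0 < lo) (hhi : lo ≤ hi) (hfc : ∀ x, |f x - c| ≤ a) :
    ∃ c', ∀ k : α → ℝ, Measurable k → (∀ x, lo ≤ k x) → (∀ x, k x ≤ hi) →
      |∫ x, k x * f x ∂m - c' * ∫ x, k x ∂m| ≤ (1 - lo / hi) * a * ∫ x, k x ∂m := by
  have hhi0 : 0 < hi := hlo.trans_le hhi
  rcases eq_or_ne (m.real Set.univ) 0 with h0 | h0
  · have : m = 0 := by
      rw [← Measure.measure_univ_eq_zero]
      simpa [Measure.real, ENNReal.toReal_eq_zero_iff] using h0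
    exact ⟨0, fun k _ _ _ => by simp [this]⟩
  have hm : 0 < m.real Set.univ := lt_of_le_of_ne measureReal_nonneg (Ne.symm h0)
  set α' := lo / hi with hα
  set fb := (∫ x, (f x - c) ∂m) / m.real Set.univ with hfb
  -- The new center is chosen before the kernel `k`, so one center serves all kernels with values in
  -- `[lo, hi]`. This uniformity is what is meant by a bounded oscillation of the image.
  refine ⟨c + α' * fb, fun k hk hk1 hk2 => ?_⟩
  have hkB : BM k := ⟨hk, hi, fun x => by rw [abs_of_pos (hlo.trans_le (hk1 x))]; exact hk2 x⟩
  have hfB : BM fun x => f x - c := hf.sub (BM.const c)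
  set K := ∫ x, k x ∂m with hK
  have hKle : K ≤ hi * m.real Set.univ := by
    calc K ≤ ∫ _, hi ∂m := integral_mono (hkB.integrable m) (integrable_const _) hk2
      _ = _ := by simp [mul_comm]
  -- Minorization: `k` dominates the constant `α' K / m(univ)`. The constant part only sees the mean
  -- of `f`, hence goes into the center, and the nonnegative remainder has mass `(1 - α') K`.
  have hkey : α' * (K / m.real Set.univ) ≤ lo := by
    have : K / m.real Set.univ ≤ hi := by rw [div_le_iff₀ hm]; exact hKle
    calc α' * (K / m.real Set.univ) ≤ α' * hi := by gcongr
      _ = lo := by rw [hα]; field_simp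
  have e1 : ∫ x, k x * f x ∂m - (c + α' * fb) * K
      = ∫ x, (k x - α' * (K / m.real Set.univ)) * (f x - c) ∂m := by
    have : ∀ x, (k x - α' * (K / m.real Set.univ)) * (f x - c)
        = (k x * f x - c * k x) - α' * (K / m.real Set.univ) * (f x - c) := fun x => by ring
    simp_rw [this]
    rw [integral_sub, integral_sub, integral_const_mul, integral_const_mul, hfb]
    · ring
    · exact (hkB.mul hf).integrable m
    · exact ((BM.const c).mul hkB).integrable m
    · exact ((hkB.mul hf).sub ((BM.const c).mul hkB)).integrable m
    · exact ((BM.const _).mul hfB).integrable m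
  rw [e1]
  have e2 : (1 - α') * a * K = ∫ x, (k x - α' * (K / m.real Set.univ)) * a ∂m := by
    rw [integral_mul_const, integral_sub (hkB.integrable m) (integrable_const _), integral_const,
      smul_eq_mul, ← hK]
    field_simp
  rw [e2]
  refine (abs_integral_le_integral_abs).trans (integral_mono
    ((((hkB.sub (BM.const _)).mul hfB).integrable m).abs)
    (((hkB.sub (BM.const _)).mul (BM.const a)).integrable m) fun x => ?_)
  have : 0 ≤ k x - α' * (K / m.real Set.univ) := sub_nonneg.2 (hkey.trans (hk1 x))
  change |_| ≤ _
  rw [abs_mul, abs_of_nonneg this]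
  exact mul_le_mul_of_nonneg_left (hfc x) this

end BoundedMeasurable

/-- The standing assumptions: strong mixing, normalized reference measures, compatible schedules
and bounded increments of the additive functionals. -/
structure Regular {X : ℕ → Type u} [∀ n, MeasurableSpace (X n)] {M : PathModel X}
    (P : Proposal M) (h : AdditiveTerms X) (ρ ε : ℕ → Bool) (εl εu δ γ H : ℝ≥0) : Prop where
  εl_pos : 0 < εl
  prob : ∀ n, IsProbabilityMeasure (M.μ (n + 1))
  mix : StrongMixing P εl εu δ γ
  backward : ∀ n, ρ n = false → ε n = false
  incr_le : ∀ n x y, |h.incr n x y| ≤ H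
  init_incr_le : ∀ x y, |h.init x + h.incr 0 x y| ≤ H

/-! ### Unnormalized marginals and the forward and backward operators. -/

section Limits

variable {X : ℕ → Type u} [∀ n, MeasurableSpace (X n)]

/-- The unnormalized marginal at time `n` of the path measure. -/
noncomputable def fwd (M : PathModel X) : ∀ n, Measure (X n)
  | 0 => (M.μ 0).withDensity fun x => (M.χ x : ℝ≥0∞)
  | n + 1 => (M.μ (n + 1)).withDensity fun y => ∫⁻ x, (M.ell n x y : ℝ≥0∞) ∂(fwd M n)

/-- `∫ ellₙ(x, y) u(x, y) μ(dy)`. -/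
noncomputable def fwdInt (M : PathModel X) (n : ℕ) (u : X n → X (n + 1) → ℝ) (x : X n) : ℝ :=
  ∫ y, M.ell n x y * u x y ∂(M.μ (n + 1))

/-- `∫ ellₙ(x, y) u(x, y) γₙ(dx)`, with `γₙ` the unnormalized marginal at time `n`. -/
noncomputable def backInt (M : PathModel X) (n : ℕ) (u : X n → X (n + 1) → ℝ) (y : X (n + 1)) :
    ℝ :=
  ∫ x, M.ell n x y * u x y ∂(fwd M n)

/-- The total mass of `backInt`. -/
noncomputable def backMass (M : PathModel X) (n : ℕ) (y : X (n + 1)) : ℝ :=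
  ∫ x, (M.ell n x y : ℝ) ∂(fwd M n)

variable {M : PathModel X} {P : Proposal M} {h : AdditiveTerms X} {ρ ε : ℕ → Bool}
  {εl εu δ γ H : ℝ≥0}

namespace Regular

lemma lo_pos (A : Regular P h ρ ε εl εu δ γ H) : (0 : ℝ) < εl := by exact_mod_cast A.εl_pos

lemma lo_le (A : Regular P h ρ ε εl εu δ γ H) (n : ℕ) (x : X n) (y : X (n + 1)) :
    (εl : ℝ) ≤ M.ell n x y := by exact_mod_cast A.mix.ell_lower n x y

lemma le_hi (A : Regular P h ρ ε εl εu δ γ H) (n : ℕ) (x : X n) (y : X (n + 1)) :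
    (M.ell n x y : ℝ) ≤ εu := by exact_mod_cast A.mix.ell_upper n x y

lemma bm_ell (A : Regular P h ρ ε εl εu δ γ H) (n : ℕ) :
    BM (Function.uncurry fun x y => (M.ell n x y : ℝ)) :=
  ⟨(M.measurable_ell n).coe_nnreal_real, εu, fun q => by
    simpa [Function.uncurry] using A.le_hi n q.1 q.2⟩

lemma nonempty_succ (A : Regular P h ρ ε εl εu δ γ H) (n : ℕ) : Nonempty (X (n + 1)) := by
  have := A.prob n
  exact nonempty_of_isProbabilityMeasure (M.μ (n + 1))

/-- The initial term is only controlled together with the first increment; subtracting the bound on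
that increment, at any second point, costs the factor two. -/
lemma abs_init_le (A : Regular P h ρ ε εl εu δ γ H) (x : X 0) : |h.init x| ≤ 2 * H := by
  obtain ⟨y⟩ := A.nonempty_succ 0
  have h1 := A.incr_le 0 x y
  have h2 := A.init_incr_le x y
  rw [abs_le] at *
  constructor <;> linarith [h1.1, h1.2, h2.1, h2.2]

lemma bm_init (A : Regular P h ρ ε εl εu δ γ H) : BM h.init :=
  ⟨h.measurable_init, _, A.abs_init_le⟩

lemma bm_incr (A : Regular P h ρ ε εl εu δ γ H) (n : ℕ) : BM (Function.uncurry (h.incr n)) :=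
  ⟨h.measurable_incr n, H, fun q => A.incr_le n q.1 q.2⟩

lemma measurable_lintegral_ell [∀ n, IsFiniteMeasure (fwd M n)] (n : ℕ) :
    Measurable fun y => ∫⁻ x, (M.ell n x y : ℝ≥0∞) ∂(fwd M n) :=
  Measurable.lintegral_prod_left' (f := fun q : X n × X (n + 1) => (M.ell n q.1 q.2 : ℝ≥0∞))
    (M.measurable_ell n).coe_nnreal_ennreal

lemma isFiniteMeasure_fwd (A : Regular P h ρ ε εl εu δ γ H) (n : ℕ) :
    IsFiniteMeasure (fwd M n) := by
  induction n with
  | zero =>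
    refine ⟨?_⟩
    simpa [fwd] using lt_top_iff_ne_top.2 M.χ_mass_ne_top
  | succ n ih =>
    have := A.prob n
    refine ⟨?_⟩
    rw [fwd, withDensity_apply _ MeasurableSet.univ, Measure.restrict_univ]
    calc ∫⁻ y, ∫⁻ x, (M.ell n x y : ℝ≥0∞) ∂(fwd M n) ∂(M.μ (n + 1))
        ≤ ∫⁻ _, ∫⁻ _, (εu : ℝ≥0∞) ∂(fwd M n) ∂(M.μ (n + 1)) := by
          gcongr with y x
          exact_mod_cast A.mix.ell_upper n x y
      _ < ∞ := by
          simp only [lintegral_const, measure_univ, mul_one]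
          exact ENNReal.mul_lt_top ENNReal.coe_lt_top (measure_lt_top _ _)

lemma toReal_lintegral_ell (A : Regular P h ρ ε εl εu δ γ H) (n : ℕ) (y : X (n + 1)) :
    (∫⁻ x, (M.ell n x y : ℝ≥0∞) ∂(fwd M n)).toReal = backMass M n y := by
  have := A.isFiniteMeasure_fwd n
  rw [backMass, integral_eq_lintegral_of_nonneg_ae (ae_of_all _ fun x => by positivity)
    ((A.bm_ell n).curry_right y).1.aestronglyMeasurable]
  simp

lemma integral_fwd_succ (A : Regular P h ρ ε εl εu δ γ H) (n : ℕ) (f : X (n + 1) → ℝ) :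
    ∫ y, f y ∂(fwd M (n + 1)) = ∫ y, backMass M n y * f y ∂(M.μ (n + 1)) := by
  have := A.isFiniteMeasure_fwd
  rw [fwd, integral_withDensity_eq_integral_toReal_smul (measurable_lintegral_ell n)]
  · simp [A.toReal_lintegral_ell]
  · refine ae_of_all _ fun y => ?_
    calc ∫⁻ x, (M.ell n x y : ℝ≥0∞) ∂(fwd M n) ≤ ∫⁻ _, (εu : ℝ≥0∞) ∂(fwd M n) := by
          gcongr with x
          exact_mod_cast A.mix.ell_upper n x y
      _ < ∞ := by
          rw [lintegral_const]
          exact ENNReal.mul_lt_top ENNReal.coe_lt_top (measure_lt_top _ _)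

lemma bm_fwdInt (A : Regular P h ρ ε εl εu δ γ H) (n : ℕ) {u : X n → X (n + 1) → ℝ}
    (hu : BM (Function.uncurry u)) : BM (fwdInt M n u) := by
  have := A.prob n
  exact BM.integral_right (f := fun x y => M.ell n x y * u x y) ((A.bm_ell n).mul hu) _

lemma bm_backInt (A : Regular P h ρ ε εl εu δ γ H) (n : ℕ) {u : X n → X (n + 1) → ℝ}
    (hu : BM (Function.uncurry u)) : BM (backInt M n u) := by
  have := A.isFiniteMeasure_fwd n
  exact BM.integral_right (f := fun y x => M.ell n x y * u x y) ((A.bm_ell n).mul hu).swap _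

lemma bm_backMass (A : Regular P h ρ ε εl εu δ γ H) (n : ℕ) : BM (backMass M n) := by
  have := A.isFiniteMeasure_fwd n
  exact BM.integral_right (f := fun y x => (M.ell n x y : ℝ)) (A.bm_ell n).swap _

lemma integral_backInt (A : Regular P h ρ ε εl εu δ γ H) (n : ℕ) {u : X n → X (n + 1) → ℝ}
    (hu : BM (Function.uncurry u)) :
    ∫ y, backInt M n u y ∂(M.μ (n + 1)) = ∫ x, fwdInt M n u x ∂(fwd M n) := by
  have := A.prob n
  have := A.isFiniteMeasure_fwd n
  unfold backInt fwdInt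
  rw [integral_integral_swap]
  exact BM.integrable (f := Function.uncurry fun y x => M.ell n x y * u x y)
    ((A.bm_ell n).mul hu).swap _

/-- A lower bound independent of `y`: quotients by `backMass` stay bounded, and rates of convergence
of such quotients are uniform in `y`. -/
lemma lo_mul_le_backMass (A : Regular P h ρ ε εl εu δ γ H) (n : ℕ) (y : X (n + 1)) :
    εl * (fwd M n).real Set.univ ≤ backMass M n y := by
  have := A.isFiniteMeasure_fwd n
  calc εl * (fwd M n).real Set.univ = ∫ _, (εl : ℝ) ∂(fwd M n) := by simp [mul_comm]
    _ ≤ _ := integral_mono (integrable_const _) (((A.bm_ell n).curry_right y).integrable _)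
        fun x => A.lo_le n x y

lemma fwd_univ_succ (A : Regular P h ρ ε εl εu δ γ H) (n : ℕ) :
    (fwd M (n + 1)).real Set.univ = ∫ y, backMass M n y ∂(M.μ (n + 1)) := by
  have := A.integral_fwd_succ n (fun _ => 1)
  simpa using this

lemma lo_mul_le_fwd (A : Regular P h ρ ε εl εu δ γ H) (n : ℕ) :
    εl * (fwd M n).real Set.univ ≤ (fwd M (n + 1)).real Set.univ := by
  have := A.prob n
  rw [A.fwd_univ_succ]
  calc εl * (fwd M n).real Set.univ = ∫ _, εl * (fwd M n).real Set.univ ∂(M.μ (n + 1)) := by simp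
    _ ≤ _ := integral_mono (integrable_const _) ((A.bm_backMass n).integrable _)
        fun y => A.lo_mul_le_backMass n y

lemma fwd_pos (A : Regular P h ρ ε εl εu δ γ H) (n : ℕ) : 0 < (fwd M n).real Set.univ := by
  induction n with
  | zero =>
    have := A.isFiniteMeasure_fwd 0
    rw [Measure.real, ENNReal.toReal_pos_iff]
    refine ⟨?_, measure_lt_top _ _⟩
    simpa [fwd, pos_iff_ne_zero] using M.χ_mass_ne_zero
  | succ n ih => exact (mul_pos A.lo_pos ih).trans_le (A.lo_mul_le_fwd n)

lemma backMass_pos (A : Regular P h ρ ε εl εu δ γ H) (n : ℕ) (y : X (n + 1)) :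
    0 < backMass M n y :=
  (mul_pos A.lo_pos (A.fwd_pos n)).trans_le (A.lo_mul_le_backMass n y)

end Regular

end Limits

/-! ### Limiting conditional moments, their recursions and the pull-back of test functions. -/

section Moments

variable {X : ℕ → Type u} [∀ n, MeasurableSpace (X n)]

/-- The moments of the average of two independent copies if `e` is true, and the moments `b`
themselves otherwise. -/
noncomputable def combineMoments (e : Bool) (b : ℕ → ℝ) (k : ℕ) : ℝ :=
  if e then ∑ i ∈ Finset.range (k + 1), b i * b (k - i) * (k.choose i) * 2⁻¹ ^ k else b k

/-- The moments of a statistic with moments `m` that is shifted by `h̃ₙ(x, y)`. -/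
noncomputable def shiftMoments (h : AdditiveTerms X) (n : ℕ) (m : ℕ → X n → ℝ) (k : ℕ)
    (x : X n) (y : X (n + 1)) : ℝ :=
  ∑ j ∈ Finset.range (k + 1), m j x * h.incr n x y ^ (k - j) * (k.choose j)

/-- The limiting conditional moments of the statistic given the position of the particle. -/
noncomputable def mom (M : PathModel X) (h : AdditiveTerms X) (ε : ℕ → Bool) :
    ∀ n, ℕ → X n → ℝ
  | 0, k, x => h.init x ^ k
  | n + 1, k, y => combineMoments (ε n) (fun i =>
      backInt M n (shiftMoments h n (mom M h ε n) i) y / backMass M n y) k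

/-- The limiting conditional variance of the statistic given the position of the particle. -/
noncomputable def condVar (M : PathModel X) (h : AdditiveTerms X) (ε : ℕ → Bool) (n : ℕ)
    (x : X n) : ℝ :=
  mom M h ε n 2 x - mom M h ε n 1 x ^ 2

/-- Upper bounds for the conditional variances. -/
noncomputable def condVarBound (ε : ℕ → Bool) (b : ℝ) : ℕ → ℝ
  | 0 => 0
  | n + 1 => (condVarBound ε b n + b) / (1 + ((ε n).toNat : ℝ))

/-- The first component of the image of `ω (τ g(ξ) + ψ(ξ))` under one step. -/
noncomputable def pullFst (M : PathModel X) (n : ℕ) (g : X (n + 1) → ℝ) : X n → ℝ :=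
  fwdInt M n fun _ y => g y

/-- The second component of the image of `ω (τ g(ξ) + ψ(ξ))` under one step. -/
noncomputable def pullSnd (M : PathModel X) (h : AdditiveTerms X) (n : ℕ)
    (g ψ : X (n + 1) → ℝ) : X n → ℝ :=
  fwdInt M n fun x y => h.incr n x y * g y + ψ y

/-- The limiting second moment of `τ g(ξ) + ψ(ξ)` under the unnormalized marginal. -/
noncomputable def secondMoment (M : PathModel X) (h : AdditiveTerms X) (ε : ℕ → Bool) (n : ℕ)
    (g ψ : X n → ℝ) : ℝ :=
  ∫ x, (g x ^ 2 * condVar M h ε n x + (g x * mom M h ε n 1 x + ψ x) ^ 2) ∂(fwd M n)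

/-- The ratio of the limiting weighted empirical measure to the unnormalized marginal. -/
noncomputable def normConst {M : PathModel X} (P : Proposal M) (ρ : ℕ → Bool) : ℕ → ℝ
  | 0 => 1
  | n + 1 => if ρ n then (∫ x, (P.ϑ n x : ℝ) ∂(fwd M n))⁻¹ else normConst P ρ n

/-- An almost sure bound of the weights. -/
noncomputable def weightBound (ρ : ℕ → Bool) (δ : ℝ) : ℕ → ℝ
  | 0 => δ
  | n + 1 => if ρ n then δ else δ * weightBound ρ δ n

/-- A bound of the contribution of the selection steps to the asymptotic variance. -/
noncomputable def selectionVar {M : PathModel X} (P : Proposal M) (h : AdditiveTerms X)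
    (ρ ε : ℕ → Bool) (δ : ℝ) : ∀ n, (X n → ℝ) → (X n → ℝ) → ℝ
  | 0, _, _ => 0
  | n + 1, g, ψ => selectionVar P h ρ ε δ n (pullFst M n g) (pullSnd M h n g ψ) +
      if ρ n then weightBound ρ δ n / normConst P ρ n *
        secondMoment M h ε n (pullFst M n g) (pullSnd M h n g ψ) else 0

variable {M : PathModel X} {P : Proposal M} {h : AdditiveTerms X} {ρ ε : ℕ → Bool}
  {εl εu δ γ H : ℝ≥0}

namespace Regular

lemma bm_shiftMoments (A : Regular P h ρ ε εl εu δ γ H) (n : ℕ) {m : ℕ → X n → ℝ}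
    (hm : ∀ k, BM (m k)) (k : ℕ) : BM (Function.uncurry (shiftMoments h n m k)) := by
  unfold shiftMoments
  refine BM.sum (α := X n × X (n + 1)) (Finset.range (k + 1))
    (f := fun j q => m j q.1 * h.incr n q.1 q.2 ^ (k - j) * (k.choose j)) fun j _ => ?_
  exact (((hm j).comp measurable_fst).mul ((A.bm_incr n).pow (k - j))).mul (BM.const _)

lemma bm_mom (A : Regular P h ρ ε εl εu δ γ H) (n k : ℕ) : BM (mom M h ε n k) := by
  induction n generalizing k with
  | zero => exact A.bm_init.pow k
  | succ n ih =>
    have hb : ∀ i, BM fun y => backInt M n (shiftMoments h n (mom M h ε n) i) y / backMass M n y :=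
      fun i => (A.bm_backInt n (A.bm_shiftMoments n ih i)).div (A.bm_backMass n).1
        (mul_pos A.lo_pos (A.fwd_pos n)) (A.lo_mul_le_backMass n)
    change BM fun y => combineMoments (ε n) (fun i =>
      backInt M n (shiftMoments h n (mom M h ε n) i) y / backMass M n y) k
    unfold combineMoments
    split_ifs
    · exact BM.sum (α := X (n + 1)) _ fun i _ =>
        (((hb i).mul (hb (k - i))).mul (BM.const _)).mul (BM.const _)
    · exact hb k

lemma mom_zero (A : Regular P h ρ ε εl εu δ γ H) (n : ℕ) (x : X n) : mom M h ε n 0 x = 1 := by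
  induction n with
  | zero => simp [mom]
  | succ n ih =>
    have : backInt M n (shiftMoments h n (mom M h ε n) 0) x / backMass M n x = 1 := by
      rw [div_eq_one_iff_eq (A.backMass_pos n x).ne']
      simp [backInt, shiftMoments, ih, backMass]
    unfold mom combineMoments
    simp [this]

lemma bm_shift (A : Regular P h ρ ε εl εu δ γ H) (n : ℕ) :
    BM (Function.uncurry fun x y => mom M h ε n 1 x + h.incr n x y) :=
  ((A.bm_mom n 1).comp measurable_fst).add (A.bm_incr n)

lemma shiftMoments_zero (A : Regular P h ρ ε εl εu δ γ H) (n : ℕ) :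
    shiftMoments h n (mom M h ε n) 0 = fun _ _ => 1 := by
  funext x y
  simp [shiftMoments, A.mom_zero]

lemma shiftMoments_one (A : Regular P h ρ ε εl εu δ γ H) (n : ℕ) :
    shiftMoments h n (mom M h ε n) 1 = fun x y => mom M h ε n 1 x + h.incr n x y := by
  funext x y
  simp [shiftMoments, Finset.sum_range_succ, A.mom_zero]
  ring

lemma shiftMoments_two (A : Regular P h ρ ε εl εu δ γ H) (n : ℕ) :
    shiftMoments h n (mom M h ε n) 2 =
      fun x y => condVar M h ε n x + (mom M h ε n 1 x + h.incr n x y) ^ 2 := by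
  funext x y
  simp [shiftMoments, Finset.sum_range_succ, A.mom_zero, condVar]
  ring

lemma backInt_one (n : ℕ) (y : X (n + 1)) : backInt M n (fun _ _ => 1) y = backMass M n y := by
  simp [backInt, backMass]

/-- The mean of an average of two identically distributed variables is their common mean, so the
recursion is the same with and without backward sampling. -/
lemma backMass_mul_mom_one (A : Regular P h ρ ε εl εu δ γ H) (n : ℕ) (y : X (n + 1)) :
    backMass M n y * mom M h ε (n + 1) 1 y =
      backInt M n (fun x y => mom M h ε n 1 x + h.incr n x y) y := by
  have hy := (A.backMass_pos n y).ne'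
  have e0 : mom M h ε (n + 1) 1 y = backInt M n (shiftMoments h n (mom M h ε n) 1) y
      / backMass M n y := by
    unfold mom combineMoments
    split_ifs
    · simp only [Finset.sum_range_succ, A.shiftMoments_zero, backInt_one, Finset.sum_range_zero]
      simp [div_self hy]
      ring
    · rfl
  rw [e0, A.shiftMoments_one]
  field_simp

/-- The average of two independent copies has half the variance. This is where backward sampling
gains, and the origin of the factors `(1 + ε)⁻¹` in the final bound. -/
lemma backMass_mul_condVar (A : Regular P h ρ ε εl εu δ γ H) (n : ℕ) (y : X (n + 1)) :
    (1 + ((ε n).toNat : ℝ)) * (backMass M n y * condVar M h ε (n + 1) y) =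
      backInt M n (fun x y => condVar M h ε n x + (mom M h ε n 1 x + h.incr n x y) ^ 2) y
        - backMass M n y * mom M h ε (n + 1) 1 y ^ 2 := by
  have hy := (A.backMass_pos n y).ne'
  have e1 := A.backMass_mul_mom_one n y
  rw [← A.shiftMoments_one] at e1
  have e1' : backInt M n (shiftMoments h n (mom M h ε n) 1) y / backMass M n y
      = mom M h ε (n + 1) 1 y := by
    rw [← e1]; field_simp
  rw [← A.shiftMoments_two, condVar]
  have e2 : mom M h ε (n + 1) 2 y = combineMoments (ε n) (fun i =>
      backInt M n (shiftMoments h n (mom M h ε n) i) y / backMass M n y) 2 := rfl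
  rw [e2]
  unfold combineMoments
  cases hε : ε n
  · simp
    field_simp
  · simp only [if_true, Finset.sum_range_succ, A.shiftMoments_zero, backInt_one,
      Finset.sum_range_zero, Nat.sub_self, Nat.sub_zero, e1', Nat.reduceSub, Bool.toNat_true,
      Nat.choose_zero_right, Nat.choose_self, Nat.choose_one_right, Nat.cast_one, Nat.cast_ofNat,
      div_self hy]
    field_simp
    ring

lemma bm_condVar (A : Regular P h ρ ε εl εu δ γ H) (n : ℕ) : BM (condVar M h ε n) :=
  (A.bm_mom n 2).sub ((A.bm_mom n 1).pow 2)

lemma integral_backInt_mul (A : Regular P h ρ ε εl εu δ γ H) (n : ℕ) {u : X n → X (n + 1) → ℝ}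
    (hu : BM (Function.uncurry u)) {g : X (n + 1) → ℝ} (hg : BM g) :
    ∫ y, backInt M n u y * g y ∂(M.μ (n + 1)) =
      ∫ x, fwdInt M n (fun x y => u x y * g y) x ∂(fwd M n) := by
  rw [← A.integral_backInt n (u := fun x y => u x y * g y) (hu.mul (hg.comp measurable_snd))]
  refine integral_congr_ae (ae_of_all _ fun y => ?_)
  simp only [backInt, ← integral_mul_const, mul_assoc]

lemma bm_pullFst (A : Regular P h ρ ε εl εu δ γ H) (n : ℕ) {g : X (n + 1) → ℝ} (hg : BM g) :
    BM (pullFst M n g) := A.bm_fwdInt n (hg.comp measurable_snd)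

lemma bm_pullSnd (A : Regular P h ρ ε εl εu δ γ H) (n : ℕ) {g ψ : X (n + 1) → ℝ} (hg : BM g)
    (hψ : BM ψ) : BM (pullSnd M h n g ψ) :=
  A.bm_fwdInt n (((A.bm_incr n).mul (hg.comp measurable_snd)).add (hψ.comp measurable_snd))

/-- Tower property in the limit, by Fubini. In particular a centered pair stays centered under the
pull-back. -/
lemma integral_fwd_succ_affine (A : Regular P h ρ ε εl εu δ γ H) (n : ℕ) {g ψ : X (n + 1) → ℝ}
    (hg : BM g) (hψ : BM ψ) :
    ∫ y, (g y * mom M h ε (n + 1) 1 y + ψ y) ∂(fwd M (n + 1)) =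
      ∫ x, (pullFst M n g x * mom M h ε n 1 x + pullSnd M h n g ψ x) ∂(fwd M n) := by
  have := A.prob n
  have hs := A.bm_shift (ε := ε) n
  have h1 : BM (Function.uncurry fun (_ : X n) (_ : X (n + 1)) => (1 : ℝ)) := BM.const 1
  rw [A.integral_fwd_succ]
  have e : ∀ y, backMass M n y * (g y * mom M h ε (n + 1) 1 y + ψ y) =
      backInt M n (fun x y => mom M h ε n 1 x + h.incr n x y) y * g y
        + backInt M n (fun _ _ => 1) y * ψ y := fun y => by
    rw [← A.backMass_mul_mom_one, backInt_one]; ring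
  simp_rw [e]
  have := A.isFiniteMeasure_fwd n
  rw [integral_add (((A.bm_backInt n hs).mul hg).integrable _)
    (((A.bm_backInt n h1).mul hψ).integrable _), A.integral_backInt_mul n hs hg,
    A.integral_backInt_mul n h1 hψ,
    ← integral_add
      ((A.bm_fwdInt n (u := fun x y => (mom M h ε n 1 x + h.incr n x y) * g y)
        (hs.mul (hg.comp measurable_snd))).integrable _)
      ((A.bm_fwdInt n (u := fun _ y => 1 * ψ y) (h1.mul (hψ.comp measurable_snd))).integrable _)]
  refine integral_congr_ae (ae_of_all _ fun x => ?_)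
  simp only [pullFst, pullSnd, fwdInt]
  have hl := (A.bm_ell n).curry_left x
  have i1 := hl.mul ((hs.curry_left x).mul hg)
  have i2 := hl.mul ((h1.curry_left x).mul hψ)
  have i3 := hl.mul hg
  have i4 := hl.mul ((((A.bm_incr n).curry_left x).mul hg).add hψ)
  rw [← integral_mul_const]
  refine (integral_add (i1.integrable _) (i2.integrable _)).symm.trans
    (Eq.trans ?_ (integral_add ((i3.mul (BM.const _)).integrable _) (i4.integrable _)))
  refine integral_congr_ae (ae_of_all _ fun y => ?_)
  ring

lemma integral_fwd_succ_fst (A : Regular P h ρ ε εl εu δ γ H) (n : ℕ) {g : X (n + 1) → ℝ}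
    (hg : BM g) :
    ∫ y, g y ∂(fwd M (n + 1)) = ∫ x, pullFst M n g x ∂(fwd M n) := by
  rw [A.integral_fwd_succ]
  have := A.integral_backInt_mul n (u := fun _ _ => 1) (BM.const 1) hg
  simp only [backInt_one, one_mul] at this
  exact this

end Regular

end Moments

/-! ### Time-uniform oscillation bounds and second-moment bounds from strong mixing. -/

section MixingBounds

variable {X : ℕ → Type u} [∀ n, MeasurableSpace (X n)] {M : PathModel X} {P : Proposal M}
  {h : AdditiveTerms X} {ρ ε : ℕ → Bool} {εl εu δ γ H : ℝ≥0}

/-- A bound of the oscillations of the conditional means. -/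
noncomputable def oscBound (εl εu H : ℝ≥0) : ℝ := 2 * H * (εu / εl)

lemma oscBound_nonneg : 0 ≤ oscBound εl εu H := by unfold oscBound; positivity

lemma two_mul_le_oscBound (hl : 0 < εl) (hlu : εl ≤ εu) : 2 * (H : ℝ) ≤ oscBound εl εu H := by
  have h0 : (0 : ℝ) < εl := by exact_mod_cast hl
  have : (1 : ℝ) ≤ εu / εl := by rw [one_le_div h0]; exact_mod_cast hlu
  unfold oscBound
  nlinarith [H.coe_nonneg]

/-- The contraction removes `(εl / εu) * oscBound = 2 H` while a step adds only `H`. The spare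
factor two in `oscBound` is there for the initial term, which is bounded by `2 H`. -/
lemma contraction_oscBound (hl : 0 < εl) (hlu : εl ≤ εu) :
    (1 - (εl : ℝ) / εu) * oscBound εl εu H + H ≤ oscBound εl εu H := by
  have h0 : (0 : ℝ) < εl := by exact_mod_cast hl
  have h1 : (0 : ℝ) < εu := h0.trans_le (by exact_mod_cast hlu)
  have : (εl : ℝ) / εu * oscBound εl εu H = 2 * H := by
    unfold oscBound
    field_simp
  rw [sub_mul, this]
  linarith [H.coe_nonneg]

/-- Functions that arise by pulling back `(1, const)` from time `n`; the total mass is `G`. -/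
structure Tame (M : PathModel X) (h : AdditiveTerms X) (ε : ℕ → Bool) (εl εu H : ℝ≥0) (n : ℕ)
    (G : ℝ) (g ψ : X n → ℝ) : Prop where
  bm_fst : BM g
  bm_snd : BM ψ
  -- A Harnack-type inequality: it compares the supremum of `g` with its total mass.
  ratio : ∃ lo : ℝ, 0 < lo ∧ ∀ x, lo ≤ g x ∧ g x ≤ lo * (εu / εl)
  -- A bound for the oscillation of `ψ / g`, in a form without division.
  center : ∃ c : ℝ, ∀ x, |ψ x - c * g x| ≤ oscBound εl εu H * g x
  mass : ∫ x, g x ∂(fwd M n) = G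
  centered : ∫ x, (g x * mom M h ε n 1 x + ψ x) ∂(fwd M n) = 0

lemma abs_integral_mul_le {α : Type*} [MeasurableSpace α] (m : Measure α) [IsFiniteMeasure m]
    {k u : α → ℝ} {C : ℝ} (hk : BM k) (hk0 : ∀ x, 0 ≤ k x) (hu : BM u) (huC : ∀ x, |u x| ≤ C) :
    |∫ x, k x * u x ∂m| ≤ C * ∫ x, k x ∂m := by
  rw [← integral_const_mul]
  refine abs_integral_le_integral_abs.trans (integral_mono ((hk.mul hu).integrable m).abs
    ((hk.integrable m).const_mul _) fun x => ?_)
  simp only [abs_mul, abs_of_nonneg (hk0 x)]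
  rw [mul_comm]
  exact mul_le_mul_of_nonneg_right (huC x) (hk0 x)

namespace Regular

/-- The new conditional mean is a backward average of the old one plus an increment: the average
contracts the oscillation, the increment adds at most `H`. The center itself may drift with `n`. -/
lemma exists_center_mom (A : Regular P h ρ ε εl εu δ γ H) (hlu : εl ≤ εu) (n : ℕ) :
    ∃ c, ∀ x, |mom M h ε n 1 x - c| ≤ oscBound εl εu H := by
  induction n with
  | zero =>
    refine ⟨0, fun x => ?_⟩
    simpa [mom] using (A.abs_init_le x).trans (two_mul_le_oscBound A.εl_pos hlu)
  | succ n ih =>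
    obtain ⟨c, hc⟩ := ih
    have := A.isFiniteMeasure_fwd n
    obtain ⟨c', hc'⟩ := exists_center_contraction (fwd M n) (A.bm_mom n 1) A.lo_pos
      (show (εl : ℝ) ≤ εu by exact_mod_cast hlu) hc
    refine ⟨c', fun y => ?_⟩
    have hl := (A.bm_ell n).curry_right y
    have h1 := hc' (fun x => M.ell n x y) hl.1 (fun x => A.lo_le n x y) (fun x => A.le_hi n x y)
    have h2 := abs_integral_mul_le (fwd M n) (k := fun x => (M.ell n x y : ℝ))
      (u := fun x => h.incr n x y) hl (fun x => by positivity) ((A.bm_incr n).curry_right y)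
      (fun x => A.incr_le n x y)
    have e := A.backMass_mul_mom_one n y
    have e2 : backInt M n (fun x y => mom M h ε n 1 x + h.incr n x y) y =
        ∫ x, M.ell n x y * mom M h ε n 1 x ∂(fwd M n)
          + ∫ x, M.ell n x y * h.incr n x y ∂(fwd M n) := by
      unfold backInt
      rw [← integral_add ((hl.mul (A.bm_mom n 1)).integrable _)
        ((hl.mul ((A.bm_incr n).curry_right y)).integrable _)]
      simp only [mul_add]
    have hm := A.backMass_pos n y
    change |_ - c' * backMass M n y| ≤ _ * backMass M n y at h1
    change |_| ≤ _ * backMass M n y at h2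
    have h3 : |backMass M n y * (mom M h ε (n + 1) 1 y - c')|
        ≤ backMass M n y * oscBound εl εu H := by
      rw [mul_sub, e, e2]
      have h4 := mul_le_mul_of_nonneg_left (contraction_oscBound (H := H) A.εl_pos hlu) hm.le
      rw [abs_le] at *
      constructor <;> nlinarith [h1.1, h1.2, h2.1, h2.2]
    rw [abs_mul, abs_of_pos hm] at h3
    exact le_of_mul_le_mul_left h3 hm

/-- Law of total variance: before the division by `1 + ε`, the new variance is the averaged old
variance plus the variance of the moved conditional mean, which varies by at most `oscBound + H`
around a constant. -/
lemma condVar_mem (A : Regular P h ρ ε εl εu δ γ H) (hlu : εl ≤ εu) (n : ℕ) (x : X n) :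
    0 ≤ condVar M h ε n x ∧
      condVar M h ε n x ≤ condVarBound ε ((oscBound εl εu H + H) ^ 2) n := by
  induction n with
  | zero => simp [condVar, mom, condVarBound]
  | succ n ih =>
    obtain ⟨c, hc⟩ := A.exists_center_mom (h := h) (ε := ε) hlu n
    have := A.isFiniteMeasure_fwd n
    have hm := A.backMass_pos n x
    have hl := (A.bm_ell n).curry_right x
    have hv := A.bm_condVar n
    have hs := (A.bm_shift (ε := ε) n).curry_right x
    set b := (oscBound εl εu H + H) ^ 2 with hb
    set s := condVarBound ε b n with hs'
    set T' := mom M h ε (n + 1) 1 x with hT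
    have e := A.backMass_mul_condVar n x
    have e1 := A.backMass_mul_mom_one n x
    rw [← hT] at e e1
    -- Second moments about an arbitrary point `t`: the choice `t = T'` gives nonnegativity of the
    -- variance, and `t = c` the upper bound, since the mean minimizes the second moment.
    have expand : ∀ t : ℝ, ∫ z, M.ell n z x * (condVar M h ε n z +
        (mom M h ε n 1 z + h.incr n z x - t) ^ 2) ∂(fwd M n) =
        backInt M n (fun x y => condVar M h ε n x + (mom M h ε n 1 x + h.incr n x y) ^ 2) x
          - 2 * t * (backMass M n x * T') + t ^ 2 * backMass M n x := by
      intro t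
      rw [e1]
      unfold backInt backMass
      rw [← integral_const_mul, ← integral_const_mul, ← integral_sub, ← integral_add]
      · refine integral_congr_ae (ae_of_all _ fun z => ?_)
        simp only
        ring
      · exact ((hl.mul (hv.add (hs.pow 2))).sub ((BM.const _).mul (hl.mul hs))).integrable _
      · exact ((BM.const _).mul hl).integrable _
      · exact (hl.mul (hv.add (hs.pow 2))).integrable _
      · exact ((BM.const _).mul (hl.mul hs)).integrable _
    have low : 0 ≤ ∫ z, M.ell n z x * (condVar M h ε n z +
        (mom M h ε n 1 z + h.incr n z x - T') ^ 2) ∂(fwd M n) :=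
      integral_nonneg fun z => mul_nonneg (by positivity) (add_nonneg (ih z).1 (sq_nonneg _))
    have up : ∫ z, M.ell n z x * (condVar M h ε n z +
        (mom M h ε n 1 z + h.incr n z x - c) ^ 2) ∂(fwd M n) ≤ backMass M n x * (s + b) := by
      unfold backMass
      rw [← integral_mul_const]
      refine integral_mono ((hl.mul (hv.add ((hs.sub (BM.const c)).pow 2))).integrable _)
        ((hl.mul (BM.const _)).integrable _) fun z => ?_
      refine mul_le_mul_of_nonneg_left (add_le_add (ih z).2 ?_) (by positivity)
      rw [hb, ← sq_abs]
      have h1 : |mom M h ε n 1 z + h.incr n z x - c| ≤ oscBound εl εu H + H := by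
        calc _ = |(mom M h ε n 1 z - c) + h.incr n z x| := by ring_nf
          _ ≤ _ := (abs_add_le _ _).trans (add_le_add (hc z) (A.incr_le n z x))
      exact pow_le_pow_left₀ (abs_nonneg _) h1 2
    rw [expand] at low up
    have hpos : (0 : ℝ) < 1 + ((ε n).toNat : ℝ) := by positivity
    constructor
    · have : 0 ≤ ((1 + ((ε n).toNat : ℝ)) * backMass M n x) * condVar M h ε (n + 1) x := by
        rw [mul_assoc, e]; linarith
      exact nonneg_of_mul_nonneg_right this (by positivity)
    · change _ ≤ (s + b) / _
      rw [le_div_iff₀ hpos]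
      refine le_of_mul_le_mul_left ?_ hm
      calc _ = (1 + ((ε n).toNat : ℝ)) * (backMass M n x * condVar M h ε (n + 1) x) := by ring
        _ ≤ _ := by
          rw [e]
          nlinarith [mul_nonneg hm.le (sq_nonneg (T' - c))]

lemma tame_one (A : Regular P h ρ ε εl εu δ γ H) (hlu : εl ≤ εu) (n : ℕ) :
    Tame M h ε εl εu H n ((fwd M n).real Set.univ) (fun _ => 1)
      (fun _ => -((∫ x, mom M h ε n 1 x ∂(fwd M n)) / (fwd M n).real Set.univ)) where
  bm_fst := BM.const 1
  bm_snd := BM.const _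
  ratio := ⟨1, one_pos, fun _ => ⟨le_rfl, by
    rw [one_mul, one_le_div A.lo_pos]; exact_mod_cast hlu⟩⟩
  center := ⟨-((∫ x, mom M h ε n 1 x ∂(fwd M n)) / (fwd M n).real Set.univ), fun _ => by
    rw [mul_one, sub_self, abs_zero, mul_one]; exact oscBound_nonneg⟩
  mass := by simp
  centered := by
    have := A.isFiniteMeasure_fwd n
    simp only [one_mul]
    rw [integral_add ((A.bm_mom n 1).integrable _) (integrable_const _), integral_const,
      smul_eq_mul]
    have := (A.fwd_pos n).ne'
    field_simp
    ring

/-- The quotient of the pulled-back pair is an average of `ψ / g + h̃` with density proportional to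
`ell * g`. Measured against `g dμ`, the kernel `ell` lies in `[εl, εu]`, so the contraction applies
and `oscBound` is reproduced exactly; all constants are independent of the number of pull-backs. -/
lemma tame_pull (A : Regular P h ρ ε εl εu δ γ H) (hlu : εl ≤ εu) {n : ℕ} {G : ℝ}
    {g ψ : X (n + 1) → ℝ} (ht : Tame M h ε εl εu H (n + 1) G g ψ) :
    Tame M h ε εl εu H n G (pullFst M n g) (pullSnd M h n g ψ) := by
  have hprob := A.prob n
  obtain ⟨lo, hlo, hlo'⟩ := ht.ratio
  obtain ⟨c, hc⟩ := ht.center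
  have hg := ht.bm_fst
  have hψ := ht.bm_snd
  have hgpos : ∀ y, 0 < g y := fun y => hlo.trans_le (hlo' y).1
  have hl := A.bm_ell n
  have hlu' : (εl : ℝ) ≤ εu := by exact_mod_cast hlu
  have hg1 : lo ≤ ∫ y, g y ∂(M.μ (n + 1)) := by
    calc lo = ∫ _, lo ∂(M.μ (n + 1)) := by simp
      _ ≤ _ := integral_mono (integrable_const _) (hg.integrable _) fun y => (hlo' y).1
  -- The ratio `εu / εl` comes afresh from the last kernel and does not accumulate.
  refine ⟨A.bm_pullFst n hg, A.bm_pullSnd n hg hψ, ⟨εl * ∫ y, g y ∂(M.μ (n + 1)),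
    mul_pos A.lo_pos (hlo.trans_le hg1), fun x => ⟨?_, ?_⟩⟩, ?_, ?_, ?_⟩
  · rw [← integral_const_mul]
    exact integral_mono ((hg.integrable _).const_mul _) (((hl.curry_left x).mul hg).integrable _)
      fun y => mul_le_mul_of_nonneg_right (A.lo_le n x y) (hgpos y).le
  · have : εl * (∫ y, g y ∂(M.μ (n + 1))) * (εu / εl) = εu * ∫ y, g y ∂(M.μ (n + 1)) := by
      have := A.lo_pos.ne'
      field_simp
    rw [this, ← integral_const_mul]
    exact integral_mono (((hl.curry_left x).mul hg).integrable _) ((hg.integrable _).const_mul _)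
      fun y => mul_le_mul_of_nonneg_right (A.le_hi n x y) (hgpos y).le
  · -- contraction with respect to the measure with density `g`
    have hgm : Measurable fun y => ENNReal.ofReal (g y) := hg.1.ennreal_ofReal
    set m := (M.μ (n + 1)).withDensity fun y => ENNReal.ofReal (g y) with hm
    have hfin : IsFiniteMeasure m := isFiniteMeasure_withDensity_ofReal (hg.integrable _).2
    have int_m : ∀ u : X (n + 1) → ℝ, ∫ y, u y ∂m = ∫ y, g y * u y ∂(M.μ (n + 1)) := by
      intro u
      rw [hm, integral_withDensity_eq_integral_toReal_smul hgm
        (ae_of_all _ fun _ => ENNReal.ofReal_lt_top)]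
      simp [ENNReal.toReal_ofReal (hgpos _).le]
    have hq : BM fun y => ψ y / g y := hψ.div hg.1 hlo fun y => (hlo' y).1
    have hqc : ∀ y, |ψ y / g y - c| ≤ oscBound εl εu H := fun y => by
      have : ψ y / g y - c = (ψ y - c * g y) / g y := by
        have := (hgpos y).ne'
        field_simp
      rw [this, abs_div, abs_of_pos (hgpos y), div_le_iff₀ (hgpos y)]
      exact hc y
    obtain ⟨c', hc'⟩ := exists_center_contraction m hq A.lo_pos hlu' hqc
    refine ⟨c', fun x => ?_⟩
    have h1 := hc' (fun y => M.ell n x y) (hl.curry_left x).1 (A.lo_le n x) (A.le_hi n x)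
    have h2 := abs_integral_mul_le m (k := fun y => (M.ell n x y : ℝ))
      (u := fun y => h.incr n x y) (hl.curry_left x) (fun y => by positivity)
      ((A.bm_incr n).curry_left x) (A.incr_le n x)
    have e1 : ∫ y, (M.ell n x y : ℝ) ∂m = pullFst M n g x := by
      rw [int_m]
      simp only [pullFst, fwdInt, mul_comm]
    have e2 : ∫ y, (M.ell n x y : ℝ) * (ψ y / g y) ∂m = ∫ y, M.ell n x y * ψ y ∂(M.μ (n + 1)) := by
      rw [int_m]
      refine integral_congr_ae (ae_of_all _ fun y => ?_)
      have := (hgpos y).ne'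
      simp only
      field_simp
    have e3 : pullSnd M h n g ψ x =
        ∫ y, M.ell n x y * ψ y ∂(M.μ (n + 1)) + ∫ y, M.ell n x y * h.incr n x y ∂m := by
      rw [int_m, ← integral_add (((hl.curry_left x).mul hψ).integrable _)
        ((hg.mul ((hl.curry_left x).mul ((A.bm_incr n).curry_left x))).integrable _)]
      unfold pullSnd fwdInt
      refine integral_congr_ae (ae_of_all _ fun y => ?_)
      simp only
      ring
    rw [e1] at h1 h2
    rw [e2] at h1
    rw [e3]
    have hp : 0 ≤ pullFst M n g x :=
      integral_nonneg fun y => mul_nonneg (by positivity) (hgpos y).le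
    have h4 := mul_le_mul_of_nonneg_right (contraction_oscBound (H := H) A.εl_pos hlu) hp
    rw [abs_le] at *
    constructor <;> nlinarith [h1.1, h1.2, h2.1, h2.2]
  · rw [← ht.mass, A.integral_fwd_succ_fst n hg]
  · rw [← ht.centered, A.integral_fwd_succ_affine n hg hψ]

/-- Pointwise `|g T + ψ| ≤ 4 a g`, with `a` the oscillation bound and `T` the conditional mean,
because the pair is centered. The supremum of `g ^ 2` is then compared with the squared mass `G ^ 2`
through the ratio bound. -/
lemma secondMoment_le (A : Regular P h ρ ε εl εu δ γ H) (hlu : εl ≤ εu) {n : ℕ} {G : ℝ}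
    {g ψ : X n → ℝ} (ht : Tame M h ε εl εu H n G g ψ) :
    secondMoment M h ε n g ψ ≤ G ^ 2 * ((εu / εl) ^ 2 / (fwd M n).real Set.univ *
      (condVarBound ε ((oscBound εl εu H + H) ^ 2) n + 16 * oscBound εl εu H ^ 2)) := by
  have hfin := A.isFiniteMeasure_fwd n
  obtain ⟨lo, hlo, hlo'⟩ := ht.ratio
  obtain ⟨c, hc⟩ := ht.center
  obtain ⟨c', hc'⟩ := A.exists_center_mom (h := h) (ε := ε) hlu n
  have hg := ht.bm_fst
  have hψ := ht.bm_snd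
  have hT := A.bm_mom (ε := ε) n 1
  have hgpos : ∀ y, 0 < g y := fun y => hlo.trans_le (hlo' y).1
  set a := oscBound εl εu H with ha
  set s := condVarBound ε ((a + H) ^ 2) n with hs
  set m := (fwd M n).real Set.univ with hm
  have hmpos : 0 < m := A.fwd_pos n
  have hGlo : lo * m ≤ G := by
    rw [← ht.mass]
    calc lo * m = ∫ _, lo ∂(fwd M n) := by simp [hm, mul_comm]
      _ ≤ _ := integral_mono (integrable_const _) (hg.integrable _) fun y => (hlo' y).1
  have hGpos : 0 < G := (mul_pos hlo hmpos).trans_le hGlo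
  have hdev : ∀ x, |g x * mom M h ε n 1 x + ψ x - (c + c') * g x| ≤ 2 * a * g x := fun x => by
    have h1 := hc x
    have h2 := mul_le_mul_of_nonneg_left (hc' x) (hgpos x).le
    rw [← abs_of_pos (hgpos x), ← abs_mul, abs_of_pos (hgpos x)] at h2
    rw [abs_le] at *
    constructor <;> nlinarith [h1.1, h1.2, h2.1, h2.2]
  -- The function `g T + ψ` stays within `2 a g` of `(c + c') g` and has integral zero, so the
  -- multiple `c + c'` is itself at most `2 a`.
  have hcent : |c + c'| ≤ 2 * a := by
    have e : ∫ x, (g x * mom M h ε n 1 x + ψ x - (c + c') * g x) ∂(fwd M n) = -(c + c') * G := by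
      rw [integral_sub (((hg.mul hT).add hψ).integrable _) ((hg.integrable _).const_mul _),
        ht.centered, integral_const_mul, ht.mass]
      ring
    have h1 : |-(c + c') * G| ≤ 2 * a * G := by
      rw [← e, ← ht.mass, ← integral_const_mul]
      exact abs_integral_le_integral_abs.trans (integral_mono
        ((((hg.mul hT).add hψ).sub ((BM.const _).mul hg)).integrable _).abs
        ((hg.integrable _).const_mul _) hdev)
    rw [abs_mul, abs_neg, abs_of_pos hGpos] at h1
    exact le_of_mul_le_mul_right h1 hGpos
  have hbd : ∀ x, |g x * mom M h ε n 1 x + ψ x| ≤ 4 * a * g x := fun x => by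
    have h1 := hdev x
    have h2 := mul_le_mul_of_nonneg_right hcent (hgpos x).le
    rw [← abs_of_pos (hgpos x), ← abs_mul, abs_of_pos (hgpos x)] at h2
    rw [abs_le] at *
    constructor <;> nlinarith [h1.1, h1.2, h2.1, h2.2]
  have hs0 : ∀ x, 0 ≤ condVar M h ε n x ∧ condVar M h ε n x ≤ s := fun x => A.condVar_mem hlu n x
  have hpt : ∀ x, g x ^ 2 * condVar M h ε n x + (g x * mom M h ε n 1 x + ψ x) ^ 2
      ≤ (lo * (εu / εl)) ^ 2 * (s + 16 * a ^ 2) := fun x => by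
    have h1 : g x ^ 2 ≤ (lo * (εu / εl)) ^ 2 := pow_le_pow_left₀ (hgpos x).le (hlo' x).2 2
    have h2 : (g x * mom M h ε n 1 x + ψ x) ^ 2 ≤ (4 * a * g x) ^ 2 := by
      rw [← sq_abs (g x * _ + _)]
      exact pow_le_pow_left₀ (abs_nonneg _) (hbd x) 2
    have h3 : 0 ≤ s := (hs0 x).1.trans (hs0 x).2
    calc _ ≤ g x ^ 2 * s + (4 * a * g x) ^ 2 :=
          add_le_add (mul_le_mul_of_nonneg_left (hs0 x).2 (sq_nonneg _)) h2
      _ = g x ^ 2 * (s + 16 * a ^ 2) := by ring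
      _ ≤ _ := mul_le_mul_of_nonneg_right h1 (by positivity)
  have hnn : 0 ≤ s + 16 * a ^ 2 := by
    obtain ⟨x⟩ : Nonempty (X n) := by
      by_contra hne
      rw [not_nonempty_iff] at hne
      have : fwd M n = 0 := Measure.eq_zero_of_isEmpty _
      rw [hm, this] at hmpos
      simp at hmpos
    have := (hs0 x).1.trans (hs0 x).2
    positivity
  calc secondMoment M h ε n g ψ
      ≤ ∫ _, (lo * (εu / εl)) ^ 2 * (s + 16 * a ^ 2) ∂(fwd M n) :=
        integral_mono ((((hg.pow 2).mul (A.bm_condVar n)).add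
          (((hg.mul hT).add hψ).pow 2)).integrable _) (integrable_const _) hpt
    _ = (lo * m) ^ 2 * ((εu / εl) ^ 2 / m * (s + 16 * a ^ 2)) := by
        rw [integral_const, smul_eq_mul, ← hm]
        field_simp
    _ ≤ _ := by gcongr

end Regular

end MixingBounds

/-! ### Combinatorics of the resampling and backward-sampling schedules. -/

section Schedules

/-- The number of steps since the last selection. -/
def gapLength (ρ : ℕ → Bool) : ℕ → ℕ
  | 0 => 0
  | n + 1 => if ρ n then 0 else gapLength ρ n + 1

/-- The inner sums of the schedule average, computed recursively. -/
noncomputable def selectionWeight (ρ ε : ℕ → Bool) : ℕ → ℝ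
  | 0 => 0
  | j + 1 => (selectionWeight ρ ε j + 1) / (1 + ((ε (selectionTime ρ j)).toNat : ℝ))

variable {ρ ε : ℕ → Bool} {d : ℕ}

lemma gapLength_spec (n : ℕ) :
    gapLength ρ n ≤ n ∧ ∀ i, n - gapLength ρ n ≤ i → i < n → ρ i = false := by
  induction n with
  | zero => simp [gapLength]
  | succ n ih =>
    unfold gapLength
    split_ifs with hρ
    · exact ⟨by omega, fun i h1 h2 => by omega⟩
    · refine ⟨by omega, fun i h1 h2 => ?_⟩
      rcases Nat.lt_succ_iff_lt_or_eq.1 h2 with h3 | rfl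
      · exact ih.2 i (by omega) h3
      · simpa using hρ

/-- A longer gap would contain the selection promised within `d` steps of its first time. The length
`d` itself can occur for a gap that starts at time zero. -/
lemma gapLength_le (hρ : ∀ n, ∃ k, 1 ≤ k ∧ k ≤ d ∧ ρ (n + k) = true) (n : ℕ) :
    gapLength ρ n ≤ d := by
  by_contra! hlt
  obtain ⟨h1, h2⟩ := gapLength_spec (ρ := ρ) n
  obtain ⟨k, hk1, hk2, hk3⟩ := hρ (n - gapLength ρ n)
  rw [h2 _ (by omega) (by omega)] at hk3
  exact Bool.false_ne_true hk3

lemma numSelections_succ (n : ℕ) :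
    numSelections ρ (n + 1) = numSelections ρ n + (ρ n).toNat := by
  simp [numSelections, Finset.sum_range_succ]

lemma numSelections_mono : Monotone (numSelections ρ) :=
  monotone_nat_of_le_succ fun n => by rw [numSelections_succ]; omega

lemma numSelections_le (n : ℕ) : numSelections ρ n ≤ n := by
  induction n with
  | zero => simp [numSelections]
  | succ n ih =>
    rw [numSelections_succ]
    have := Bool.toNat_le (ρ n)
    omega

lemma selectionTime_numSelections {n : ℕ} (hn : ρ n = true) :
    selectionTime ρ (numSelections ρ n) = n := by
  refine le_antisymm (Nat.sInf_le ?_) (le_csInf ⟨n, ?_⟩ fun m hm => ?_)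
  · simp [numSelections_succ, hn]
  · simp [numSelections_succ, hn]
  · by_contra! hlt
    have := numSelections_mono (ρ := ρ) (Nat.succ_le_of_lt hlt)
    simp only [Set.mem_ofPred_eq] at hm
    rw [Nat.succ_eq_add_one, hm] at this
    omega

lemma selectionWeight_nonneg (j : ℕ) : 0 ≤ selectionWeight ρ ε j := by
  induction j with
  | zero => simp [selectionWeight]
  | succ j ih =>
    unfold selectionWeight
    positivity

lemma selectionWeight_succ_eq_sum (m : ℕ) :
    selectionWeight ρ ε (m + 1) = ∑ l ∈ Finset.range (m + 1), ∏ j ∈ Finset.Icc l m,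
      (1 + ((ε (selectionTime ρ j)).toNat : ℝ))⁻¹ := by
  induction m with
  | zero => simp [selectionWeight]
  | succ m ih =>
    rw [Finset.sum_range_succ, selectionWeight, ih, add_div, Finset.sum_div, Finset.Icc_self,
      Finset.prod_singleton, one_div]
    congr 1
    refine Finset.sum_congr rfl fun l hl => ?_
    rw [Finset.prod_Icc_succ_top (by have := Finset.mem_range.1 hl; omega), div_eq_mul_inv]

lemma numSelections_mul_scheduleAverage (n : ℕ) :
    (numSelections ρ n : ℝ) * scheduleAverage ρ ε n =
      ∑ m ∈ Finset.range (numSelections ρ n), selectionWeight ρ ε (m + 1) := by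
  simp only [selectionWeight_succ_eq_sum, scheduleAverage]
  push_cast
  -- Without selections the inverse has its default value zero, but the sum is empty as well.
  rcases Nat.eq_zero_or_pos (numSelections ρ n) with h0 | h0
  · simp [h0]
  · have : (numSelections ρ n : ℝ) ≠ 0 := by positivity
    field_simp

/-- Between selections the bound grows by `b` per step, which the gap length counts. At a selection
at most `d` such steps and the current one, hence `d + 1` copies of `b`, are collected before
dividing by `1 + ε`; this is the recursion of `selectionWeight`. -/
lemma condVarBound_le (hb : ∀ n, ρ n = false → ε n = false) {b : ℝ} (hb0 : 0 ≤ b)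
    (hρ : ∀ n, ∃ k, 1 ≤ k ∧ k ≤ d ∧ ρ (n + k) = true) (n : ℕ) :
    condVarBound ε b n ≤
      b * (d + 1) * selectionWeight ρ ε (numSelections ρ n) + b * gapLength ρ n := by
  induction n with
  | zero => simp [condVarBound, numSelections, selectionWeight, gapLength]
  | succ n ih =>
    rw [numSelections_succ]
    unfold condVarBound gapLength
    cases h : ρ n
    · simp only [hb n h, Bool.toNat_false, Nat.cast_zero, add_zero, div_one, Bool.false_eq_true,
        if_false, Nat.cast_add, Nat.cast_one]
      linarith
    · simp only [Bool.toNat_true, if_true, Nat.cast_zero, mul_zero, add_zero, selectionWeight,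
        selectionTime_numSelections h]
      rw [mul_div_assoc']
      gcongr
      have : (gapLength ρ n : ℝ) ≤ d := by exact_mod_cast gapLength_le hρ n
      nlinarith [mul_le_mul_of_nonneg_left this hb0]

/-- Contributions that are bounded in terms of the number of previous selections. -/
lemma sum_selections_le (t u : ℕ → ℝ) (htu : ∀ n, t n ≤ u (numSelections ρ n)) (n : ℕ) :
    (∑ m ∈ Finset.range n, if ρ m then t m else 0) ≤
      ∑ j ∈ Finset.range (numSelections ρ n), u j := by
  induction n with
  | zero => simp [numSelections]
  | succ n ih =>
    rw [Finset.sum_range_succ, numSelections_succ]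
    cases h : ρ n
    · simpa using ih
    · simp only [if_true, Bool.toNat_true, Finset.sum_range_succ]
      exact add_le_add ih (htu n)

/-- Passage from bounds of the asymptotic variances to the time-normalized limit. -/
lemma limsup_div_le {v : ℕ → ℝ≥0} {K C : ℝ≥0}
    (hv : ∀ n, (v n : ℝ) ≤ K + ∑ j ∈ Finset.range (numSelections ρ n),
      C * (selectionWeight ρ ε (j + 1) + 1)) :
    limsup (fun n : ℕ => (v n : ℝ≥0∞) / (n : ℝ≥0∞)) atTop ≤
      C * (1 + limsup (fun n : ℕ => (scheduleAverage ρ ε n : ℝ≥0∞)) atTop) := by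
  -- The number of selections is bounded by the number of steps, which turns the normalization by
  -- `rₙ` into one by `n`.
  have h1 : ∀ n, v n ≤ K + C * n * (1 + scheduleAverage ρ ε n) := fun n => by
    have hr : (numSelections ρ n : ℝ) ≤ n := by exact_mod_cast numSelections_le n
    rw [← NNReal.coe_le_coe]
    push_cast
    refine (hv n).trans ?_
    rw [← Finset.mul_sum, Finset.sum_add_distrib, ← numSelections_mul_scheduleAverage]
    simp only [Finset.sum_const, Finset.card_range, nsmul_eq_mul, mul_one]
    have : (numSelections ρ n : ℝ) * scheduleAverage ρ ε n + numSelections ρ n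
        ≤ n * (1 + scheduleAverage ρ ε n) := by
      nlinarith [mul_le_mul_of_nonneg_right hr (scheduleAverage ρ ε n).coe_nonneg]
    nlinarith [mul_le_mul_of_nonneg_left this C.coe_nonneg]
  have h2 : ∀ n : ℕ, 1 ≤ n → (v n : ℝ≥0∞) / n ≤
      (K : ℝ≥0∞) / n + C * (1 + scheduleAverage ρ ε n) := fun n hn => by
    have hn0 : (n : ℝ≥0∞) ≠ 0 := by exact_mod_cast (by omega : n ≠ 0)
    have hnt : (n : ℝ≥0∞) ≠ ∞ := ENNReal.natCast_ne_top n
    rw [ENNReal.div_le_iff hn0 hnt, add_mul, ENNReal.div_mul_cancel hn0 hnt]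
    calc (v n : ℝ≥0∞) ≤ ((K + C * n * (1 + scheduleAverage ρ ε n) : ℝ≥0) : ℝ≥0∞) := by
          exact_mod_cast h1 n
      _ = _ := by push_cast; ring
  have hlim : Tendsto (fun n : ℕ => (K : ℝ≥0∞) / n) atTop (𝓝 0) := by
    simpa using ENNReal.Tendsto.const_div (a := (K : ℝ≥0∞)) ENNReal.tendsto_nat_nhds_top
      (Or.inr ENNReal.coe_ne_top)
  refine ENNReal.le_of_forall_pos_le_add fun e he _ => ?_
  have hK : ∀ᶠ n : ℕ in atTop, (K : ℝ≥0∞) / n ≤ e :=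
    hlim.eventually_le_const (by exact_mod_cast he)
  calc _ ≤ limsup (fun n : ℕ => (e : ℝ≥0∞) + C * (1 + scheduleAverage ρ ε n)) atTop := by
        refine limsup_le_limsup ?_
        filter_upwards [hK, eventually_ge_atTop 1] with n hn1 hn2
        exact (h2 n hn2).trans (by gcongr)
    _ = C * (1 + limsup (fun n : ℕ => (scheduleAverage ρ ε n : ℝ≥0∞)) atTop) + e := by
        rw [limsup_const_add _ _ _ (by isBoundedDefault) (by isBoundedDefault), add_comm,
          ENNReal.limsup_const_mul_of_ne_top ENNReal.coe_ne_top,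
          limsup_const_add _ _ _ (by isBoundedDefault) (by isBoundedDefault)]

end Schedules

/-! ### From second moments to the bound in terms of the schedule. -/

section VarianceBound

variable {X : ℕ → Type u} [∀ n, MeasurableSpace (X n)] {M : PathModel X} {P : Proposal M}
  {h : AdditiveTerms X} {ρ ε : ℕ → Bool} {εl εu δ γ H : ℝ≥0} {d : ℕ}

/-- The bound of the weights at time `n`, normalized by their limiting mean. -/
noncomputable def relWeight (P : Proposal M) (ρ : ℕ → Bool) (δ : ℝ≥0) (n : ℕ) : ℝ :=
  weightBound ρ δ n / (normConst P ρ n * (fwd M n).real Set.univ)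

lemma weightBound_nonneg (n : ℕ) : 0 ≤ weightBound ρ δ n := by
  induction n with
  | zero => simp [weightBound]
  | succ n ih =>
    unfold weightBound
    split_ifs <;> positivity

namespace Regular

lemma p_pos (A : Regular P h ρ ε εl εu δ γ H) (n : ℕ) (x : X n) (y : X (n + 1)) :
    0 < P.p n x y := by
  rw [pos_iff_ne_zero]
  intro h0
  have h1 := A.mix.ell_lower n x y
  rw [P.p_dominates n x y h0] at h1
  exact absurd A.εl_pos h1.not_gt

/-- The weight bound says `ell ≤ δ ϑ p`; integrating in `y` eliminates `p`, as both `p` and the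
reference measure have mass one. Thus the multipliers, only assumed positive, are bounded below. -/
lemma lo_le_mul_ϑ (A : Regular P h ρ ε εl εu δ γ H) (n : ℕ) (x : X n) :
    (εl : ℝ) ≤ δ * P.ϑ n x := by
  have hprob := A.prob n
  have h1 : ∀ y, (εl : ℝ≥0∞) ≤ (δ * P.ϑ n x : ℝ≥0) * (P.p n x y : ℝ≥0∞) := fun y => by
    have h2 := A.mix.weight_bound true n x y
    unfold Proposal.weightFn at h2
    have hp : 0 < P.ϑ n x ^ true.toNat * P.p n x y :=
      mul_pos (pow_pos (P.ϑ_pos n x) _) (A.p_pos n x y)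
    rw [div_le_iff₀ hp] at h2
    have h3 := (A.mix.ell_lower n x y).trans h2
    have : εl ≤ δ * P.ϑ n x * P.p n x y := by simpa [mul_assoc] using h3
    exact_mod_cast this
  have h4 : (εl : ℝ≥0∞) ≤ (δ * P.ϑ n x : ℝ≥0) := by
    calc (εl : ℝ≥0∞) = ∫⁻ _, (εl : ℝ≥0∞) ∂(M.μ (n + 1)) := by simp
      _ ≤ ∫⁻ y, (δ * P.ϑ n x : ℝ≥0) * (P.p n x y : ℝ≥0∞) ∂(M.μ (n + 1)) := lintegral_mono h1
      _ = _ := by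
        have hp : Measurable fun y => P.p n x y := (P.measurable_p n).comp measurable_prodMk_left
        rw [lintegral_const_mul _ hp.coe_nnreal_ennreal, P.p_mass, mul_one]
  exact_mod_cast h4

lemma bm_ϑ (A : Regular P h ρ ε εl εu δ γ H) (n : ℕ) : BM fun x => (P.ϑ n x : ℝ) :=
  ⟨(P.measurable_ϑ n).coe_nnreal_real, γ, fun x => by
    rw [NNReal.abs_eq]; exact_mod_cast A.mix.ϑ_bound n x⟩

lemma integral_ϑ_pos (A : Regular P h ρ ε εl εu δ γ H) (n : ℕ) :
    0 < ∫ x, (P.ϑ n x : ℝ) ∂(fwd M n) := by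
  have := A.isFiniteMeasure_fwd n
  have h1 : εl * (fwd M n).real Set.univ ≤ δ * ∫ x, (P.ϑ n x : ℝ) ∂(fwd M n) := by
    rw [← integral_const_mul]
    calc εl * (fwd M n).real Set.univ = ∫ _, (εl : ℝ) ∂(fwd M n) := by simp [mul_comm]
      _ ≤ _ := integral_mono (integrable_const _) (((A.bm_ϑ n).integrable _).const_mul _)
          (A.lo_le_mul_ϑ n)
  exact pos_of_mul_pos_right ((mul_pos A.lo_pos (A.fwd_pos n)).trans_le h1) (by positivity)

lemma normConst_pos (A : Regular P h ρ ε εl εu δ γ H) (n : ℕ) : 0 < normConst P ρ n := by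
  induction n with
  | zero => simp [normConst]
  | succ n ih =>
    unfold normConst
    split_ifs
    · exact inv_pos.2 (A.integral_ϑ_pos n)
    · exact ih

lemma relWeight_nonneg (A : Regular P h ρ ε εl εu δ γ H) (n : ℕ) : 0 ≤ relWeight P ρ δ n :=
  div_nonneg (weightBound_nonneg n) (mul_pos (A.normConst_pos n) (A.fwd_pos n)).le

/-- A selection resets the weights, and the model-independent bound `γ δ / εl` results; every step
without selection costs at most a factor `δ / εl`. Before the first selection the initial masses
enter, so that phase gets a constant of its own, to be made negligible by dividing by `n`. -/
lemma relWeight_le (A : Regular P h ρ ε εl εu δ γ H) (n : ℕ) :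
    relWeight P ρ δ n ≤ max 1 ((δ : ℝ) / εl) ^ gapLength ρ n *
      if numSelections ρ n = 0 then relWeight P ρ δ 0 else γ * (δ / εl) := by
  induction n with
  | zero => simp [gapLength, numSelections]
  | succ n ih =>
    have hf := A.fwd_pos n
    have hf1 := A.fwd_pos (n + 1)
    have hle := A.lo_mul_le_fwd n
    have hl := A.lo_pos
    rw [numSelections_succ]
    cases hρ : ρ n
    · simp only [gapLength, hρ, Bool.false_eq_true, if_false, Bool.toNat_false, add_zero]
      have h1 : relWeight P ρ δ (n + 1) ≤ (δ / εl) * relWeight P ρ δ n := by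
        simp only [relWeight, weightBound, normConst, hρ, Bool.false_eq_true, if_false]
        have hk := A.normConst_pos n
        rw [div_mul_div_comm]
        refine div_le_div_of_nonneg_left (mul_nonneg δ.coe_nonneg (weightBound_nonneg n))
          (by positivity) ?_
        calc _ = normConst P ρ n * (εl * (fwd M n).real Set.univ) := by ring
          _ ≤ _ := mul_le_mul_of_nonneg_left hle hk.le
      calc _ ≤ (δ / εl) * relWeight P ρ δ n := h1
        _ ≤ max 1 ((δ : ℝ) / εl) * relWeight P ρ δ n :=
          mul_le_mul_of_nonneg_right (le_max_right _ _) (A.relWeight_nonneg n)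
        _ ≤ max 1 ((δ : ℝ) / εl) * _ := mul_le_mul_of_nonneg_left ih (by positivity)
        _ = _ := by rw [pow_succ]; ring
    · simp only [gapLength, hρ, if_true, Bool.toNat_true, pow_zero, one_mul, Nat.succ_ne_zero,
        if_false]
      have h2 : ∫ x, (P.ϑ n x : ℝ) ∂(fwd M n) ≤ γ * (fwd M n).real Set.univ := by
        have := A.isFiniteMeasure_fwd n
        calc ∫ x, (P.ϑ n x : ℝ) ∂(fwd M n) ≤ ∫ _, (γ : ℝ) ∂(fwd M n) :=
              integral_mono ((A.bm_ϑ n).integrable _) (integrable_const _)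
                fun x => by exact_mod_cast A.mix.ϑ_bound n x
          _ = _ := by simp [mul_comm]
      have h3 := A.integral_ϑ_pos n
      simp only [relWeight, weightBound, normConst, hρ, if_true]
      rw [div_le_iff₀ (by positivity), inv_mul_eq_div, mul_div_assoc', le_div_iff₀ h3]
      calc δ * ∫ x, (P.ϑ n x : ℝ) ∂(fwd M n) ≤ δ * (γ * (fwd M n).real Set.univ) := by gcongr
        _ = γ * (δ / εl) * (εl * (fwd M n).real Set.univ) := by field_simp
        _ ≤ _ := by gcongr

/-- The bound of the contribution of a selection step at time `n`. -/
noncomputable def _root_.AdaSmooth.stepBound (P : Proposal M) (ρ ε : ℕ → Bool)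
    (εl εu δ H : ℝ≥0) (n : ℕ) : ℝ :=
  relWeight P ρ δ n * ((εu / εl) ^ 2 *
    (condVarBound ε ((oscBound εl εu H + H) ^ 2) n + 16 * oscBound εl εu H ^ 2))

lemma weighted_secondMoment_le (A : Regular P h ρ ε εl εu δ γ H) (hlu : εl ≤ εu) {n : ℕ} {G : ℝ}
    {g ψ : X n → ℝ} (ht : Tame M h ε εl εu H n G g ψ) :
    weightBound ρ δ n / normConst P ρ n * secondMoment M h ε n g ψ
      ≤ G ^ 2 * stepBound P ρ ε εl εu δ H n := by
  have hk := A.normConst_pos n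
  have hf := A.fwd_pos n
  calc _ ≤ weightBound ρ δ n / normConst P ρ n * _ := mul_le_mul_of_nonneg_left
        (A.secondMoment_le hlu ht) (div_nonneg (weightBound_nonneg n) hk.le)
    _ = _ := by
        unfold stepBound relWeight
        field_simp

/-- Pull-backs of tame pairs are tame with the same mass `G`, so a single factor `G ^ 2` serves all
terms. -/
lemma selectionVar_le (A : Regular P h ρ ε εl εu δ γ H) (hlu : εl ≤ εu) (n : ℕ) {G : ℝ}
    {g ψ : X n → ℝ} (ht : Tame M h ε εl εu H n G g ψ) :
    selectionVar P h ρ ε δ n g ψ ≤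
      G ^ 2 * ∑ m ∈ Finset.range n, if ρ m then stepBound P ρ ε εl εu δ H m else 0 := by
  induction n with
  | zero => simp [selectionVar]
  | succ n ih =>
    have ht' := A.tame_pull hlu ht
    rw [Finset.sum_range_succ, mul_add, selectionVar]
    refine add_le_add (ih ht') ?_
    split_ifs
    · exact A.weighted_secondMoment_le hlu ht'
    · simp

/-- The constant of the variance bound. -/
noncomputable def _root_.AdaSmooth.mixingConst (εl εu δ : ℝ≥0) (d : ℕ) : ℝ≥0 :=
  max 1 (δ / εl) ^ d * (δ / εl) * ((εu / εl) ^ 2 *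
    ((2 * (εu / εl) + 1) ^ 2 * (d + 1) + 64 * (εu / εl) ^ 2))

/-- After the first selection everything is expressed by `H ^ 2 * γ` and mixing constants: `oscBound
+ H = H (2 εu / εl + 1)` and `16 oscBound ^ 2 = 64 H ^ 2 (εu / εl) ^ 2`. The terms without the
schedule weight `S` are absorbed by passing to `S + 1`. -/
lemma stepBound_le (A : Regular P h ρ ε εl εu δ γ H)
    (hρ : ∀ n, ∃ k, 1 ≤ k ∧ k ≤ d ∧ ρ (n + k) = true) (n : ℕ) :
    stepBound P ρ ε εl εu δ H n ≤
      if numSelections ρ n = 0 then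
        max 1 ((δ : ℝ) / εl) ^ d * relWeight P ρ δ 0 * ((εu / εl) ^ 2 *
          ((oscBound εl εu H + H) ^ 2 * d + 16 * oscBound εl εu H ^ 2))
      else (mixingConst εl εu δ d * H ^ 2 * γ : ℝ≥0) *
        (selectionWeight ρ ε (numSelections ρ n) + 1) := by
  have h1 := condVarBound_le (b := (oscBound εl εu H + H) ^ 2) A.backward (by positivity) hρ n
  have hq : (gapLength ρ n : ℝ) ≤ d := by exact_mod_cast gapLength_le hρ n
  have h2 : max 1 ((δ : ℝ) / εl) ^ gapLength ρ n ≤ max 1 ((δ : ℝ) / εl) ^ d :=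
    pow_le_pow_right₀ (le_max_left _ _) (gapLength_le hρ n)
  have h3 := A.relWeight_le n
  have hD0 := A.relWeight_nonneg 0
  have hS := selectionWeight_nonneg (ρ := ρ) (ε := ε) (numSelections ρ n)
  have hl := A.lo_pos
  set S := selectionWeight ρ ε (numSelections ρ n)
  set b := (oscBound εl εu H + H) ^ 2 with hb
  have hb0 : 0 ≤ b := sq_nonneg _
  have h4 : condVarBound ε b n ≤ b * (d + 1) * S + b * d :=
    h1.trans (by gcongr)
  have h5 : condVarBound ε b n + 16 * oscBound εl εu H ^ 2
      ≤ b * (d + 1) * S + b * d + 16 * oscBound εl εu H ^ 2 := by linarith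
  unfold stepBound
  split_ifs with h0
  · have hS0 : S = 0 := by simp [S, h0, selectionWeight]
    rw [if_pos h0] at h3
    have h6 : relWeight P ρ δ n ≤ max 1 ((δ : ℝ) / εl) ^ d * relWeight P ρ δ 0 :=
      h3.trans (by gcongr)
    rw [hS0, mul_zero, zero_add] at h5
    calc _ ≤ relWeight P ρ δ n * ((εu / εl) ^ 2 * (b * d + 16 * oscBound εl εu H ^ 2)) :=
          mul_le_mul_of_nonneg_left (by gcongr) (A.relWeight_nonneg n)
      _ ≤ _ := mul_le_mul_of_nonneg_right h6 (by positivity)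
  · rw [if_neg h0] at h3
    have h6 : relWeight P ρ δ n ≤ max 1 ((δ : ℝ) / εl) ^ d * (γ * (δ / εl)) :=
      h3.trans (by gcongr)
    calc _ ≤ relWeight P ρ δ n * ((εu / εl) ^ 2 *
            (b * (d + 1) * S + b * d + 16 * oscBound εl εu H ^ 2)) :=
          mul_le_mul_of_nonneg_left (by gcongr) (A.relWeight_nonneg n)
      _ ≤ max 1 ((δ : ℝ) / εl) ^ d * (γ * (δ / εl)) * ((εu / εl) ^ 2 *
            (b * (d + 1) * S + b * d + 16 * oscBound εl εu H ^ 2)) :=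
          mul_le_mul_of_nonneg_right h6 (by positivity)
      _ ≤ max 1 ((δ : ℝ) / εl) ^ d * (γ * (δ / εl)) * ((εu / εl) ^ 2 *
            ((b * (d + 1) + 16 * oscBound εl εu H ^ 2) * (S + 1))) := by
          gcongr
          have : 0 ≤ 16 * oscBound εl εu H ^ 2 * S := by positivity
          nlinarith
      _ = _ := by
          rw [hb]
          unfold oscBound mixingConst
          push_cast
          ring

lemma variance_bound (A : Regular P h ρ ε εl εu δ γ H) (hlu : εl ≤ εu)
    (hρ : ∀ n, ∃ k, 1 ≤ k ∧ k ≤ d ∧ ρ (n + k) = true) :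
    ∃ K : ℝ≥0, ∀ (n : ℕ) (G : ℝ) (g ψ : X n → ℝ), 0 < G → Tame M h ε εl εu H n G g ψ →
      (weightBound ρ δ n / normConst P ρ n * secondMoment M h ε n g ψ
        + selectionVar P h ρ ε δ n g ψ) / G ^ 2 ≤
      K + ∑ j ∈ Finset.range (numSelections ρ n),
        (mixingConst εl εu δ d * H ^ 2 * γ : ℝ≥0) * (selectionWeight ρ ε (j + 1) + 1) := by
  set K : ℝ := max 1 ((δ : ℝ) / εl) ^ d * relWeight P ρ δ 0 * ((εu / εl) ^ 2 *
          ((oscBound εl εu H + H) ^ 2 * d + 16 * oscBound εl εu H ^ 2)) with hK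
  have hK0 : 0 ≤ K := mul_nonneg (mul_nonneg (by positivity) (A.relWeight_nonneg 0))
    (by positivity)
  refine ⟨⟨K, hK0⟩, fun n G g ψ hG ht => ?_⟩
  set u : ℕ → ℝ := fun j => if j = 0 then K else (mixingConst εl εu δ d * H ^ 2 * γ : ℝ≥0) *
        (selectionWeight ρ ε j + 1) with hu
  have h1 := sum_selections_le (ρ := ρ) (stepBound P ρ ε εl εu δ H) u (A.stepBound_le hρ) n
  rw [div_le_iff₀ (by positivity)]
  calc _ ≤ G ^ 2 * stepBound P ρ ε εl εu δ H n + G ^ 2 * ∑ m ∈ Finset.range n,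
          (if ρ m then stepBound P ρ ε εl εu δ H m else 0) :=
        add_le_add (A.weighted_secondMoment_le hlu ht) (A.selectionVar_le hlu n ht)
    _ ≤ G ^ 2 * u (numSelections ρ n) +
          G ^ 2 * ∑ j ∈ Finset.range (numSelections ρ n), u j := by
        gcongr
        exact A.stepBound_le hρ n
    -- The current second moment supplies the missing index `rₙ`. Splitting off index zero, the
    -- phase before any selection, then shifts the sum to `selectionWeight ρ ε (j + 1)`, as in the
    -- schedule average.
    _ = G ^ 2 * ∑ j ∈ Finset.range (numSelections ρ n + 1), u j := by
        rw [Finset.sum_range_succ]; ring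
    _ = _ := by
        rw [Finset.sum_range_succ']
        simp only [hu, Nat.succ_ne_zero, if_false, if_true]
        change _ = (K + _) * _
        ring

end Regular

end VarianceBound

/-! ### Identification of the smoothed expectation with the limiting conditional mean. -/

section PathMeasure

variable {X : ℕ → Type u} [∀ n, MeasurableSpace (X n)] {M : PathModel X} {P : Proposal M}
  {h : AdditiveTerms X} {ρ ε : ℕ → Bool} {εl εu δ γ H : ℝ≥0}

/-- Extension of a path by one point. -/
def snocPath {n : ℕ} (q : Path X n × X (n + 1)) : Path X (n + 1) :=
  Fin.snoc (α := fun i : Fin (n + 2) => X i) q.1 q.2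

/-- The final point of a path. -/
def lastPoint {n : ℕ} (x : Path X n) : X n := x (Fin.last n)

lemma measurable_lastPoint {n : ℕ} : Measurable (lastPoint (X := X) (n := n)) :=
  measurable_pi_apply (Fin.last n)

lemma snocPath_of_lt {n : ℕ} (q : Path X n × X (n + 1)) (i : Fin (n + 2)) (hi : i.val < n + 1) :
    snocPath q i = q.1 ⟨i.val, hi⟩ := by
  simp only [snocPath, Fin.snoc, hi, dif_pos]
  rfl

lemma lastPoint_snocPath {n : ℕ} (q : Path X n × X (n + 1)) : lastPoint (snocPath q) = q.2 :=
  Fin.snoc_last (α := fun i : Fin (n + 2) => X i) q.2 q.1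

lemma measurable_snocPath {n : ℕ} : Measurable (snocPath (X := X) (n := n)) := by
  refine measurable_pi_iff.2 fun i => ?_
  by_cases hi : i.val < n + 1
  · have : (fun q : Path X n × X (n + 1) => snocPath q i) = fun q => q.1 ⟨i.val, hi⟩ := by
      funext q
      exact snocPath_of_lt q i hi
    rw [this]
    exact (measurable_pi_apply (⟨i.val, hi⟩ : Fin (n + 1))).comp measurable_fst
  · have hl : i = Fin.last (n + 1) := Fin.ext (by simp; omega)
    subst hl
    have : (fun q : Path X n × X (n + 1) => snocPath q (Fin.last (n + 1))) = fun q => q.2 := by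
      funext q
      exact lastPoint_snocPath q
    rw [this]
    exact measurable_snd

lemma map_snocPath (M : PathModel X) (n : ℕ) :
    ((Measure.pi fun i : Fin (n + 1) => M.μ i).prod (M.μ (n + 1))).map snocPath =
      Measure.pi fun i : Fin (n + 2) => M.μ i := by
  have hσ := M.sigmaFinite_μ
  symm
  refine Measure.pi_eq fun s hs => ?_
  have hpre : snocPath ⁻¹' (Set.univ.pi s) =
      (Set.univ.pi fun i : Fin (n + 1) => s i.castSucc) ×ˢ s (Fin.last (n + 1)) := by
    ext q
    simp only [Set.mem_preimage, Set.mem_univ_pi, Set.mem_prod]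
    rw [Fin.forall_fin_succ']
    have h1 : ∀ i : Fin (n + 1), snocPath q i.castSucc = q.1 i := fun i =>
      snocPath_of_lt q i.castSucc i.isLt
    have h2 : snocPath q (Fin.last (n + 1)) = q.2 := lastPoint_snocPath q
    exact and_congr (forall_congr' fun i => by rw [h1]) (by rw [h2])
  rw [Measure.map_apply measurable_snocPath (MeasurableSet.univ_pi hs), hpre, Measure.prod_prod,
    Measure.pi_pi]
  exact (Fin.prod_univ_castSucc fun i : Fin (n + 2) => M.μ i (s i)).symm

lemma pathDensity_snocPath (n : ℕ) (q : Path X n × X (n + 1)) :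
    M.pathDensity (n + 1) (snocPath q) =
      M.pathDensity n q.1 * M.ell n (lastPoint q.1) q.2 := by
  have e := Fin.prod_univ_castSucc fun m : Fin (n + 1) =>
    M.ell m (snocPath q m.castSucc) (snocPath q m.succ)
  have h1 : ∀ m : Fin n, M.ell m (snocPath q m.castSucc.castSucc) (snocPath q m.castSucc.succ) =
      M.ell m (q.1 m.castSucc) (q.1 m.succ) := fun m =>
    congrArg₂ (M.ell m) (snocPath_of_lt q m.castSucc.castSucc (by simp))
      (snocPath_of_lt q m.castSucc.succ (by simp))
  have h2 : M.ell n (snocPath q (Fin.last n).castSucc) (snocPath q (Fin.last n).succ) =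
      M.ell n (lastPoint q.1) q.2 :=
    congrArg₂ (M.ell n) (snocPath_of_lt q (Fin.last n).castSucc (by simp)) (lastPoint_snocPath q)
  have h0 : snocPath q (⟨0, (n + 1).succ_pos⟩ : Fin (n + 2)) = q.1 ⟨0, n.succ_pos⟩ :=
    snocPath_of_lt q _ n.succ_pos
  unfold PathModel.pathDensity
  refine (congrArg₂ (· * ·) (congrArg M.χ h0) (e.trans
    (congrArg₂ (· * ·) (Finset.prod_congr rfl fun m _ => h1 m) h2))).trans (mul_assoc _ _ _).symm

lemma functional_snocPath (n : ℕ) (q : Path X n × X (n + 1)) :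
    h.functional (n + 1) (snocPath q) =
      h.functional n q.1 + h.incr n (lastPoint q.1) q.2 := by
  have e := Fin.sum_univ_castSucc fun m : Fin (n + 1) =>
    h.incr m (snocPath q m.castSucc) (snocPath q m.succ)
  have h1 : ∀ m : Fin n, h.incr m (snocPath q m.castSucc.castSucc) (snocPath q m.castSucc.succ) =
      h.incr m (q.1 m.castSucc) (q.1 m.succ) := fun m =>
    congrArg₂ (h.incr m) (snocPath_of_lt q m.castSucc.castSucc (by simp))
      (snocPath_of_lt q m.castSucc.succ (by simp))
  have h2 : h.incr n (snocPath q (Fin.last n).castSucc) (snocPath q (Fin.last n).succ) =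
      h.incr n (lastPoint q.1) q.2 :=
    congrArg₂ (h.incr n) (snocPath_of_lt q (Fin.last n).castSucc (by simp)) (lastPoint_snocPath q)
  have h0 : snocPath q (⟨0, (n + 1).succ_pos⟩ : Fin (n + 2)) = q.1 ⟨0, n.succ_pos⟩ :=
    snocPath_of_lt q _ n.succ_pos
  unfold AdditiveTerms.functional
  refine (congrArg₂ (· + ·) (congrArg h.init h0) (e.trans
    (congrArg₂ (· + ·) (Finset.sum_congr rfl fun m _ => h1 m) h2))).trans (add_assoc _ _ _).symm

lemma measurable_pathDensity (M : PathModel X) (n : ℕ) : Measurable (M.pathDensity n) := by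
  unfold PathModel.pathDensity
  refine (M.measurable_χ.comp (measurable_pi_apply (⟨0, n.succ_pos⟩ : Fin (n + 1)))).mul
    (Finset.measurable_fun_prod _ fun m _ => ?_)
  exact (M.measurable_ell m).comp (f := fun x : Path X n => (x m.castSucc, x m.succ))
    ((measurable_pi_apply m.castSucc).prodMk (measurable_pi_apply m.succ))

lemma measurable_ell_last (M : PathModel X) (n : ℕ) :
    Measurable fun q : Path X n × X (n + 1) => M.ell n (lastPoint q.1) q.2 :=
  (M.measurable_ell n).comp (f := fun q : Path X n × X (n + 1) => (lastPoint q.1, q.2))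
    ((measurable_lastPoint.comp measurable_fst).prodMk measurable_snd)

/-- A path is extended by one point at its end, with density depending on the previous end point
only. This makes inductions in `n` possible for measures on dependent products. -/
lemma unnormalizedSmoothing_succ (M : PathModel X) (n : ℕ) :
    M.unnormalizedSmoothing (n + 1) =
      (((M.unnormalizedSmoothing n).prod (M.μ (n + 1))).withDensity
        fun q => (M.ell n (lastPoint q.1) q.2 : ℝ≥0∞)).map snocPath := by
  have hσ := M.sigmaFinite_μ
  have hd := (measurable_pathDensity M n).coe_nnreal_ennreal
  have hd1 := (measurable_pathDensity M (n + 1)).coe_nnreal_ennreal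
  have hl := (measurable_ell_last M n).coe_nnreal_ennreal
  have : SFinite (M.unnormalizedSmoothing n) := by
    unfold PathModel.unnormalizedSmoothing
    infer_instance
  refine Measure.ext_of_lintegral _ fun F hF => ?_
  rw [lintegral_map hF measurable_snocPath]
  unfold PathModel.unnormalizedSmoothing
  rw [← map_snocPath, prod_withDensity_left hd,
    lintegral_withDensity_eq_lintegral_mul _ hd1 hF, lintegral_map (hd1.mul hF) measurable_snocPath,
    lintegral_withDensity_eq_lintegral_mul _ hl (g := fun q => F (snocPath q))
      (hF.comp measurable_snocPath),
    lintegral_withDensity_eq_lintegral_mul _ (f := fun q => (M.pathDensity n q.1 : ℝ≥0∞))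
      (Measurable.comp (f := Prod.fst) hd measurable_fst) (hl.mul (g := fun q => F (snocPath q)) (hF.comp measurable_snocPath))]
  refine lintegral_congr fun q => ?_
  simp only [Pi.mul_apply, pathDensity_snocPath]
  push_cast
  ring

namespace Regular

lemma map_unnormalizedSmoothing_zero (M : PathModel X) :
    (M.unnormalizedSmoothing 0).map (lastPoint) = fwd M 0 := by
  have hσ := M.sigmaFinite_μ
  have hm := measurable_lastPoint (X := X) (n := 0)
  -- At time zero the product has a single factor, and the final point is the only coordinate.
  have hp : (Measure.pi fun i : Fin 1 => M.μ i).map (lastPoint) = M.μ 0 :=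
    (measurePreserving_piUnique fun i : Fin 1 => M.μ i).map_eq
  refine Measure.ext_of_lintegral _ fun F hF => ?_
  have hχ := M.measurable_χ.coe_nnreal_ennreal
  have hd : Measurable fun x : Path X 0 => (M.pathDensity 0 x : ℝ≥0∞) :=
    (measurable_pathDensity M 0).coe_nnreal_ennreal
  rw [lintegral_map hF hm, fwd, lintegral_withDensity_eq_lintegral_mul _ hχ hF, ← hp,
    lintegral_map (hχ.mul hF) hm]
  unfold PathModel.unnormalizedSmoothing
  rw [lintegral_withDensity_eq_lintegral_mul _ hd (g := fun x => F (lastPoint x))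
    (hF.comp hm)]
  refine lintegral_congr fun x => ?_
  simp [PathModel.pathDensity, lastPoint]

lemma isFiniteMeasure_unnormalizedSmoothing (A : Regular P h ρ ε εl εu δ γ H) (n : ℕ) :
    IsFiniteMeasure (M.unnormalizedSmoothing n) := by
  induction n with
  | zero =>
    have := A.isFiniteMeasure_fwd 0
    rw [← map_unnormalizedSmoothing_zero] at this
    exact Measure.isFiniteMeasure_of_map (measurable_lastPoint).aemeasurable
  | succ n ih =>
    have := A.prob n
    rw [unnormalizedSmoothing_succ]
    have : IsFiniteMeasure (((M.unnormalizedSmoothing n).prod (M.μ (n + 1))).withDensity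
        fun q => (M.ell n (lastPoint q.1) q.2 : ℝ≥0∞)) := by
      refine isFiniteMeasure_withDensity (ne_of_lt ?_)
      calc _ ≤ ∫⁻ _, (εu : ℝ≥0∞) ∂((M.unnormalizedSmoothing n).prod (M.μ (n + 1))) :=
            lintegral_mono fun q => ENNReal.coe_le_coe.2 (A.mix.ell_upper n _ _)
        _ < ∞ := by
            rw [lintegral_const]
            exact ENNReal.mul_lt_top ENNReal.coe_lt_top (measure_lt_top _ _)
    infer_instance

lemma bm_functional (A : Regular P h ρ ε εl εu δ γ H) (n : ℕ) : BM (h.functional n) := by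
  unfold AdditiveTerms.functional
  refine (A.bm_init.comp (g := fun x : Path X n => x ⟨0, n.succ_pos⟩)
    (measurable_pi_apply (⟨0, n.succ_pos⟩ : Fin (n + 1)))).add (BM.sum (α := Path X n) _ fun m _ => ?_)
  exact (A.bm_incr m).comp (g := fun x : Path X n => (x m.castSucc, x m.succ))
    ((measurable_pi_apply m.castSucc).prodMk (measurable_pi_apply m.succ))

/-- Integrating out the last point replaces `(g, ψ)` by its pull-back on the path side, and the same
identity holds for the marginals. The class of affine functions of `hₙ` is what makes the induction
close. -/
lemma integral_unnormalizedSmoothing (A : Regular P h ρ ε εl εu δ γ H) (n : ℕ) {g ψ : X n → ℝ}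
    (hg : BM g) (hψ : BM ψ) :
    ∫ x, (g (lastPoint x) * h.functional n x + ψ (lastPoint x))
        ∂(M.unnormalizedSmoothing n) =
      ∫ x, (g x * mom M h ε n 1 x + ψ x) ∂(fwd M n) := by
  induction n with
  | zero =>
    have hm := measurable_lastPoint (X := X) (n := 0)
    rw [← map_unnormalizedSmoothing_zero, integral_map hm.aemeasurable
      ((hg.mul (A.bm_mom 0 1)).add hψ).1.aestronglyMeasurable]
    refine integral_congr_ae (ae_of_all _ fun x => ?_)
    simp [AdditiveTerms.functional, mom, lastPoint]
  | succ n ih =>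
    have := A.prob n
    have := A.isFiniteMeasure_unnormalizedSmoothing n
    have hl := measurable_lastPoint (X := X) (n := n + 1)
    have hl' := measurable_lastPoint (X := X) (n := n)
    have hF := ((hg.comp hl).mul (A.bm_functional (n + 1))).add (hψ.comp hl)
    rw [unnormalizedSmoothing_succ, integral_map measurable_snocPath.aemeasurable
      hF.1.aestronglyMeasurable, integral_withDensity_eq_integral_smul (measurable_ell_last M n)]
    simp only [functional_snocPath, NNReal.smul_def, smul_eq_mul]
    have hB : BM fun q : Path X n × X (n + 1) => M.ell n (lastPoint q.1) q.2 *
        (g q.2 * (h.functional n q.1 + h.incr n (lastPoint q.1) q.2) + ψ q.2) := by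
      have hq : Measurable fun q : Path X n × X (n + 1) => (lastPoint q.1, q.2) :=
        (hl'.comp measurable_fst).prodMk measurable_snd
      exact ((A.bm_ell n).comp hq).mul (((hg.comp measurable_snd).mul
        (((A.bm_functional n).comp measurable_fst).add ((A.bm_incr n).comp hq))).add
          (hψ.comp measurable_snd))
    calc _ = ∫ q : Path X n × X (n + 1), M.ell n (lastPoint q.1) q.2 *
        (g q.2 * (h.functional n q.1 + h.incr n (lastPoint q.1) q.2) + ψ q.2)
          ∂((M.unnormalizedSmoothing n).prod (M.μ (n + 1))) := by
          refine integral_congr_ae (ae_of_all _ fun q => ?_)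
          simp only [lastPoint_snocPath]
      _ = ∫ x, (pullFst M n g (lastPoint x) * h.functional n x
            + pullSnd M h n g ψ (lastPoint x)) ∂(M.unnormalizedSmoothing n) := by
          rw [integral_prod _ (hB.integrable _)]
          refine integral_congr_ae (ae_of_all _ fun x => ?_)
          simp only [pullFst, pullSnd, fwdInt]
          have hel := (A.bm_ell n).curry_left (lastPoint x)
          rw [← integral_mul_const, ← integral_add]
          · refine integral_congr_ae (ae_of_all _ fun y => ?_)
            simp only
            ring
          · exact ((hel.mul hg).mul (BM.const _)).integrable _
          · exact (hel.mul ((((A.bm_incr n).curry_left (lastPoint x)).mul hg).add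
              hψ)).integrable _
      _ = _ := by rw [ih (A.bm_pullFst n hg) (A.bm_pullSnd n hg hψ),
            A.integral_fwd_succ_affine n hg hψ]

/-- The smoothed expectation in terms of the conditional mean at the final time. -/
lemma integral_smoothing (A : Regular P h ρ ε εl εu δ γ H) (n : ℕ) :
    ∫ x, h.functional n x ∂(M.smoothing n) =
      (∫ x, mom M h ε n 1 x ∂(fwd M n)) / (fwd M n).real Set.univ := by
  have := A.isFiniteMeasure_unnormalizedSmoothing n
  have h1 := A.integral_unnormalizedSmoothing n (BM.const 1) (BM.const 0)
  have h2 := A.integral_unnormalizedSmoothing n (BM.const 0) (BM.const 1)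
  simp only [one_mul, add_zero] at h1
  simp only [zero_mul, zero_add, integral_const, smul_eq_mul, mul_one] at h2
  rw [PathModel.smoothing, integral_smul_measure, h1, ← h2, ENNReal.toReal_inv, smul_eq_mul,
    inv_mul_eq_div]
  rfl

end Regular

end PathMeasure

/-! ### Explicit particle laws and almost sure bounds. -/

section Laws

variable {X : ℕ → Type u} [∀ n, MeasurableSpace (X n)] {M : PathModel X}

/-- The probabilities of the forward index. -/
noncomputable def selProb (P : Proposal M) (ρ : Bool) (n : ℕ) {N : ℕ} (s : Sample X N n)
    (i I : Fin N) : ℝ≥0 :=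
  if ρ then catProb (fun l => (s l).2.2 * P.ϑ n (s l).1) I else if I = i then 1 else 0

/-- The probabilities of the backward index; without backward sampling it is the forward index. -/
noncomputable def backProb (M : PathModel X) (ε : Bool) (n : ℕ) {N : ℕ} (s : Sample X N n)
    (y : X (n + 1)) (I J : Fin N) : ℝ≥0 :=
  if ε then catProb (fun j => (s j).2.2 * M.ell n (s j).1 y) J else if J = I then 1 else 0

/-- The average of the statistics moved from two ancestors. -/
noncomputable def avgStat (h : AdditiveTerms X) (n : ℕ) {N : ℕ} (s : Sample X N n) (I J : Fin N)
    (y : X (n + 1)) : ℝ :=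
  2⁻¹ * (movedStat h n s I y + movedStat h n s J y)

variable {N n : ℕ}

lemma lintegral_selectionLaw (P : Proposal M) (ρ : Bool) (s : Sample X N n) (i : Fin N)
    (f : Fin N → ℝ≥0∞) :
    ∫⁻ I, f I ∂(selectionLaw P ρ n s i) = ∑ I, (selProb P ρ n s i I : ℝ≥0∞) * f I := by
  unfold selectionLaw selProb
  cases ρ
  · simp [apply_ite]
  · simp [lintegral_cat]

lemma lintegral_statLaw (h : AdditiveTerms X) (ε : Bool) (s : Sample X N n) (I : Fin N)
    (y : X (n + 1)) {f : ℝ → ℝ≥0∞} (hf : Measurable f) :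
    ∫⁻ t, f t ∂(statLaw M h ε n s I y) =
      ∑ J, (backProb M ε n s y I J : ℝ≥0∞) * f (avgStat h n s I J y) := by
  unfold statLaw backProb avgStat
  cases ε
  -- With `J = I` the average collapses to the moved statistic, so one formula covers both cases.
  · have : ∀ a : ℝ, 2⁻¹ * (a + a) = a := fun a => by ring
    simp [apply_ite, this]
  · simp [lintegral_map hf (measurable_of_finite _), lintegral_cat]

lemma measurable_backProb (M : PathModel X) (ε : Bool) (I J : Fin N) :
    Measurable fun q : Sample X N n × X (n + 1) => backProb M ε n q.1 q.2 I J := by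
  unfold backProb
  cases ε
  · simp
  · simp only [if_true]
    exact measurable_catProb (fun j => Measurable.mul (by fun_prop) (measurable_ell_sample j)) J

lemma measurable_backProb_right (M : PathModel X) (ε : Bool) (s : Sample X N n) (I J : Fin N) :
    Measurable fun y => backProb M ε n s y I J :=
  (measurable_backProb M ε I J).comp (measurable_prodMk_left (x := s))

lemma measurable_avgStat (h : AdditiveTerms X) (I J : Fin N) :
    Measurable fun q : Sample X N n × X (n + 1) => avgStat h n q.1 I J q.2 :=
  ((measurable_movedStat h I).add (measurable_movedStat h J)).const_mul _

/-- The position, statistic and weight of a particle with given ancestors and position. -/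
noncomputable def offspring (P : Proposal M) (h : AdditiveTerms X) (ρ : Bool) (n : ℕ) {N : ℕ}
    (s : Sample X N n) (i I J : Fin N) (y : X (n + 1)) : X (n + 1) × ℝ × ℝ≥0 :=
  (y, avgStat h n s I J y, newWeight P ρ n s i I y)

lemma measurable_offspring (P : Proposal M) (h : AdditiveTerms X) (ρ : Bool) (s : Sample X N n)
    (i I J : Fin N) : Measurable (offspring P h ρ n s i I J) :=
  measurable_id.prodMk
    (((measurable_avgStat h I J).comp (measurable_prodMk_left (x := s))).prodMk
      ((measurable_newWeight P ρ i I).comp (measurable_prodMk_left (x := s))))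

lemma measurable_p_right (P : Proposal M) (x : X n) : Measurable fun y => P.p n x y :=
  (P.measurable_p n).comp (measurable_prodMk_left (x := x))

/-- The particle law as a finite mixture of images of measures with densities. -/
lemma particleLaw_eq (P : Proposal M) (h : AdditiveTerms X) (ρ ε : Bool) (s : Sample X N n)
    (i : Fin N) :
    particleLaw P h ρ ε n s i = ∑ I, ∑ J, selProb P ρ n s i I •
      ((M.μ (n + 1)).withDensity fun y =>
        ((P.p n (s I).1 y * backProb M ε n s y I J : ℝ≥0) : ℝ≥0∞)).map
          (offspring P h ρ n s i I J) := by
  refine Measure.ext_of_lintegral _ fun F hF => ?_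
  simp only [lintegral_finsetSum_measure, lintegral_smul_measure]
  rw [particleLaw, Measure.lintegral_bind (measurable_of_finite _).aemeasurable hF.aemeasurable,
    lintegral_selectionLaw]
  refine Finset.sum_congr rfl fun I _ => ?_
  simp only [ENNReal.smul_def, smul_eq_mul]
  rw [← Finset.mul_sum]
  congr 1
  have hK : Measurable fun y => (statLaw M h ε n s I y).map
      fun t => (y, t, newWeight P ρ n s i I y) :=
    (measurable_map_statLaw (n := n) P h ρ ε i I).comp (measurable_prodMk_left (x := s))
  have hp := (measurable_p_right P (s I).1).coe_nnreal_ennreal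
  have hb := fun J => (measurable_backProb_right M ε s I J).coe_nnreal_ennreal
  have hoff := measurable_offspring P h ρ s i I
  rw [Measure.lintegral_bind hK.aemeasurable hF.aemeasurable, mutationLaw,
    lintegral_withDensity_eq_lintegral_mul _ hp
      (g := fun y => ∫⁻ z, F z ∂((statLaw M h ε n s I y).map
        fun t => (y, t, newWeight P ρ n s i I y))) ((Measure.measurable_lintegral hF).comp hK)]
  have hd : ∀ J, Measurable fun y =>
      ((P.p n (s I).1 y * backProb M ε n s y I J : ℝ≥0) : ℝ≥0∞) := fun J =>
    ((measurable_p_right P (s I).1).mul (measurable_backProb_right M ε s I J)).coe_nnreal_ennreal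
  have hFo : ∀ J, Measurable fun y => F (offspring P h ρ n s i I J y) := fun J => hF.comp (hoff J)
  have e : ∀ J, ∫⁻ z, F z ∂((M.μ (n + 1)).withDensity fun y =>
        ((P.p n (s I).1 y * backProb M ε n s y I J : ℝ≥0) : ℝ≥0∞)).map
          (offspring P h ρ n s i I J) = ∫⁻ y, (P.p n (s I).1 y : ℝ≥0∞) *
          (backProb M ε n s y I J * F (offspring P h ρ n s i I J y)) ∂(M.μ (n + 1)) := fun J => by
    rw [lintegral_map hF (hoff J), lintegral_withDensity_eq_lintegral_mul _ (hd J) (hFo J)]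
    refine lintegral_congr fun y => ?_
    simp [mul_assoc]
  simp only [e]
  rw [← lintegral_finsetSum _ fun J _ => Measurable.fun_mul hp (Measurable.fun_mul (hb J) (hFo J))]
  refine lintegral_congr fun y => ?_
  have hm : Measurable fun t : ℝ => (y, t, newWeight P ρ n s i I y) := by fun_prop
  simp only [Pi.mul_apply, ← Finset.mul_sum]
  rw [lintegral_map hF hm, lintegral_statLaw h ε s I y
    (f := fun t => F (y, t, newWeight P ρ n s i I y)) (hF.comp hm)]
  rfl

lemma integral_particleLaw (P : Proposal M) (h : AdditiveTerms X) (ρ ε : Bool) (s : Sample X N n)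
    (i : Fin N) {G : X (n + 1) × ℝ × ℝ≥0 → ℝ} (hG : Measurable G) {C : ℝ}
    (hC : ∀ I J y, |G (offspring P h ρ n s i I J y)| ≤ C) :
    ∫ z, G z ∂(particleLaw P h ρ ε n s i) = ∑ I, selProb P ρ n s i I *
      ∫ y, P.p n (s I).1 y * ∑ J, backProb M ε n s y I J * G (offspring P h ρ n s i I J y)
        ∂(M.μ (n + 1)) := by
  have hpr := isProbabilityMeasure_particleLaw P h ρ ε s i
  have hoff := measurable_offspring P h ρ s i
  have hp_int : ∀ x : X n, Integrable (fun y => (P.p n x y : ℝ)) (M.μ (n + 1)) := fun x => by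
    refine ⟨(measurable_p_right P x).coe_nnreal_real.aestronglyMeasurable, ?_⟩
    simp [HasFiniteIntegral, P.p_mass]
  have hb1 : ∀ y I J, (backProb M ε n s y I J : ℝ) ≤ 1 := fun y I J => by
    unfold backProb
    split_ifs
    · have := sum_catProb (fun j => (s j).2.2 * M.ell n (s j).1 y) I
      rw [← ENNReal.ofNNReal_finsetSum] at this
      have h1 : ∑ i, catProb (fun j => (s j).2.2 * M.ell n (s j).1 y) i = 1 := by exact_mod_cast this
      exact_mod_cast (Finset.single_le_sum (fun _ _ => zero_le) (Finset.mem_univ J)).trans h1.le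
    · simp
    · simp
  have hint : ∀ I J, Integrable (fun y => P.p n (s I).1 y *
      (backProb M ε n s y I J * G (offspring P h ρ n s i I J y))) (M.μ (n + 1)) := fun I J => by
    refine Integrable.mul_bdd (c := C) (hp_int _) (((measurable_backProb_right M ε s I
      J).coe_nnreal_real.mul (hG.comp (hoff I J))).aestronglyMeasurable) (ae_of_all _ fun y => ?_)
    rw [Real.norm_eq_abs, abs_mul, NNReal.abs_eq]
    calc _ ≤ 1 * C := mul_le_mul (hb1 y I J) (hC I J y) (abs_nonneg _) zero_le_one
      _ = C := one_mul C
  set m : Fin N → Fin N → Measure (X (n + 1) × ℝ × ℝ≥0) := fun I J =>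
    ((M.μ (n + 1)).withDensity fun y =>
        ((P.p n (s I).1 y * backProb M ε n s y I J : ℝ≥0) : ℝ≥0∞)).map
          (offspring P h ρ n s i I J) with hm
  have hdens : ∀ I J, Measurable fun y => P.p n (s I).1 y * backProb M ε n s y I J := fun I J =>
    (measurable_p_right P (s I).1).mul (measurable_backProb_right M ε s I J)
  have hGm : ∀ I J, Integrable G (m I J) := fun I J => by
    rw [hm, integrable_map_measure hG.aestronglyMeasurable (hoff I J).aemeasurable,
      integrable_withDensity_iff_integrable_smul (hdens I J)]
    refine (hint I J).congr (ae_of_all _ fun y => ?_)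
    simp [NNReal.smul_def, mul_assoc]
  have e : ∀ I J, ∫ z, G z ∂(m I J) = ∫ y, P.p n (s I).1 y *
      (backProb M ε n s y I J * G (offspring P h ρ n s i I J y)) ∂(M.μ (n + 1)) := fun I J => by
    rw [hm, integral_map (hoff I J).aemeasurable hG.aestronglyMeasurable,
      integral_withDensity_eq_integral_smul (hdens I J)]
    refine integral_congr_ae (ae_of_all _ fun y => ?_)
    simp [NNReal.smul_def, mul_assoc]
  rw [particleLaw_eq, integral_finsetSum_measure fun I _ => integrable_finsetSum_measure.2
    fun J _ => (hGm I J).smul_measure_nnreal]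
  refine Finset.sum_congr rfl fun I _ => ?_
  rw [integral_finsetSum_measure fun J _ => (hGm I J).smul_measure_nnreal]
  simp only [integral_smul_nnreal_measure, NNReal.smul_def, smul_eq_mul]
  rw [← Finset.mul_sum]
  simp_rw [Finset.mul_sum Finset.univ _ (P.p n _ _ : ℝ)]
  rw [integral_finsetSum _ fun J _ => hint I J]
  congr 1
  exact Finset.sum_congr rfl fun J _ => e I J

variable {P : Proposal M} {h : AdditiveTerms X} {ρ ε : ℕ → Bool} {εl εu δ γ H : ℝ≥0}

/-- Samples whose weights and statistics satisfy the almost sure bounds. -/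
def GoodSample (ρ : ℕ → Bool) (δ H : ℝ≥0) {N n : ℕ} (s : Sample X N n) : Prop :=
  ∀ i, ((s i).2.2 : ℝ) ≤ weightBound ρ δ n ∧ |(s i).2.1| ≤ (n + 2 : ℝ) * H

lemma measurableSet_good (n : ℕ) : MeasurableSet {z : X n × ℝ × ℝ≥0 |
    (z.2.2 : ℝ) ≤ weightBound ρ δ n ∧ |z.2.1| ≤ (n + 2 : ℝ) * H} := by
  have h1 : Measurable fun z : X n × ℝ × ℝ≥0 => (z.2.2 : ℝ) :=
    (measurable_snd.comp measurable_snd).coe_nnreal_real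
  have h2 : Measurable fun z : X n × ℝ × ℝ≥0 => |z.2.1| :=
    (measurable_fst.comp measurable_snd).abs
  exact (measurableSet_le h1 measurable_const).inter (measurableSet_le h2 measurable_const)

lemma measurableSet_goodSample : MeasurableSet {s : Sample X N n | GoodSample ρ δ H s} := by
  have : {s : Sample X N n | GoodSample ρ δ H s} = ⋂ i, (fun s => s i) ⁻¹' {z : X n × ℝ × ℝ≥0 |
      (z.2.2 : ℝ) ≤ weightBound ρ δ n ∧ |z.2.1| ≤ (n + 2 : ℝ) * H} := by
    ext s
    simp [GoodSample]
  rw [this]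
  exact MeasurableSet.iInter fun i => measurable_pi_apply i (measurableSet_good n)

namespace Regular

/-- The bound `(n + 2) H` consists of `2 H` for the initial term and `H` per increment; averaging
two statistics respects it. -/
lemma abs_movedStat_le (A : Regular P h ρ ε εl εu δ γ H) {s : Sample X N n}
    (hs : GoodSample ρ δ H s) (I : Fin N) (y : X (n + 1)) :
    |movedStat h n s I y| ≤ ((n + 1 : ℕ) + 2 : ℝ) * H := by
  unfold movedStat
  push_cast
  calc _ ≤ _ := abs_add_le _ _
    _ ≤ (n + 2 : ℝ) * (H : ℝ) + H := add_le_add (hs I).2 (A.incr_le n _ _)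
    _ = _ := by ring

lemma newWeight_le (A : Regular P h ρ ε εl εu δ γ H) {s : Sample X N n}
    (hs : GoodSample ρ δ H s) (i I : Fin N) (y : X (n + 1)) :
    (newWeight P (ρ n) n s i I y : ℝ) ≤ weightBound ρ δ (n + 1) := by
  have h1 : (P.weightFn (ρ n) n (s I).1 y : ℝ) ≤ δ := by
    exact_mod_cast A.mix.weight_bound (ρ n) n (s I).1 y
  unfold newWeight weightBound
  push_cast
  cases hρ : ρ n
  · rw [hρ] at h1
    simp only [Bool.toNat_false, Nat.sub_zero, pow_one, Bool.false_eq_true, if_false]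
    exact mul_le_mul h1 (hs i).1 (by positivity) (by positivity)
  · rw [hρ] at h1
    simpa using h1

lemma good_offspring (A : Regular P h ρ ε εl εu δ γ H) {s : Sample X N n}
    (hs : GoodSample ρ δ H s) (i I J : Fin N) (y : X (n + 1)) :
    ((offspring P h (ρ n) n s i I J y).2.2 : ℝ) ≤ weightBound ρ δ (n + 1) ∧
      |(offspring P h (ρ n) n s i I J y).2.1| ≤ ((n + 1 : ℕ) + 2 : ℝ) * H := by
  refine ⟨A.newWeight_le hs i I y, ?_⟩
  have h1 := A.abs_movedStat_le hs I y
  have h2 := A.abs_movedStat_le hs J y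
  simp only [offspring, avgStat]
  rw [abs_le] at *
  constructor <;> linarith [h1.1, h1.2, h2.1, h2.2]

lemma ae_particleLaw (A : Regular P h ρ ε εl εu δ γ H) {s : Sample X N n}
    (hs : GoodSample ρ δ H s) (i : Fin N) :
    ∀ᵐ z ∂(particleLaw P h (ρ n) (ε n) n s i),
      (z.2.2 : ℝ) ≤ weightBound ρ δ (n + 1) ∧ |z.2.1| ≤ ((n + 1 : ℕ) + 2 : ℝ) * H := by
  have hmeas := measurableSet_good (X := X) (ρ := ρ) (δ := δ) (H := H) (n + 1)
  rw [particleLaw_eq, ae_iff]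
  simp only [Measure.finsetSum_apply, Measure.smul_apply]
  refine Finset.sum_eq_zero fun I _ => Finset.sum_eq_zero fun J _ => ?_
  change _ • (Measure.map _ _) {z : X (n + 1) × ℝ × ℝ≥0 |
      (z.2.2 : ℝ) ≤ weightBound ρ δ (n + 1) ∧ |z.2.1| ≤ ((n + 1 : ℕ) + 2 : ℝ) * H}ᶜ = 0
  rw [Measure.map_apply (measurable_offspring P h (ρ n) s i I J) hmeas.compl]
  have : offspring P h (ρ n) n s i I J ⁻¹' {z : X (n + 1) × ℝ × ℝ≥0 |
      (z.2.2 : ℝ) ≤ weightBound ρ δ (n + 1) ∧ |z.2.1| ≤ ((n + 1 : ℕ) + 2 : ℝ) * H}ᶜ = ∅ := by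
    ext y
    simpa using A.good_offspring hs i I J y
  rw [this]
  simp

lemma ae_stepLaw (A : Regular P h ρ ε εl εu δ γ H) {s : Sample X N n}
    (hs : GoodSample ρ δ H s) :
    ∀ᵐ s' ∂(stepLaw P h (ρ n) (ε n) n s), GoodSample ρ δ H s' := by
  unfold GoodSample
  rw [ae_all_iff]
  intro i
  exact (measurePreserving_eval (fun i => particleLaw P h (ρ n) (ε n) n s i)
    i).quasiMeasurePreserving.ae (A.ae_particleLaw hs i)

lemma ae_law (A : Regular P h ρ ε εl εu δ γ H) (N n : ℕ) :
    ∀ᵐ s ∂(law P h ρ ε N n), GoodSample ρ δ H s := by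
  induction n with
  | zero =>
    unfold GoodSample
    rw [ae_all_iff]
    intro i
    have h0 : IsProbabilityMeasure ((M.μ 0).withDensity fun x => (P.ν x : ℝ≥0∞)) :=
      ⟨by simp [P.ν_mass]⟩
    have hm : Measurable fun x => (x, h.init x, P.initWeightFn x) :=
      measurable_id.prodMk (h.measurable_init.prodMk (M.measurable_χ.div P.measurable_ν))
    have := Measure.isProbabilityMeasure_map (μ := (M.μ 0).withDensity fun x => (P.ν x : ℝ≥0∞))
      hm.aemeasurable
    refine (measurePreserving_eval (fun _ : Fin N => ((M.μ 0).withDensity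
      fun x => (P.ν x : ℝ≥0∞)).map fun x => (x, h.init x, P.initWeightFn x))
        i).quasiMeasurePreserving.ae ?_ (p := fun z : X 0 × ℝ × ℝ≥0 =>
          (z.2.2 : ℝ) ≤ weightBound ρ δ 0 ∧ |z.2.1| ≤ ((0 : ℕ) + 2 : ℝ) * H)
    rw [ae_map_iff hm.aemeasurable (measurableSet_good 0)]
    refine ae_of_all _ fun x => ⟨?_, ?_⟩
    · simp only [weightBound]
      exact_mod_cast A.mix.initWeight_bound x
    · simpa using A.abs_init_le x
  | succ n ih =>
    rw [law, ae_iff]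
    change (Measure.bind _ _) {s : Sample X N (n + 1) | GoodSample ρ δ H s}ᶜ = 0
    rw [Measure.bind_apply measurableSet_goodSample.compl
      (measurable_stepLaw P h (ρ n) (ε n)).aemeasurable]
    refine (lintegral_congr_ae ?_).trans lintegral_zero
    filter_upwards [ih] with s hs
    exact A.ae_stepLaw hs

end Regular

/-- The one-step kernel. -/
noncomputable def stepKernel (P : Proposal M) (h : AdditiveTerms X) (ρ ε : Bool) (N n : ℕ) :
    Kernel (Sample X N n) (Sample X N (n + 1)) :=
  ⟨stepLaw P h ρ ε n, measurable_stepLaw P h ρ ε⟩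

/-- Conditioning on the previous sample; needed for real test functions and for complex
exponentials. -/
lemma integral_law_succ {E : Type*} [NormedAddCommGroup E] [NormedSpace ℝ E] (P : Proposal M)
    (h : AdditiveTerms X) (ρ ε : ℕ → Bool) (N n : ℕ) {G : Sample X N (n + 1) → E}
    (hG : Integrable G (law P h ρ ε N (n + 1))) :
    ∫ s', G s' ∂(law P h ρ ε N (n + 1)) =
      ∫ s, ∫ s', G s' ∂(stepLaw P h (ρ n) (ε n) n s) ∂(law P h ρ ε N n) := by
  have e : law P h ρ ε N (n + 1) = (law P h ρ ε N n).bind (stepKernel P h (ρ n) (ε n) N n) := rfl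
  rw [e, Measure.comp_eq_comp_const_apply] at hG ⊢
  rw [Kernel.integral_comp hG, Kernel.const_apply]
  rfl

lemma measurable_integral_stepLaw {E : Type*} [NormedAddCommGroup E] [NormedSpace ℝ E]
    (P : Proposal M) (h : AdditiveTerms X) (ρ ε : Bool) {G : Sample X N (n + 1) → E}
    (hG : StronglyMeasurable G) :
    StronglyMeasurable fun s : Sample X N n => ∫ s', G s' ∂(stepLaw P h ρ ε n s) :=
  hG.integral_kernel (κ := stepKernel P h ρ ε N n)

lemma measurable_integral_particleLaw (P : Proposal M) (h : AdditiveTerms X) (ρ ε : Bool)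
    (i : Fin N) {G : X (n + 1) × ℝ × ℝ≥0 → ℝ} (hG : Measurable G) :
    Measurable fun s : Sample X N n => ∫ z, G z ∂(particleLaw P h ρ ε n s i) := by
  let κ : Kernel (Sample X N n) (X (n + 1) × ℝ × ℝ≥0) :=
    ⟨fun s => particleLaw P h ρ ε n s i, measurable_particleLaw P h ρ ε i⟩
  have : IsMarkovKernel κ := ⟨fun s => isProbabilityMeasure_particleLaw P h ρ ε s i⟩
  exact (hG.stronglyMeasurable.integral_kernel (κ := κ)).measurable

end Laws

/-! ### A calculus of mean-square convergence at rate `1 / N`, uniform over families. -/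

section Rates

variable {Ω : ℕ → Type*} [∀ N, MeasurableSpace (Ω N)] {m : ∀ N, Measure (Ω N)}
  [∀ N, IsProbabilityMeasure (m N)]

/-- The bounded random variables `u N` converge to `a` in mean square at rate `C / N`. -/
structure Rate (m : ∀ N, Measure (Ω N)) (u : ∀ N, Ω N → ℝ) (a K C : ℝ) : Prop where
  meas : ∀ N, Measurable (u N)
  bdd : ∀ N, ∀ᵐ s ∂(m N), |u N s| ≤ K
  lim_le : |a| ≤ K
  rate : ∀ N, 1 ≤ N → ∫ s, (u N s - a) ^ 2 ∂(m N) ≤ C / N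

/-- A family of random variables converging in mean square at a uniform rate. -/
def RateFam {ι : Type*} (m : ∀ N, Measure (Ω N)) (u : ι → ∀ N, Ω N → ℝ) (a : ι → ℝ) : Prop :=
  ∃ K C, ∀ i, Rate m (u i) (a i) K C

lemma integrable_of_ae_abs_le {α : Type*} [MeasurableSpace α] {μ : Measure α} [IsFiniteMeasure μ]
    {f : α → ℝ} (hf : Measurable f) {C : ℝ} (hC : ∀ᵐ x ∂μ, |f x| ≤ C) : Integrable f μ :=
  Integrable.of_bound hf.aestronglyMeasurable C hC

lemma Rate.nonneg {u : ∀ N, Ω N → ℝ} {a K C : ℝ} (hu : Rate m u a K C) : 0 ≤ K :=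
  (abs_nonneg _).trans hu.lim_le

lemma Rate.integrable_sq {u : ∀ N, Ω N → ℝ} {a K C : ℝ} (hu : Rate m u a K C) (N : ℕ) (b : ℝ) :
    Integrable (fun s => (u N s - b) ^ 2) (m N) := by
  refine integrable_of_ae_abs_le (((hu.meas N).sub_const b).pow_const 2) (C := (K + |b|) ^ 2) ?_
  filter_upwards [hu.bdd N] with s hs
  rw [abs_pow]
  exact pow_le_pow_left₀ (abs_nonneg _) ((abs_sub _ _).trans (by linarith)) 2

/-- Comparison of mean square errors. -/
lemma Rate.of_le {u v w : ∀ N, Ω N → ℝ} {a b c K K' K'' C C' α β : ℝ} (hu : Rate m u a K C)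
    (hv : Rate m v b K' C') (hw : ∀ N, Measurable (w N)) (hwK : ∀ N, ∀ᵐ s ∂(m N), |w N s| ≤ K'')
    (hc : |c| ≤ K'') (hα : 0 ≤ α) (hβ : 0 ≤ β)
    (h : ∀ N, ∀ᵐ s ∂(m N), (w N s - c) ^ 2 ≤ α * (u N s - a) ^ 2 + β * (v N s - b) ^ 2) :
    Rate m w c K'' (α * C + β * C') := by
  refine ⟨hw, hwK, hc, fun N hN => ?_⟩
  have i1 := (hu.integrable_sq N a).const_mul α
  have i2 := (hv.integrable_sq N b).const_mul β
  calc ∫ s, (w N s - c) ^ 2 ∂(m N)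
      ≤ ∫ s, (α * (u N s - a) ^ 2 + β * (v N s - b) ^ 2) ∂(m N) :=
        integral_mono_of_nonneg (ae_of_all _ fun s => sq_nonneg _) (i1.add i2) (h N)
    _ = α * ∫ s, (u N s - a) ^ 2 ∂(m N) + β * ∫ s, (v N s - b) ^ 2 ∂(m N) := by
        rw [integral_add i1 i2, integral_const_mul, integral_const_mul]
    _ ≤ α * (C / N) + β * (C' / N) := by
        gcongr
        · exact hu.rate N hN
        · exact hv.rate N hN
    _ = _ := by ring

lemma Rate.const {c K : ℝ} (h : |c| ≤ K) : Rate m (fun _ _ => c) c K 0 :=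
  ⟨fun _ => measurable_const, fun _ => ae_of_all _ fun _ => h, h, fun N _ => by simp⟩

lemma Rate.add {u v : ∀ N, Ω N → ℝ} {a b K K' C C' : ℝ} (hu : Rate m u a K C)
    (hv : Rate m v b K' C') :
    Rate m (fun N s => u N s + v N s) (a + b) (K + K') (2 * C + 2 * C') := by
  refine hu.of_le hv (fun N => (hu.meas N).add (hv.meas N)) (fun N => ?_)
    ((abs_add_le _ _).trans (add_le_add hu.lim_le hv.lim_le)) zero_le_two zero_le_two
    (fun N => ae_of_all _ fun s => ?_)
  · filter_upwards [hu.bdd N, hv.bdd N] with s h1 h2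
    exact (abs_add_le _ _).trans (add_le_add h1 h2)
  · nlinarith [sq_nonneg (u N s - a - (v N s - b))]

lemma Rate.mul {u v : ∀ N, Ω N → ℝ} {a b K K' C C' : ℝ} (hu : Rate m u a K C)
    (hv : Rate m v b K' C') :
    Rate m (fun N s => u N s * v N s) (a * b) (K * K') (2 * K' ^ 2 * C + 2 * K ^ 2 * C') := by
  refine hu.of_le hv (fun N => (hu.meas N).mul (hv.meas N)) (fun N => ?_) ?_ (by positivity)
    (by positivity) (fun N => ?_)
  · filter_upwards [hu.bdd N, hv.bdd N] with s h1 h2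
    rw [abs_mul]
    exact mul_le_mul h1 h2 (abs_nonneg _) hu.nonneg
  · rw [abs_mul]
    exact mul_le_mul hu.lim_le hv.lim_le (abs_nonneg _) hu.nonneg
  · filter_upwards [hv.bdd N] with s h2
    have e : u N s * v N s - a * b = v N s * (u N s - a) + a * (v N s - b) := by ring
    have h3 : v N s ^ 2 ≤ K' ^ 2 := sq_le_sq' (abs_le.1 h2).1 (abs_le.1 h2).2
    have h4 : a ^ 2 ≤ K ^ 2 := sq_le_sq' (abs_le.1 hu.lim_le).1 (abs_le.1 hu.lim_le).2
    calc _ ≤ 2 * (v N s * (u N s - a)) ^ 2 + 2 * (a * (v N s - b)) ^ 2 := by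
          rw [e]
          nlinarith [sq_nonneg (v N s * (u N s - a) - a * (v N s - b))]
      _ = 2 * v N s ^ 2 * (u N s - a) ^ 2 + 2 * a ^ 2 * (v N s - b) ^ 2 := by ring
      _ ≤ _ := by gcongr

/-- The quotient is given through `x * v = u` with `x` bounded, so the random denominator may
vanish; only its limit has to be bounded below. -/
lemma Rate.div {u v x : ∀ N, Ω N → ℝ} {a b K K' C C' Kx b₀ : ℝ} (hu : Rate m u a K C)
    (hv : Rate m v b K' C') (hx : ∀ N, Measurable (x N)) (hxK : ∀ N, ∀ᵐ s ∂(m N), |x N s| ≤ Kx)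
    (hxv : ∀ N, ∀ᵐ s ∂(m N), x N s * v N s = u N s) (hb₀ : 0 < b₀) (hb : b₀ ≤ b) :
    Rate m x (a / b) (max Kx (K / b₀)) (2 / b₀ ^ 2 * C + 2 * Kx ^ 2 / b₀ ^ 2 * C') := by
  have hbpos : 0 < b := hb₀.trans_le hb
  refine hu.of_le hv hx (fun N => ?_) ?_ (by positivity) (by positivity) (fun N => ?_)
  · filter_upwards [hxK N] with s hs
    exact hs.trans (le_max_left _ _)
  · rw [abs_div, abs_of_pos hbpos]
    exact (div_le_div₀ hu.nonneg hu.lim_le hb₀ hb).trans (le_max_right _ _)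
  · filter_upwards [hxK N, hxv N] with s h1 h2
    -- This form divides by the deterministic limit only.
    have e : x N s - a / b = ((u N s - a) - x N s * (v N s - b)) / b := by
      rw [← h2]
      field_simp
      ring
    have h3 : x N s ^ 2 ≤ Kx ^ 2 := sq_le_sq' (abs_le.1 h1).1 (abs_le.1 h1).2
    calc _ = ((u N s - a) - x N s * (v N s - b)) ^ 2 / b ^ 2 := by rw [e, div_pow]
      _ ≤ (2 * (u N s - a) ^ 2 + 2 * (x N s * (v N s - b)) ^ 2) / b₀ ^ 2 := by
          gcongr
          nlinarith [sq_nonneg ((u N s - a) + x N s * (v N s - b))]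
      _ = (2 * (u N s - a) ^ 2 + 2 * x N s ^ 2 * (v N s - b) ^ 2) / b₀ ^ 2 := by ring
      _ ≤ (2 * (u N s - a) ^ 2 + 2 * Kx ^ 2 * (v N s - b) ^ 2) / b₀ ^ 2 := by gcongr
      _ = _ := by ring

lemma Rate.congr {u v : ∀ N, Ω N → ℝ} {a K C : ℝ} (hu : Rate m u a K C)
    (hv : ∀ N, Measurable (v N)) (h : ∀ N, 1 ≤ N → ∀ᵐ s ∂(m N), v N s = u N s)
    (hK : ∀ N, ∀ᵐ s ∂(m N), |v N s| ≤ K) : Rate m v a K C := by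
  refine ⟨hv, hK, hu.lim_le, fun N hN => ?_⟩
  refine le_trans (le_of_eq (integral_congr_ae ?_)) (hu.rate N hN)
  filter_upwards [h N hN] with s hs
  rw [hs]

section Families

variable {ι : Type*} {u v : ι → ∀ N, Ω N → ℝ} {a b : ι → ℝ}

lemma RateFam.const {K : ℝ} (h : ∀ i, |a i| ≤ K) : RateFam m (fun i _ _ => a i) a :=
  ⟨K, 0, fun i => Rate.const (h i)⟩

lemma RateFam.add (hu : RateFam m u a) (hv : RateFam m v b) :
    RateFam m (fun i N s => u i N s + v i N s) (fun i => a i + b i) := by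
  obtain ⟨K, C, h1⟩ := hu
  obtain ⟨K', C', h2⟩ := hv
  exact ⟨_, _, fun i => (h1 i).add (h2 i)⟩

lemma RateFam.mul (hu : RateFam m u a) (hv : RateFam m v b) :
    RateFam m (fun i N s => u i N s * v i N s) (fun i => a i * b i) := by
  obtain ⟨K, C, h1⟩ := hu
  obtain ⟨K', C', h2⟩ := hv
  exact ⟨_, _, fun i => (h1 i).mul (h2 i)⟩

lemma RateFam.mul_const (hu : RateFam m u a) (c : ℝ) :
    RateFam m (fun i N s => u i N s * c) (fun i => a i * c) :=
  hu.mul (RateFam.const (a := fun _ => c) fun _ => le_rfl)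

lemma RateFam.sum {κ : Type*} (t : Finset κ) {u : κ → ι → ∀ N, Ω N → ℝ} {a : κ → ι → ℝ}
    (hu : ∀ j ∈ t, RateFam m (u j) (a j)) :
    RateFam m (fun i N s => ∑ j ∈ t, u j i N s) (fun i => ∑ j ∈ t, a j i) := by
  induction t using Finset.cons_induction with
  | empty => simpa using RateFam.const (m := m) (a := fun _ : ι => (0 : ℝ)) (K := 0) (by simp)
  | cons j t hj ih =>
    simp only [Finset.sum_cons]
    exact (hu j (by simp)).add (ih fun j hj => hu j (by simp [hj]))

lemma RateFam.reindex (hu : RateFam m u a) {κ : Type*} (e : κ → ι) :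
    RateFam m (fun j => u (e j)) (fun j => a (e j)) := by
  obtain ⟨K, C, h1⟩ := hu
  exact ⟨K, C, fun j => h1 (e j)⟩

lemma RateFam.div {x : ι → ∀ N, Ω N → ℝ} {Kx b₀ : ℝ} (hu : RateFam m u a) (hv : RateFam m v b)
    (hx : ∀ i N, Measurable (x i N)) (hxK : ∀ i N, ∀ᵐ s ∂(m N), |x i N s| ≤ Kx)
    (hxv : ∀ i N, ∀ᵐ s ∂(m N), x i N s * v i N s = u i N s) (hb₀ : 0 < b₀)
    (hb : ∀ i, b₀ ≤ b i) : RateFam m x fun i => a i / b i := by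
  obtain ⟨K, C, h1⟩ := hu
  obtain ⟨K', C', h2⟩ := hv
  exact ⟨_, _, fun i => (h1 i).div (h2 i) (hx i) (hxK i) (hxv i) hb₀ (hb i)⟩

lemma sq_integral_le {α : Type*} [MeasurableSpace α] {μ : Measure α} [IsProbabilityMeasure μ]
    {f : α → ℝ} (hf : Measurable f) {C : ℝ} (hC : ∀ᵐ x ∂μ, |f x| ≤ C) :
    (∫ x, f x ∂μ) ^ 2 ≤ ∫ x, f x ^ 2 ∂μ := by
  have h1 := integrable_of_ae_abs_le hf hC
  have h2 : Integrable (fun x => f x ^ 2) μ := by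
    refine integrable_of_ae_abs_le (hf.pow_const 2) (C := C ^ 2) ?_
    filter_upwards [hC] with x hx
    rw [abs_pow]
    exact pow_le_pow_left₀ (abs_nonneg _) hx 2
  set c := ∫ x, f x ∂μ with hc
  have h3 : 0 ≤ ∫ x, (f x - c) ^ 2 ∂μ := integral_nonneg fun x => sq_nonneg _
  have h4 : ∫ x, (f x - c) ^ 2 ∂μ = ∫ x, f x ^ 2 ∂μ - 2 * c * c + c ^ 2 := by
    have : ∀ x, (f x - c) ^ 2 = f x ^ 2 - 2 * c * f x + c ^ 2 := fun x => by ring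
    simp_rw [this]
    have i12 : Integrable (fun x => f x ^ 2 - 2 * c * f x) μ := h2.sub (h1.const_mul _)
    rw [integral_add i12 (integrable_const _), integral_sub h2 (h1.const_mul _), integral_const_mul, ← hc]
    simp
  nlinarith

/-- By Jensen and Fubini the mean square error of an integral is at most the integrated error;
uniformity in the parameter `y` is essential. It serves to integrate over the new position. -/
lemma RateFam.integral {Y : Type*} [MeasurableSpace Y] (μ : Measure Y) [IsProbabilityMeasure μ]
    {u : ι → Y → ∀ N, Ω N → ℝ} {a : ι → Y → ℝ}
    (hu : RateFam m (fun q : ι × Y => u q.1 q.2) (fun q => a q.1 q.2))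
    (hmu : ∀ i N, Measurable fun q : Ω N × Y => u i q.2 N q.1) (hma : ∀ i, Measurable (a i)) :
    RateFam m (fun i N s => ∫ y, u i y N s ∂μ) (fun i => ∫ y, a i y ∂μ) := by
  obtain ⟨K, C, h1⟩ := hu
  refine ⟨K, C, fun i => ⟨fun N => ?_, fun N => ?_, ?_, fun N hN => ?_⟩⟩
  · exact ((hmu i N).stronglyMeasurable.integral_prod_right).measurable
  · have hms : MeasurableSet {q : Ω N × Y | |u i q.2 N q.1| ≤ K} :=
      measurableSet_le (hmu i N).abs measurable_const
    have := (Measure.ae_ae_comm (μ := m N) (ν := μ) (p := fun s y => |u i y N s| ≤ K) hms).2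
      (ae_of_all _ fun y => (h1 (i, y)).bdd N)
    filter_upwards [this] with s hs
    simpa using norm_integral_le_of_norm_le_const (f := fun y => u i y N s) (C := K) hs
  · have := norm_integral_le_of_norm_le_const (μ := μ) (f := a i) (C := K)
      (ae_of_all _ fun y => (h1 (i, y)).lim_le)
    simpa using this
  · have hms : MeasurableSet {q : Ω N × Y | |u i q.2 N q.1| ≤ K} :=
      measurableSet_le (hmu i N).abs measurable_const
    have hbd := (Measure.ae_ae_comm (μ := m N) (ν := μ) (p := fun s y => |u i y N s| ≤ K) hms).2
      (ae_of_all _ fun y => (h1 (i, y)).bdd N)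
    have hd : Measurable fun q : Ω N × Y => u i q.2 N q.1 - a i q.2 :=
      (hmu i N).sub ((hma i).comp measurable_snd)
    have hbd2 : ∀ᵐ q ∂((m N).prod μ), |(u i q.2 N q.1 - a i q.2) ^ 2| ≤ (K + K) ^ 2 := by
      have hms2 : MeasurableSet {q : Ω N × Y | |(u i q.2 N q.1 - a i q.2) ^ 2| ≤ (K + K) ^ 2} :=
        measurableSet_le (hd.pow_const 2).abs measurable_const
      rw [Measure.ae_prod_iff_ae_ae hms2]
      filter_upwards [hbd] with s hs
      filter_upwards [hs] with y hy
      rw [abs_pow]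
      exact pow_le_pow_left₀ (abs_nonneg _)
        ((abs_sub _ _).trans (add_le_add hy (h1 (i, y)).lim_le)) 2
    have hint : Integrable (fun q : Ω N × Y => (u i q.2 N q.1 - a i q.2) ^ 2) ((m N).prod μ) :=
      integrable_of_ae_abs_le (hd.pow_const 2) hbd2
    calc ∫ s, (∫ y, u i y N s ∂μ - ∫ y, a i y ∂μ) ^ 2 ∂(m N)
        ≤ ∫ s, ∫ y, (u i y N s - a i y) ^ 2 ∂μ ∂(m N) := by
          refine integral_mono_of_nonneg (ae_of_all _ fun s => sq_nonneg _)
            hint.integral_prod_left ?_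
          filter_upwards [hbd] with s hs
          have m1 : Measurable fun y => u i y N s := (hmu i N).comp measurable_prodMk_left
          rw [← integral_sub (integrable_of_ae_abs_le m1 hs) (integrable_of_ae_abs_le (hma i)
            (ae_of_all _ fun y => (h1 (i, y)).lim_le))]
          refine sq_integral_le (m1.sub (hma i)) (C := K + K) ?_
          filter_upwards [hs] with y hy
          exact (abs_sub _ _).trans (add_le_add hy (h1 (i, y)).lim_le)
      _ = ∫ y, ∫ s, (u i y N s - a i y) ^ 2 ∂(m N) ∂μ := integral_integral_swap hint
      _ ≤ ∫ _, C / N ∂μ := integral_mono hint.integral_prod_right (integrable_const _)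
          fun y => (h1 (i, y)).rate N hN
      _ = C / N := by simp

end Families

/-- The mean over the particles of a sample. -/
noncomputable def emp {E : Type*} {N : ℕ} (g : E → ℝ) (s : Fin N → E) : ℝ :=
  (N : ℝ)⁻¹ * ∑ i, g (s i)

lemma abs_emp_le {E : Type*} {N : ℕ} {g : E → ℝ} {s : Fin N → E} {C : ℝ} (hC : 0 ≤ C)
    (h : ∀ i, |g (s i)| ≤ C) : |emp g s| ≤ C := by
  unfold emp
  rcases Nat.eq_zero_or_pos N with rfl | hN
  · simpa using hC
  · have hN' : (0 : ℝ) < N := by exact_mod_cast hN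
    rw [abs_mul, abs_inv, abs_of_pos hN', inv_mul_le_iff₀ hN']
    calc _ ≤ ∑ i, |g (s i)| := Finset.abs_sum_le_sum_abs _ _
      _ ≤ ∑ _ : Fin N, C := Finset.sum_le_sum fun i _ => h i
      _ = N * C := by simp

lemma measurable_emp {E : Type*} [MeasurableSpace E] {N : ℕ} {g : E → ℝ} (hg : Measurable g) :
    Measurable fun s : Fin N → E => emp g s :=
  (Finset.measurable_fun_sum _ fun i _ => hg.comp (measurable_pi_apply i)).const_mul _

lemma emp_add {E : Type*} {N : ℕ} (f g : E → ℝ) (s : Fin N → E) :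
    emp (fun z => f z + g z) s = emp f s + emp g s := by
  simp [emp, Finset.sum_add_distrib, mul_add]

lemma emp_mul_const {E : Type*} {N : ℕ} (f : E → ℝ) (c : ℝ) (s : Fin N → E) :
    emp (fun z => f z * c) s = emp f s * c := by
  simp [emp, Finset.sum_mul, mul_assoc]

lemma emp_sum {E κ : Type*} {N : ℕ} (t : Finset κ) (f : κ → E → ℝ) (s : Fin N → E) :
    emp (fun z => ∑ j ∈ t, f j z) s = ∑ j ∈ t, emp (f j) s := by
  simp only [emp, ← Finset.mul_sum]
  rw [Finset.sum_comm]

/-- Mean square error of the mean of independent bounded random variables. -/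
lemma integral_emp_sub_sq_le {E : Type*} [MeasurableSpace E] {N : ℕ} (hN : 1 ≤ N)
    (Q : Fin N → Measure E) [∀ i, IsProbabilityMeasure (Q i)] {g : E → ℝ} (hg : Measurable g)
    {G : ℝ} (hG : ∀ i, ∀ᵐ z ∂(Q i), |g z| ≤ G) (a : ℝ) :
    ∫ s, (emp g s - a) ^ 2 ∂(Measure.pi Q) ≤
      G ^ 2 / N + ((N : ℝ)⁻¹ * ∑ i, ∫ z, g z ∂(Q i) - a) ^ 2 := by
  have hN' : (0 : ℝ) < N := by exact_mod_cast hN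
  have hae : ∀ i, ∀ᵐ s ∂(Measure.pi Q), |g (s i)| ≤ G := fun i =>
    (measurePreserving_eval Q i).quasiMeasurePreserving.ae (hG i)
  have hmi : ∀ i, Measurable fun s : Fin N → E => g (s i) := fun i =>
    hg.comp (measurable_pi_apply i)
  have hG0 : 0 ≤ G := by
    obtain ⟨z, hz⟩ := (hG ⟨0, hN⟩).exists
    exact (abs_nonneg _).trans hz
  have hmL : ∀ i, MemLp g 2 (Q i) := fun i => MemLp.of_bound hg.aestronglyMeasurable G (hG i)
  have hsum : MemLp (fun s : Fin N → E => ∑ i, g (s i)) 2 (Measure.pi Q) :=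
    memLp_finsetSum _ fun i _ => MemLp.of_bound (hmi i).aestronglyMeasurable G (hae i)
  have hemp : MemLp (fun s : Fin N → E => emp g s) 2 (Measure.pi Q) := hsum.const_mul _
  have hmean : ∫ s, emp g s ∂(Measure.pi Q) = (N : ℝ)⁻¹ * ∑ i, ∫ z, g z ∂(Q i) := by
    unfold emp
    rw [integral_const_mul, integral_finsetSum _ fun i _ => integrable_of_ae_abs_le (hmi i) (hae i)]
    congr 1
    refine Finset.sum_congr rfl fun i _ => ?_
    exact integral_comp_eval (μ := Q) (i := i) hg.aestronglyMeasurable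
  have hvar : Var[fun s : Fin N → E => emp g s; Measure.pi Q] ≤ G ^ 2 / N := by
    have e1 : (fun s : Fin N → E => emp g s) =
        fun s => (N : ℝ)⁻¹ * (∑ i, fun s : Fin N → E => g (s i)) s := by
      funext s
      simp [emp]
    rw [e1, variance_const_mul, variance_sum_pi (X := fun _ => g) hmL]
    have h2 : ∀ i, Var[g; Q i] ≤ G ^ 2 := fun i => by
      refine (variance_le_expectation_sq hg.aestronglyMeasurable).trans ?_
      calc _ ≤ ∫ _, G ^ 2 ∂(Q i) := by
            refine integral_mono_of_nonneg (ae_of_all _ fun z => sq_nonneg _) (integrable_const _) ?_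
            filter_upwards [hG i] with z hz
            exact sq_le_sq' (abs_le.1 hz).1 (abs_le.1 hz).2
        _ = G ^ 2 := by simp
    calc _ ≤ (N : ℝ)⁻¹ ^ 2 * ∑ _ : Fin N, G ^ 2 := by
          gcongr with i
          exact h2 i
      _ = _ := by
          simp
          field_simp
  -- Bias-variance decomposition; independence makes the variance part at most `G ^ 2 / N`.
  have hdec : ∫ s, (emp g s - a) ^ 2 ∂(Measure.pi Q) =
      Var[fun s : Fin N → E => emp g s; Measure.pi Q] +
        (∫ s, emp g s ∂(Measure.pi Q) - a) ^ 2 := by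
    rw [variance_eq_sub hemp]
    have : ∀ s : Fin N → E, (emp g s - a) ^ 2 = emp g s ^ 2 - 2 * a * emp g s + a ^ 2 :=
      fun s => by ring
    simp_rw [this]
    have i1 := hemp.integrable_sq
    have i2 := hemp.integrable one_le_two
    have i12 : Integrable (fun s => emp g s ^ 2 - 2 * a * emp g s) (Measure.pi Q) :=
      i1.sub (i2.const_mul _)
    simp only [Pi.pow_apply]
    rw [integral_add i12 (integrable_const _), integral_sub i1 (i2.const_mul _), integral_const_mul]
    simp only [integral_const, probReal_univ, one_smul]
    ring
  rw [hdec, hmean]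
  gcongr

end Rates

/-! ### Conditional means of weighted monomials over one step. -/

section LawOfLargeNumbers

variable {X : ℕ → Type u} [∀ n, MeasurableSpace (X n)] {M : PathModel X} {P : Proposal M}
  {h : AdditiveTerms X} {ρ ε : ℕ → Bool} {εl εu δ γ H : ℝ≥0} {N n : ℕ}

/-- The test function `ω f(ξ, ω) τ ^ k`. -/
noncomputable def weightedMonomial {E : Type*} (k : ℕ) (f : E → ℝ≥0 → ℝ) (z : E × ℝ × ℝ≥0) : ℝ :=
  z.2.2 * f z.1 z.2.2 * z.2.1 ^ k

lemma measurable_weightedMonomial {E : Type*} [MeasurableSpace E] (k : ℕ) {f : E → ℝ≥0 → ℝ}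
    (hf : Measurable (Function.uncurry f)) : Measurable (weightedMonomial k f) := by
  unfold weightedMonomial
  have h1 : Measurable fun z : E × ℝ × ℝ≥0 => f z.1 z.2.2 :=
    hf.comp (g := Function.uncurry f) (f := fun z : E × ℝ × ℝ≥0 => (z.1, z.2.2)) (by fun_prop)
  have h2 : Measurable fun z : E × ℝ × ℝ≥0 => (z.2.2 : ℝ) :=
    (measurable_snd.comp measurable_snd).coe_nnreal_real
  exact (h2.mul h1).mul (by fun_prop)

lemma abs_weightedMonomial_le {E : Type*} {k : ℕ} {f : E → ℝ≥0 → ℝ} {B W T : ℝ} (hW : 0 ≤ W)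
    (hB : ∀ x w, |f x w| ≤ B) {z : E × ℝ × ℝ≥0} (hz : (z.2.2 : ℝ) ≤ W ∧ |z.2.1| ≤ T) :
    |weightedMonomial k f z| ≤ W * B * T ^ k := by
  unfold weightedMonomial
  rw [abs_mul, abs_mul, abs_pow, NNReal.abs_eq]
  have := (abs_nonneg _).trans (hB z.1 z.2.2)
  gcongr
  · exact hz.1
  · exact hB _ _
  · exact hz.2

/-- The conditional mean of `emp g` given the previous sample. -/
noncomputable def stepMean (P : Proposal M) (h : AdditiveTerms X) (ρ ε : Bool) (n : ℕ)
    (g : X (n + 1) × ℝ × ℝ≥0 → ℝ) {N : ℕ} (s : Sample X N n) : ℝ :=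
  (N : ℝ)⁻¹ * ∑ i, ∫ z, g z ∂(particleLaw P h ρ ε n s i)

lemma measurable_stepMean (P : Proposal M) (h : AdditiveTerms X) (ρ ε : Bool)
    {g : X (n + 1) × ℝ × ℝ≥0 → ℝ} (hg : Measurable g) :
    Measurable fun s : Sample X N n => stepMean P h ρ ε n g s :=
  (Finset.measurable_fun_sum _ fun i _ =>
    measurable_integral_particleLaw P h ρ ε i hg).const_mul _

/-- The bound of a function of a particle on the almost sure range of the particles. -/
def BoundedOnGood (ρ : ℕ → Bool) (δ H : ℝ≥0) (n : ℕ) (g : X n × ℝ × ℝ≥0 → ℝ) (G : ℝ) : Prop :=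
  ∀ z : X n × ℝ × ℝ≥0, (z.2.2 : ℝ) ≤ weightBound ρ δ n ∧ |z.2.1| ≤ (n + 2 : ℝ) * H → |g z| ≤ G

lemma boundedOnGood_weightedMonomial {k : ℕ} {f : X n → ℝ≥0 → ℝ} {B : ℝ}
    (hB : ∀ x w, |f x w| ≤ B) : BoundedOnGood ρ δ H n (weightedMonomial k f)
      (weightBound ρ δ n * B * ((n + 2 : ℝ) * H) ^ k) :=
  fun _ hz => abs_weightedMonomial_le (weightBound_nonneg n) hB hz

/-- Also true when all weights vanish, since both sides are then zero. The convention for degenerate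
categorical draws therefore drops out of every cleared identity. -/
lemma catProb_mul_sum (a : Fin N → ℝ≥0) (i : Fin N) :
    (catProb a i : ℝ) * ∑ j, (a j : ℝ) = a i := by
  have : catProb a i * ∑ j, a j = a i := by
    unfold catProb
    split_ifs with h0
    · rw [h0, mul_zero]
      exact (Finset.sum_eq_zero_iff.1 h0 i (Finset.mem_univ i)).symm
    · rw [div_mul_cancel₀ _ h0]
  exact_mod_cast this

lemma sum_catProb_le_one (a : Fin N → ℝ≥0) : ∑ i, (catProb a i : ℝ) ≤ 1 := by
  rcases Nat.eq_zero_or_pos N with rfl | hN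
  · simp
  · have := sum_catProb a ⟨0, hN⟩
    rw [← ENNReal.ofNNReal_finsetSum] at this
    have h1 : ∑ i, catProb a i = 1 := by exact_mod_cast this
    exact_mod_cast h1.le

/-- The function `ω ellₙ(ξ, y) φ(ξ, y) (τ + h̃ₙ(ξ, y)) ^ k`. -/
noncomputable def movedMonomial (M : PathModel X) (h : AdditiveTerms X) (n : ℕ)
    (φ : X n → X (n + 1) → ℝ) (k : ℕ) (y : X (n + 1)) (z : X n × ℝ × ℝ≥0) : ℝ :=
  z.2.2 * M.ell n z.1 y * φ z.1 y * (z.2.1 + h.incr n z.1 y) ^ k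

lemma emp_movedMonomial (φ : X n → X (n + 1) → ℝ) (k : ℕ) (y : X (n + 1)) (s : Sample X N n) :
    emp (movedMonomial M h n φ k y) s = ∑ j ∈ Finset.range (k + 1), emp (weightedMonomial j
      fun x _ => M.ell n x y * φ x y * h.incr n x y ^ (k - j)) s * (k.choose j) := by
  simp only [← emp_mul_const]
  rw [← emp_sum]
  congr 1
  funext z
  unfold movedMonomial weightedMonomial
  rw [add_pow, Finset.mul_sum]
  refine Finset.sum_congr rfl fun j _ => ?_
  ring

lemma measurable_emp_movedMonomial {φ : X n → X (n + 1) → ℝ}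
    (hφ : Measurable (Function.uncurry φ)) (k : ℕ) :
    Measurable fun q : Sample X N n × X (n + 1) => emp (movedMonomial M h n φ k q.2) q.1 := by
  unfold emp movedMonomial
  refine (Finset.measurable_fun_sum _ fun i _ => ?_).const_mul _
  have h1 : Measurable fun q : Sample X N n × X (n + 1) => φ (q.1 i).1 q.2 :=
    hφ.comp (f := fun q : Sample X N n × X (n + 1) => ((q.1 i).1, q.2)) (by fun_prop)
  have h2 : Measurable fun q : Sample X N n × X (n + 1) => ((q.1 i).2.2 : ℝ) :=
    (by fun_prop : Measurable fun q : Sample X N n × X (n + 1) => (q.1 i).2.2).coe_nnreal_real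
  exact ((h2.mul (measurable_ell_sample i).coe_nnreal_real).mul h1).mul
    ((measurable_movedStat h i).pow_const k)

/-- The mean of the `k`-th powers of the moved statistics under the backward probabilities. -/
noncomputable def backAvg (M : PathModel X) (h : AdditiveTerms X) (n k : ℕ) (y : X (n + 1))
    {N : ℕ} (s : Sample X N n) : ℝ :=
  ∑ J, (catProb (fun j => (s j).2.2 * M.ell n (s j).1 y) J : ℝ) * movedStat h n s J y ^ k

lemma measurable_backAvg (k : ℕ) :
    Measurable fun q : Sample X N n × X (n + 1) => backAvg M h n k q.2 q.1 := by
  refine Finset.measurable_fun_sum _ fun J _ => Measurable.mul ?_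
    ((measurable_movedStat h J).pow_const k)
  refine (measurable_catProb (fun j => ?_) J).coe_nnreal_real
  exact Measurable.mul (by fun_prop) (measurable_ell_sample j)

lemma backAvg_mul (k : ℕ) (y : X (n + 1)) (s : Sample X N n) :
    backAvg M h n k y s * emp (movedMonomial M h n (fun _ _ => 1) 0 y) s =
      emp (movedMonomial M h n (fun _ _ => 1) k y) s := by
  have e : emp (movedMonomial M h n (fun _ _ => 1) 0 y) s =
      (N : ℝ)⁻¹ * ∑ j, (((s j).2.2 * M.ell n (s j).1 y : ℝ≥0) : ℝ) := by
    simp [emp, movedMonomial]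
  rw [e, backAvg, mul_left_comm, Finset.sum_mul, emp]
  congr 1
  refine Finset.sum_congr rfl fun J _ => ?_
  rw [mul_right_comm, catProb_mul_sum]
  simp [movedMonomial, movedStat]

/-- The integrand of the conditional mean of a step with selection. -/
noncomputable def selectionMix (M : PathModel X) (h : AdditiveTerms X) (e : Bool) (n : ℕ)
    (φ : X n → X (n + 1) → ℝ) (k : ℕ) (y : X (n + 1)) {N : ℕ} (s : Sample X N n) : ℝ :=
  if e then ∑ i ∈ Finset.range (k + 1), emp (movedMonomial M h n φ i y) s *
    backAvg M h n (k - i) y s * (k.choose i) * 2⁻¹ ^ k else emp (movedMonomial M h n φ k y) s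

lemma measurable_selectionMix {φ : X n → X (n + 1) → ℝ}
    (hφ : Measurable (Function.uncurry φ)) (e : Bool) (k : ℕ) :
    Measurable fun q : Sample X N n × X (n + 1) => selectionMix M h e n φ k q.2 q.1 := by
  unfold selectionMix
  split_ifs
  · exact Finset.measurable_fun_sum _ fun i _ => (((measurable_emp_movedMonomial hφ i).mul
      (measurable_backAvg (k - i))).mul_const _).mul_const _
  · exact measurable_emp_movedMonomial hφ k

/-- The selection mix as a double sum over ancestors. -/
lemma selectionMix_eq (e : Bool) (φ : X n → X (n + 1) → ℝ) (k : ℕ) (y : X (n + 1))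
    (s : Sample X N n) :
    selectionMix M h e n φ k y s = (N : ℝ)⁻¹ * ∑ I, ((s I).2.2 : ℝ) * M.ell n (s I).1 y *
      φ (s I).1 y * ∑ J, backProb M e n s y I J * avgStat h n s I J y ^ k := by
  unfold selectionMix backProb avgStat
  cases e
  · simp only [Bool.false_eq_true, if_false, emp]
    congr 1
    refine Finset.sum_congr rfl fun I _ => ?_
    have : ∀ a : ℝ, 2⁻¹ * (a + a) = a := fun a => by ring
    simp [movedMonomial, movedStat, this, apply_ite NNReal.toReal]
  · simp only [if_true, emp]
    simp_rw [mul_assoc, ← Finset.mul_sum]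
    congr 1
    simp_rw [Finset.sum_mul]
    rw [Finset.sum_comm]
    refine Finset.sum_congr rfl fun I _ => ?_
    simp only [backAvg, movedMonomial, mul_pow, add_pow (movedStat h n s I y), Finset.mul_sum,
      Finset.sum_mul]
    rw [Finset.sum_comm]
    refine Finset.sum_congr rfl fun J _ => Finset.sum_congr rfl fun i _ => ?_
    simp only [movedStat]
    ring

namespace Regular

/-- Importance weighting turns the proposal into the model dynamics. No null set occurs: `ell` is
positive and dominated, hence `p` is positive everywhere. -/
lemma p_mul_weightFn (A : Regular P h ρ ε εl εu δ γ H) (r : Bool) (x : X n) (y : X (n + 1)) :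
    (P.ϑ n x : ℝ) ^ r.toNat * (P.p n x y * P.weightFn r n x y) = M.ell n x y := by
  have h1 := (A.p_pos n x y).ne'
  have h2 := (P.ϑ_pos n x).ne'
  have : P.ϑ n x ^ r.toNat * (P.p n x y * P.weightFn r n x y) = M.ell n x y := by
    unfold Proposal.weightFn
    field_simp
  exact_mod_cast this

lemma abs_backAvg_le (A : Regular P h ρ ε εl εu δ γ H) {s : Sample X N n}
    (hs : GoodSample ρ δ H s) (k : ℕ) (y : X (n + 1)) :
    |backAvg M h n k y s| ≤ (((n + 1 : ℕ) + 2 : ℝ) * H) ^ k := by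
  unfold backAvg
  calc _ ≤ ∑ J, (catProb (fun j => (s j).2.2 * M.ell n (s j).1 y) J : ℝ) *
        (((n + 1 : ℕ) + 2 : ℝ) * H) ^ k := by
        refine (Finset.abs_sum_le_sum_abs _ _).trans (Finset.sum_le_sum fun J _ => ?_)
        rw [abs_mul, NNReal.abs_eq, abs_pow]
        gcongr
        exact A.abs_movedStat_le hs J y
    _ ≤ 1 * (((n + 1 : ℕ) + 2 : ℝ) * H) ^ k := by
        rw [← Finset.sum_mul]
        gcongr
        exact sum_catProb_le_one _
    _ = _ := one_mul _

lemma integral_particleLaw_of_good (A : Regular P h ρ ε εl εu δ γ H) {s : Sample X N n}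
    (hs : GoodSample ρ δ H s) (i : Fin N) {g : X (n + 1) × ℝ × ℝ≥0 → ℝ} (hg : Measurable g)
    {G : ℝ} (hG : BoundedOnGood ρ δ H (n + 1) g G) :
    ∫ z, g z ∂(particleLaw P h (ρ n) (ε n) n s i) = ∑ I, selProb P (ρ n) n s i I *
      ∫ y, P.p n (s I).1 y * ∑ J, backProb M (ε n) n s y I J *
        g (offspring P h (ρ n) n s i I J y) ∂(M.μ (n + 1)) :=
  integral_particleLaw P h _ _ s i hg fun I J y => hG _ (by
    have := A.good_offspring hs i I J y
    exact_mod_cast this)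

/-- Rates of convergence of conditional means carry over to the next sample. -/
lemma rateFam_of_stepMean (A : Regular P h ρ ε εl εu δ γ H) {ι : Type*}
    {g : ι → X (n + 1) × ℝ × ℝ≥0 → ℝ} (hg : ∀ i, Measurable (g i)) {G : ℝ}
    (hG : ∀ i, BoundedOnGood ρ δ H (n + 1) (g i) G) {a : ι → ℝ}
    (hr : RateFam (fun N => law P h ρ ε N n)
      (fun i _ s => stepMean P h (ρ n) (ε n) n (g i) s) a) :
    RateFam (fun N => law P h ρ ε N (n + 1)) (fun i _ s => emp (g i) s) a := by
  obtain ⟨K, C, hr⟩ := hr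
  have hG0 : ∀ i : ι, 0 ≤ G := fun i => by
    obtain ⟨y⟩ := A.nonempty_succ n
    exact (abs_nonneg _).trans (hG i (y, 0, 0) ⟨by simpa using weightBound_nonneg (n + 1),
      by simp; positivity⟩)
  have hbd : ∀ i N, ∀ᵐ s ∂(law P h ρ ε N (n + 1)), |emp (g i) s| ≤ max K G := fun i N => by
    filter_upwards [A.ae_law N (n + 1)] with s hs
    exact (abs_emp_le (hG0 i) fun j => hG i _ (hs j)).trans (le_max_right _ _)
  refine ⟨max K G, G ^ 2 + C, fun i => ⟨fun N => measurable_emp (hg i), hbd i,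
    (hr i).lim_le.trans (le_max_left _ _), fun N hN => ?_⟩⟩
  have hint : Integrable (fun s => (emp (g i) s - a i) ^ 2) (law P h ρ ε N (n + 1)) := by
    refine integrable_of_ae_abs_le (((measurable_emp (hg i)).sub_const _).pow_const 2)
      (C := (max K G + |a i|) ^ 2) ?_
    filter_upwards [hbd i N] with s hs
    rw [abs_pow]
    exact pow_le_pow_left₀ (abs_nonneg _) ((abs_sub _ _).trans (by linarith)) 2
  rw [integral_law_succ P h ρ ε N n hint]
  have i1 := (hr i).integrable_sq N (a i)
  -- Given the past sample, the new particles are independent: their fluctuation costs `G ^ 2 / N`,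
  -- the rest is the error of the conditional mean.
  calc _ ≤ ∫ s, (G ^ 2 / N + (stepMean P h (ρ n) (ε n) n (g i) s - a i) ^ 2)
        ∂(law P h ρ ε N n) := by
        refine integral_mono_of_nonneg (ae_of_all _ fun s => integral_nonneg fun s' => sq_nonneg _)
          ((integrable_const _).add i1) ?_
        filter_upwards [A.ae_law N n] with s hs
        refine integral_emp_sub_sq_le hN _ (hg i) (fun j => ?_) (a i)
        filter_upwards [A.ae_particleLaw hs j] with z hz
        exact hG i z (by exact_mod_cast hz)
    _ = G ^ 2 / N + ∫ s, (stepMean P h (ρ n) (ε n) n (g i) s - a i) ^ 2 ∂(law P h ρ ε N n) := by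
        rw [integral_add (integrable_const _) i1]
        simp
    _ ≤ G ^ 2 / N + C / N := by
        gcongr
        exact (hr i).rate N hN
    _ = _ := by ring

lemma abs_stepMean_le (A : Regular P h ρ ε εl εu δ γ H) {s : Sample X N n}
    (hs : GoodSample ρ δ H s) {g : X (n + 1) × ℝ × ℝ≥0 → ℝ} {G : ℝ}
    (hG : BoundedOnGood ρ δ H (n + 1) g G) (hG0 : 0 ≤ G) :
    |stepMean P h (ρ n) (ε n) n g s| ≤ G := by
  refine abs_emp_le (g := fun i => ∫ z, g z ∂(particleLaw P h (ρ n) (ε n) n s i)) (s := fun i => i)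
    hG0 fun i => ?_
  have := norm_integral_le_of_norm_le_const (μ := particleLaw P h (ρ n) (ε n) n s i) (f := g)
    (C := G) (by
      filter_upwards [A.ae_particleLaw hs i] with z hz
      exact hG z (by exact_mod_cast hz))
  simpa using this

/-- The conditional mean of a step with selection. -/
lemma stepMean_mul (A : Regular P h ρ ε εl εu δ γ H) (hρ : ρ n = true) {s : Sample X N n}
    (hs : GoodSample ρ δ H s) (k : ℕ) {f : X (n + 1) → ℝ≥0 → ℝ}
    (hf : Measurable (Function.uncurry f)) {B : ℝ} (hB : ∀ x w, |f x w| ≤ B) :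
    stepMean P h (ρ n) (ε n) n (weightedMonomial k f) s *
        emp (weightedMonomial 0 fun x _ => (P.ϑ n x : ℝ)) s =
      ∫ y, selectionMix M h (ε n) n (fun x y => f y (P.weightFn true n x y)) k y s
        ∂(M.μ (n + 1)) := by
  have := A.prob n
  rcases Nat.eq_zero_or_pos N with rfl | hN
  · simp [stepMean, selectionMix_eq]
  have hN' : (N : ℝ) ≠ 0 := by positivity
  have hg := measurable_weightedMonomial k hf
  have hG := boundedOnGood_weightedMonomial (X := X) (n := n + 1) (ρ := ρ) (δ := δ) (H := H)
    (k := k) hB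
  set T : Fin N → X (n + 1) → ℝ := fun I y => ((s I).2.2 : ℝ) * M.ell n (s I).1 y *
      f y (P.weightFn true n (s I).1 y) *
        ∑ J, backProb M (ε n) n s y I J * avgStat h n s I J y ^ k with hT
  have hϑ : emp (weightedMonomial 0 fun x _ => (P.ϑ n x : ℝ)) s =
      (N : ℝ)⁻¹ * ∑ l, (((s l).2.2 * P.ϑ n (s l).1 : ℝ≥0) : ℝ) := by
    simp [emp, weightedMonomial]
  -- Multiplying by the total selection weight clears the categorical normalizer. The multiplier `ϑ`
  -- and the proposal `p` then cancel against the new weight, and only `ω ell` remains.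
  have e1 : ∀ i, (∫ z, weightedMonomial k f z ∂(particleLaw P h (ρ n) (ε n) n s i)) *
      ∑ l, (((s l).2.2 * P.ϑ n (s l).1 : ℝ≥0) : ℝ) = ∑ I, ∫ y, T I y ∂(M.μ (n + 1)) := fun i => by
    rw [A.integral_particleLaw_of_good hs i hg hG, Finset.sum_mul]
    refine Finset.sum_congr rfl fun I _ => ?_
    have : (selProb P (ρ n) n s i I : ℝ) * ∑ l, (((s l).2.2 * P.ϑ n (s l).1 : ℝ≥0) : ℝ) =
        (s I).2.2 * P.ϑ n (s I).1 := by
      rw [selProb, hρ, if_pos rfl, catProb_mul_sum]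
      simp
    rw [mul_right_comm, this, ← integral_const_mul]
    refine integral_congr_ae (ae_of_all _ fun y => ?_)
    have hw := A.p_mul_weightFn true (s I).1 y
    simp only [Bool.toNat_true, pow_one] at hw
    simp only [hT, offspring, newWeight, hρ, weightedMonomial, Bool.toNat_true, Nat.sub_self,
      pow_zero, mul_one, ← hw, Finset.mul_sum]
    refine Finset.sum_congr rfl fun J _ => ?_
    ring
  have hTi : ∀ I, Integrable (T I) (M.μ (n + 1)) := fun I => by
    have hell := (A.bm_ell n).curry_left (s I).1
    have hw : Measurable fun y => P.weightFn true n (s I).1 y :=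
      (measurable_weightFn P true n).comp measurable_prodMk_left
    have hfm : BM fun y => f y (P.weightFn true n (s I).1 y) :=
      ⟨hf.comp (measurable_id.prodMk hw), B, fun y => hB _ _⟩
    have hbk : ∀ J, BM fun y => (backProb M (ε n) n s y I J : ℝ) := fun J => by
      refine ⟨(measurable_backProb_right M (ε n) s I J).coe_nnreal_real, 1, fun y => ?_⟩
      rw [NNReal.abs_eq]
      unfold backProb
      split_ifs
      · exact (Finset.single_le_sum (f := fun J => (catProb _ J : ℝ))
          (fun _ _ => NNReal.coe_nonneg _) (Finset.mem_univ J)).trans (sum_catProb_le_one _)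
      · simp
      · simp
    have hst : ∀ J, BM fun y => avgStat h n s I J y := fun J => by
      have hm : ∀ I, BM fun y => movedStat h n s I y := fun I =>
        (BM.const _).add ((A.bm_incr n).curry_left _)
      exact (BM.const _).mul ((hm I).add (hm J))
    exact ((((BM.const _).mul hell).mul hfm).mul (BM.sum _ fun J _ =>
      (hbk J).mul ((hst J).pow k))).integrable _
  rw [hϑ, stepMean]
  calc _ = (N : ℝ)⁻¹ * ((N : ℝ)⁻¹ * ∑ i, (∫ z, weightedMonomial k f z
        ∂(particleLaw P h (ρ n) (ε n) n s i)) * ∑ l, (((s l).2.2 * P.ϑ n (s l).1 : ℝ≥0) : ℝ)) := by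
        rw [← Finset.sum_mul]
        ring
    _ = (N : ℝ)⁻¹ * ∑ I, ∫ y, T I y ∂(M.μ (n + 1)) := by
        simp only [e1, Finset.sum_const, Finset.card_univ, Fintype.card_fin, nsmul_eq_mul]
        field_simp
    _ = _ := by
        rw [← integral_finsetSum _ fun I _ => hTi I, ← integral_const_mul]
        refine integral_congr_ae (ae_of_all _ fun y => ?_)
        simp only [selectionMix_eq, hT]

/-- The conditional mean of a step without selection. -/
lemma stepMean_eq_sum (A : Regular P h ρ ε εl εu δ γ H) (hρ : ρ n = false) {s : Sample X N n}
    (hs : GoodSample ρ δ H s) (k : ℕ) {f : X (n + 1) → ℝ≥0 → ℝ}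
    (hf : Measurable (Function.uncurry f)) {B : ℝ} (hB : ∀ x w, |f x w| ≤ B) :
    stepMean P h (ρ n) (ε n) n (weightedMonomial k f) s =
      ∑ j ∈ Finset.range (k + 1), emp (weightedMonomial j fun x w => fwdInt M n
        (fun x y => f y (P.weightFn false n x y * w) * h.incr n x y ^ (k - j)) x) s *
          (k.choose j) := by
  have := A.prob n
  have hε := A.backward n hρ
  have hg := measurable_weightedMonomial k hf
  have hG := boundedOnGood_weightedMonomial (X := X) (n := n + 1) (ρ := ρ) (δ := δ) (H := H)
    (k := k) hB
  simp only [← emp_mul_const]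
  rw [← emp_sum, stepMean, emp]
  congr 1
  refine Finset.sum_congr rfl fun i _ => ?_
  rw [A.integral_particleLaw_of_good hs i hg hG]
  -- Without selection there is no backward draw either, so `I = J = i` and the double sum
  -- collapses.
  simp only [selProb, backProb, hρ, hε, Bool.false_eq_true, if_false]
  simp only [apply_ite NNReal.toReal, NNReal.coe_one, NNReal.coe_zero, ite_mul, one_mul, zero_mul,
    Finset.sum_ite_eq', Finset.mem_univ, if_true]
  simp only [weightedMonomial, fwdInt]
  have hi : ∀ j, Integrable (fun y => M.ell n (s i).1 y * (f y (P.weightFn false n (s i).1 y *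
      (s i).2.2) * h.incr n (s i).1 y ^ (k - j))) (M.μ (n + 1)) := fun j => by
    have hell := (A.bm_ell n).curry_left (s i).1
    have hw : Measurable fun y => P.weightFn false n (s i).1 y :=
      (measurable_weightFn P false n).comp measurable_prodMk_left
    have hfm : BM fun y => f y (P.weightFn false n (s i).1 y * (s i).2.2) :=
      ⟨hf.comp (measurable_id.prodMk (hw.mul_const _)), B, fun y => hB _ _⟩
    exact (hell.mul (hfm.mul (((A.bm_incr n).curry_left _).pow _))).integrable _
  have e2 : ∀ j, ((s i).2.2 : ℝ) * (∫ y, M.ell n (s i).1 y * (f y (P.weightFn false n (s i).1 y *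
      (s i).2.2) * h.incr n (s i).1 y ^ (k - j)) ∂(M.μ (n + 1))) * (s i).2.1 ^ j * (k.choose j) =
      ∫ y, ((s i).2.2 * (s i).2.1 ^ j * (k.choose j)) * (M.ell n (s i).1 y *
      (f y (P.weightFn false n (s i).1 y *
      (s i).2.2) * h.incr n (s i).1 y ^ (k - j))) ∂(M.μ (n + 1)) := fun j => by
    rw [integral_const_mul]; ring
  simp only [e2]
  rw [← integral_finsetSum _ fun j _ => (hi j).const_mul _]
  refine integral_congr_ae (ae_of_all _ fun y => ?_)
  have hw := A.p_mul_weightFn false (s i).1 y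
  simp only [Bool.toNat_false, pow_zero, one_mul] at hw
  have ha : avgStat h n s i i y = (s i).2.1 + h.incr n (s i).1 y := by
    simp only [avgStat, movedStat]; ring
  simp only [offspring, newWeight, Bool.toNat_false, Nat.sub_zero, pow_one, ha, ← hw, add_pow,
    Finset.mul_sum, NNReal.coe_mul]
  refine Finset.sum_congr rfl fun j _ => ?_
  ring

end Regular

end LawOfLargeNumbers

/-! ### Propagation of the law of large numbers in time. -/

section RatesOfConvergence

variable {X : ℕ → Type u} [∀ n, MeasurableSpace (X n)] {M : PathModel X} {P : Proposal M}
  {h : AdditiveTerms X} {ρ ε : ℕ → Bool} {εl εu δ γ H : ℝ≥0} {N n : ℕ}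

/-- Weighted monomials in the statistic, with coefficients depending on the position, converge to
their limits at a uniform rate. -/
def PositionRates (P : Proposal M) (h : AdditiveTerms X) (ρ ε : ℕ → Bool) (n : ℕ) : Prop :=
  -- All index types of the universe of the state spaces are allowed, so that in the induction a
  -- family over `ι` can be replaced by one over `ι × X (n + 1)`.
  ∀ (ι : Type u) (k : ℕ) (B : ℝ) (f : ι → X n → ℝ), (∀ i, Measurable (f i)) →
    (∀ i x, |f i x| ≤ B) →
    RateFam (fun N => law P h ρ ε N n) (fun i _ s => emp (weightedMonomial k fun x _ => f i x) s)
      fun i => normConst P ρ n * ∫ x, f i x * mom M h ε n k x ∂(fwd M n)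

/-- Weighted monomials in the statistic, with coefficients depending on the position and on the
weight, converge. -/
def WeightRates (P : Proposal M) (h : AdditiveTerms X) (ρ ε : ℕ → Bool) (n : ℕ) : Prop :=
  ∀ (k : ℕ) (f : X n → ℝ≥0 → ℝ), Measurable (Function.uncurry f) → (∃ B, ∀ x w, |f x w| ≤ B) →
    -- The limit is left unspecified: it serves for squared weights, where existence and an upper
    -- bound suffice.
    ∃ a K C, Rate (fun N => law P h ρ ε N n) (fun _ s => emp (weightedMonomial k f) s) a K C

/-- The limit of `selectionMix`. -/
noncomputable def selectionMixLimit (M : PathModel X) (h : AdditiveTerms X) (ε : ℕ → Bool) (n : ℕ)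
    (φ : X n → X (n + 1) → ℝ) (k : ℕ) (y : X (n + 1)) : ℝ :=
  if ε n then ∑ i ∈ Finset.range (k + 1),
    backInt M n (fun x y => φ x y * shiftMoments h n (mom M h ε n) i x y) y *
    (backInt M n (shiftMoments h n (mom M h ε n) (k - i)) y / backMass M n y) *
    (k.choose i) * 2⁻¹ ^ k
  else backInt M n (fun x y => φ x y * shiftMoments h n (mom M h ε n) k x y) y

namespace Regular

lemma measurable_selectionMixLimit (A : Regular P h ρ ε εl εu δ γ H) (n : ℕ)
    {φ : X n → X (n + 1) → ℝ} (hφ : BM (Function.uncurry φ)) (k : ℕ) :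
    Measurable (selectionMixLimit M h ε n φ k) := by
  have h1 : ∀ i, Measurable
      (backInt M n fun x y => φ x y * shiftMoments h n (mom M h ε n) i x y) := fun i =>
    (A.bm_backInt n (u := fun x y => φ x y * shiftMoments h n (mom M h ε n) i x y)
      (hφ.mul (A.bm_shiftMoments n (A.bm_mom n) i))).1
  have h2 : ∀ i, Measurable (backInt M n (shiftMoments h n (mom M h ε n) i)) := fun i =>
    (A.bm_backInt n (A.bm_shiftMoments n (A.bm_mom n) i)).1
  unfold selectionMixLimit
  split_ifs
  · exact Finset.measurable_fun_sum _ fun i _ =>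
      (((h1 i).mul ((h2 (k - i)).div (A.bm_backMass n).1)).mul_const _).mul_const _
  · exact h1 k

/-- For fixed `y` the binomial theorem reduces to weighted monomials at time `n`; letting `y` be
part of the index makes the rate uniform in `y`. -/
lemma rateFam_movedMonomial (A : Regular P h ρ ε εl εu δ γ H)
    (hr : PositionRates P h ρ ε n) {ι : Type u} {φ : ι → X n → X (n + 1) → ℝ}
    (hφ : ∀ i, Measurable (Function.uncurry (φ i))) {B : ℝ} (hB : ∀ i x y, |φ i x y| ≤ B)
    (k : ℕ) :
    RateFam (fun N => law P h ρ ε N n)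
      (fun (q : ι × X (n + 1)) _ s => emp (movedMonomial M h n (φ q.1) k q.2) s)
      fun q => normConst P ρ n *
        backInt M n (fun x y => φ q.1 x y * shiftMoments h n (mom M h ε n) k x y) q.2 := by
  have := A.isFiniteMeasure_fwd n
  have hbm : ∀ (q : ι × X (n + 1)) j,
      BM fun x => M.ell n x q.2 * φ q.1 x q.2 * h.incr n x q.2 ^ (k - j) := fun q j =>
    (((A.bm_ell n).curry_right q.2).mul (BM.curry_right (f := φ q.1)
      ⟨hφ q.1, B, fun r => hB q.1 r.1 r.2⟩ q.2)).mul (((A.bm_incr n).curry_right q.2).pow _)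
  have h1 : ∀ j ∈ Finset.range (k + 1), RateFam (fun N => law P h ρ ε N n)
      (fun (q : ι × X (n + 1)) _ s => emp (weightedMonomial j fun x _ =>
        M.ell n x q.2 * φ q.1 x q.2 * h.incr n x q.2 ^ (k - j)) s * (k.choose j))
      fun q => normConst P ρ n * (∫ x, M.ell n x q.2 * φ q.1 x q.2 * h.incr n x q.2 ^ (k - j) *
        mom M h ε n j x ∂(fwd M n)) * (k.choose j) := fun j _ => by
    refine (hr (ι × X (n + 1)) j (εu * B * H ^ (k - j)) _ (fun q => (hbm q j).1)
      fun q x => ?_).mul_const _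
    rw [abs_mul, abs_mul, abs_pow, NNReal.abs_eq]
    have hB0 := (abs_nonneg _).trans (hB q.1 x q.2)
    gcongr
    · exact A.le_hi n x q.2
    · exact hB _ _ _
    · exact A.incr_le n x q.2
  have h2 := RateFam.sum (Finset.range (k + 1)) h1
  simp only [emp_movedMonomial]
  convert h2 using 2 with q
  simp only [mul_assoc (normConst P ρ n), ← Finset.mul_sum, ← integral_mul_const]
  rw [← integral_finsetSum _ fun j _ =>
    ((((hbm q j).mul (A.bm_mom n j)).mul (BM.const _)).integrable _)]
  congr 1
  refine integral_congr_ae (ae_of_all _ fun x => ?_)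
  simp only [shiftMoments, Finset.mul_sum]
  refine Finset.sum_congr rfl fun j _ => ?_
  ring

lemma rateFam_movedMonomial_one (A : Regular P h ρ ε εl εu δ γ H) (hr : PositionRates P h ρ ε n)
    (j : ℕ) :
    RateFam (fun N => law P h ρ ε N n)
      (fun (y : X (n + 1)) _ s => emp (movedMonomial M h n (fun _ _ => 1) j y) s)
      fun y => normConst P ρ n * backInt M n (shiftMoments h n (mom M h ε n) j) y := by
  have := (A.rateFam_movedMonomial hr (ι := PUnit.{u + 1}) (φ := fun _ _ _ => 1)
    (fun _ => measurable_const) (B := 1) (fun _ _ _ => by simp) j).reindex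
    fun y : X (n + 1) => (PUnit.unit, y)
  simpa only [one_mul] using this

/-- The backward average is a self-normalized ratio of moved monomials; mixing bounds its limiting
denominator below uniformly in `y`. -/
lemma rateFam_backAvg (A : Regular P h ρ ε εl εu δ γ H) (hr : PositionRates P h ρ ε n) (k : ℕ) :
    RateFam (fun N => law P h ρ ε N n) (fun (y : X (n + 1)) _ s => backAvg M h n k y s)
      fun y => backInt M n (shiftMoments h n (mom M h ε n) k) y / backMass M n y := by
  have hκ := A.normConst_pos n
  have h0 := A.rateFam_movedMonomial_one hr 0
  have e0 : (fun y => normConst P ρ n * backInt M n (shiftMoments h n (mom M h ε n) 0) y) =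
      fun y => normConst P ρ n * backMass M n y := by
    simp only [A.shiftMoments_zero, backInt_one]
  rw [e0] at h0
  have hmeas : ∀ (y : X (n + 1)) N, Measurable fun s : Sample X N n => backAvg M h n k y s :=
    fun y N => Measurable.comp (g := fun q : Sample X N n × X (n + 1) => backAvg M h n k q.2 q.1)
      (f := fun s => (s, y)) (measurable_backAvg k) measurable_prodMk_right
  have hbdd : ∀ (y : X (n + 1)) N, ∀ᵐ s ∂(law P h ρ ε N n), |backAvg M h n k y s| ≤
      (((n + 1 : ℕ) + 2 : ℝ) * H) ^ k := fun y N => by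
    filter_upwards [A.ae_law N n] with s hs
    exact A.abs_backAvg_le hs k y
  have hmul : ∀ (y : X (n + 1)) N, ∀ᵐ s ∂(law P h ρ ε N n), backAvg M h n k y s *
      emp (movedMonomial M h n (fun _ _ => 1) 0 y) s =
        emp (movedMonomial M h n (fun _ _ => 1) k y) s :=
    fun y N => ae_of_all _ fun s => backAvg_mul k y s
  have hdiv := RateFam.div (Ω := fun N => Sample X N n) (m := fun N => law P h ρ ε N n)
    (ι := X (n + 1))
    (u := fun y _ s => emp (movedMonomial M h n (fun _ _ => 1) k y) s)
    (v := fun y _ s => emp (movedMonomial M h n (fun _ _ => 1) 0 y) s)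
    (a := fun y => normConst P ρ n * backInt M n (shiftMoments h n (mom M h ε n) k) y)
    (b := fun y => normConst P ρ n * backMass M n y)
    (x := fun y _ s => backAvg M h n k y s)
    (Kx := (((n + 1 : ℕ) + 2 : ℝ) * H) ^ k)
    (b₀ := normConst P ρ n * (εl * (fwd M n).real Set.univ))
    (A.rateFam_movedMonomial_one hr k) h0 hmeas hbdd hmul
    (mul_pos hκ (mul_pos A.lo_pos (A.fwd_pos n)))
    fun y => mul_le_mul_of_nonneg_left (A.lo_mul_le_backMass n y) hκ.le
  simp only [mul_div_mul_left _ _ hκ.ne'] at hdiv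
  exact hdiv

lemma rateFam_selectionMix (A : Regular P h ρ ε εl εu δ γ H)
    (hr : PositionRates P h ρ ε n) {ι : Type u} {φ : ι → X n → X (n + 1) → ℝ}
    (hφ : ∀ i, Measurable (Function.uncurry (φ i))) {B : ℝ} (hB : ∀ i x y, |φ i x y| ≤ B)
    (k : ℕ) :
    RateFam (fun N => law P h ρ ε N n)
      (fun (q : ι × X (n + 1)) _ s => selectionMix M h (ε n) n (φ q.1) k q.2 s)
      fun q => normConst P ρ n * selectionMixLimit M h ε n (φ q.1) k q.2 := by
  have h1 := A.rateFam_movedMonomial hr hφ hB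
  unfold selectionMix selectionMixLimit
  split_ifs
  · have h2 := RateFam.sum (Finset.range (k + 1)) fun i _ =>
      (((h1 i).mul ((A.rateFam_backAvg hr (k - i)).reindex Prod.snd)).mul_const
        (k.choose i)).mul_const (2⁻¹ ^ k)
    convert h2 using 2 with q
    rw [Finset.mul_sum]
    refine Finset.sum_congr rfl fun i _ => ?_
    ring
  · exact h1 k

/-- Rates of convergence after a step with selection. -/
lemma rateFam_succ_of_selection (A : Regular P h ρ ε εl εu δ γ H) (hρ : ρ n = true)
    (hr : PositionRates P h ρ ε n) {ι : Type u} (k : ℕ) {f : ι → X (n + 1) → ℝ≥0 → ℝ}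
    (hf : ∀ i, Measurable (Function.uncurry (f i))) {B : ℝ} (hB : ∀ i x w, |f i x w| ≤ B) :
    RateFam (fun N => law P h ρ ε N (n + 1)) (fun i _ s => emp (weightedMonomial k (f i)) s)
      fun i => (∫ y, selectionMixLimit M h ε n (fun x y => f i y (P.weightFn true n x y)) k y
        ∂(M.μ (n + 1))) / ∫ x, (P.ϑ n x : ℝ) ∂(fwd M n) := by
  have := A.prob n
  have hκ := A.normConst_pos n
  refine A.rateFam_of_stepMean (fun i => measurable_weightedMonomial k (hf i))
    (fun i => boundedOnGood_weightedMonomial (hB i)) ?_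
  set φ : ι → X n → X (n + 1) → ℝ := fun i x y => f i y (P.weightFn true n x y) with hφd
  have hφ : ∀ i, Measurable (Function.uncurry (φ i)) := fun i =>
    (hf i).comp (measurable_snd.prodMk (measurable_weightFn P true n))
  have h1 := A.rateFam_selectionMix hr hφ (fun i x y => hB _ _ _) k
  have h2 := RateFam.integral (M.μ (n + 1))
    (u := fun i y N s => selectionMix M h (ε n) n (φ i) k y s)
    (a := fun i y => normConst P ρ n * selectionMixLimit M h ε n (φ i) k y) h1
    (fun i N => measurable_selectionMix (hφ i) (ε n) k)
    fun i => (A.measurable_selectionMixLimit n ⟨hφ i, B, fun q => hB _ _ _⟩ k).const_mul _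
  have h3 := hr ι 0 γ (fun _ x => P.ϑ n x) (fun _ => (A.bm_ϑ n).1) fun _ x => by
    rw [NNReal.abs_eq]; exact_mod_cast A.mix.ϑ_bound n x
  simp only [A.mom_zero, mul_one] at h3
  have hG := fun i => boundedOnGood_weightedMonomial (X := X) (n := n + 1) (ρ := ρ) (δ := δ)
    (H := H) (k := k) (hB i)
  -- The conditional mean is the quotient of the integrated selection mix by the mean of `ω ϑ`; the
  -- factor `normConst P ρ n` appears in both limits and cancels.
  have h4 := h2.div h3 (x := fun i _ s => stepMean P h (ρ n) (ε n) n (weightedMonomial k (f i)) s)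
    (Kx := |weightBound ρ δ (n + 1) * B * (((n + 1 : ℕ) + 2 : ℝ) * H) ^ k|)
    (fun i N => measurable_stepMean P h _ _ (measurable_weightedMonomial k (hf i)))
    (fun i N => by
      filter_upwards [A.ae_law N n] with s hs
      exact A.abs_stepMean_le hs (fun z hz => (hG i z hz).trans (le_abs_self _)) (abs_nonneg _))
    (fun i N => by
      filter_upwards [A.ae_law N n] with s hs
      exact A.stepMean_mul hρ hs k (hf i) (hB i))
    (mul_pos hκ (A.integral_ϑ_pos n)) fun _ => le_rfl
  convert h4 using 2 with i
  rw [integral_const_mul, mul_div_mul_left _ _ hκ.ne']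

/-- For coefficients that depend on the new position only, the limit is the recursion defining
`mom`; this explains that definition. -/
lemma selectionMixLimit_right (A : Regular P h ρ ε εl εu δ γ H) (n k : ℕ) (f : X (n + 1) → ℝ)
    (y : X (n + 1)) :
    selectionMixLimit M h ε n (fun _ y => f y) k y =
      backMass M n y * (f y * mom M h ε (n + 1) k y) := by
  have hy := (A.backMass_pos n y).ne'
  have e1 : ∀ i, backInt M n (fun x y => f y * shiftMoments h n (mom M h ε n) i x y) y =
      f y * backInt M n (shiftMoments h n (mom M h ε n) i) y := fun i => by
    unfold backInt
    rw [← integral_const_mul]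
    refine integral_congr_ae (ae_of_all _ fun x => ?_)
    ring
  unfold selectionMixLimit mom combineMoments
  simp only [e1]
  split_ifs
  · rw [Finset.mul_sum, Finset.mul_sum]
    refine Finset.sum_congr rfl fun i _ => ?_
    field_simp
  · field_simp

lemma positionRates_succ_of_selection (A : Regular P h ρ ε εl εu δ γ H) (hρ : ρ n = true)
    (hr : PositionRates P h ρ ε n) : PositionRates P h ρ ε (n + 1) := by
  intro ι k B f hf hB
  have := A.rateFam_succ_of_selection hρ hr k (f := fun i x _ => f i x)
    (fun i => (hf i).comp measurable_fst) fun i x _ => hB i x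
  convert this using 2 with i
  rw [A.integral_fwd_succ, normConst, if_pos hρ, inv_mul_eq_div]
  simp only [A.selectionMixLimit_right]

/-- The conditional mean is a sum of lower monomials at time `n` with coefficients integrated over
the mutation. The normalizing constant is inherited, and the limits agree by Fubini. -/
lemma positionRates_succ_of_not_selection (A : Regular P h ρ ε εl εu δ γ H) (hρ : ρ n = false)
    (hr : PositionRates P h ρ ε n) : PositionRates P h ρ ε (n + 1) := by
  intro ι k B f hf hB
  have := A.prob n
  have := A.isFiniteMeasure_fwd n
  have hf' : ∀ i, Measurable (Function.uncurry fun (x : X (n + 1)) (_ : ℝ≥0) => f i x) :=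
    fun i => (hf i).comp measurable_fst
  refine A.rateFam_of_stepMean (fun i => measurable_weightedMonomial k (hf' i))
    (fun i => boundedOnGood_weightedMonomial fun x _ => hB i x) ?_
  have hu : ∀ i j, BM (Function.uncurry fun (x : X n) y => f i y * h.incr n x y ^ (k - j)) :=
    fun i j => BM.mul (α := X n × X (n + 1)) (f := fun q => f i q.2)
      ⟨(hf i).comp measurable_snd, B, fun q => hB i q.2⟩ ((A.bm_incr n).pow _)
  have hL : ∀ i j, BM (fwdInt M n fun x y => f i y * h.incr n x y ^ (k - j)) := fun i j =>
    A.bm_fwdInt n (hu i j)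
  have h1 : ∀ j ∈ Finset.range (k + 1), RateFam (fun N => law P h ρ ε N n)
      (fun (i : ι) _ s => emp (weightedMonomial j fun x _ =>
        fwdInt M n (fun x y => f i y * h.incr n x y ^ (k - j)) x) s * (k.choose j))
      fun i => normConst P ρ n * (∫ x, fwdInt M n (fun x y => f i y * h.incr n x y ^ (k - j)) x *
        mom M h ε n j x ∂(fwd M n)) * (k.choose j) := fun j _ => by
    refine (hr ι j (εu * (B * H ^ (k - j))) _ (fun i => (hL i j).1) fun i x => ?_).mul_const _
    have := norm_integral_le_of_norm_le_const (μ := M.μ (n + 1))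
      (f := fun y => M.ell n x y * (f i y * h.incr n x y ^ (k - j)))
      (C := εu * (B * H ^ (k - j))) (ae_of_all _ fun y => by
        rw [Real.norm_eq_abs, abs_mul, abs_mul, abs_pow, NNReal.abs_eq]
        have hB0 := (abs_nonneg _).trans (hB i y)
        gcongr
        · exact A.le_hi n x y
        · exact hB _ _
        · exact A.incr_le n x y)
    simpa [fwdInt] using this
  have h2 := RateFam.sum (Finset.range (k + 1)) h1
  have h3 : RateFam (fun N => law P h ρ ε N n)
      (fun i _ s => stepMean P h (ρ n) (ε n) n (weightedMonomial k fun x _ => f i x) s)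
      fun i => ∑ j ∈ Finset.range (k + 1), normConst P ρ n *
        (∫ x, fwdInt M n (fun x y => f i y * h.incr n x y ^ (k - j)) x *
          mom M h ε n j x ∂(fwd M n)) * (k.choose j) := by
    obtain ⟨K, C, h2⟩ := h2
    refine ⟨K, C, fun i => ?_⟩
    have e : ∀ N, ∀ᵐ s ∂(law P h ρ ε N n),
        stepMean P h (ρ n) (ε n) n (weightedMonomial k fun x _ => f i x) s =
        ∑ j ∈ Finset.range (k + 1), emp (weightedMonomial j fun x _ =>
          fwdInt M n (fun x y => f i y * h.incr n x y ^ (k - j)) x) s * (k.choose j) := fun N => by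
      filter_upwards [A.ae_law N n] with s hs
      exact A.stepMean_eq_sum hρ hs k (hf' i) fun x _ => hB i x
    refine (h2 i).congr (fun N => measurable_stepMean P h _ _
      (measurable_weightedMonomial k (hf' i))) (fun N _ => e N) fun N => ?_
    filter_upwards [e N, (h2 i).bdd N] with s h5 h6
    rw [h5]
    exact h6
  convert h3 using 2 with i
  rw [A.integral_fwd_succ, normConst, hρ, if_neg Bool.false_ne_true]
  simp only [mul_assoc (normConst P ρ n), ← Finset.mul_sum]
  congr 1
  have e4 : ∀ y, backMass M n y * (f i y * mom M h ε (n + 1) k y) =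
      backInt M n (shiftMoments h n (mom M h ε n) k) y * f i y := fun y => by
    have hy := (A.backMass_pos n y).ne'
    simp only [mom, combineMoments, A.backward n hρ, Bool.false_eq_true, if_false]
    field_simp
  simp only [e4]
  rw [A.integral_backInt_mul n (A.bm_shiftMoments n (A.bm_mom n) k) ⟨hf i, B, hB i⟩]
  simp only [← integral_mul_const]
  rw [← integral_finsetSum _ fun j _ =>
    (((hL i j).mul (A.bm_mom n j)).mul (BM.const _)).integrable _]
  refine integral_congr_ae (ae_of_all _ fun x => ?_)
  simp only [fwdInt, ← integral_mul_const]
  rw [← integral_finsetSum _ fun j _ => (((((A.bm_ell n).curry_left x).mul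
    ((hu i j).curry_left x)).mul (BM.const _)).mul (BM.const _)).integrable _]
  refine integral_congr_ae (ae_of_all _ fun y => ?_)
  simp only [shiftMoments, Finset.mul_sum, Finset.sum_mul]
  refine Finset.sum_congr rfl fun j _ => ?_
  ring

/-- After a selection the new weight is a function of the old and new positions alone, so no
weight-dependent hypothesis on the past is required. -/
lemma weightRates_succ_of_selection (A : Regular P h ρ ε εl εu δ γ H) (hρ : ρ n = true)
    (hr : PositionRates P h ρ ε n) : WeightRates P h ρ ε (n + 1) := by
  rintro k f hf ⟨B, hB⟩
  obtain ⟨K, C, h1⟩ := A.rateFam_succ_of_selection hρ hr (ι := PUnit.{u + 1}) k (f := fun _ => f)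
    (fun _ => hf) fun _ => hB
  exact ⟨_, K, C, h1 PUnit.unit⟩

/-- The weight is multiplied by a function of the positions; integrating out the new position gives
coefficients depending on the old position and weight. -/
lemma weightRates_succ_of_not_selection (A : Regular P h ρ ε εl εu δ γ H) (hρ : ρ n = false)
    (hr : WeightRates P h ρ ε n) : WeightRates P h ρ ε (n + 1) := by
  rintro k f hf ⟨B, hB⟩
  have := A.prob n
  have hL : ∀ j, Measurable (Function.uncurry fun (x : X n) (w : ℝ≥0) => fwdInt M n
      (fun x y => f y (P.weightFn false n x y * w) * h.incr n x y ^ (k - j)) x) ∧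
      ∃ B, ∀ x (w : ℝ≥0), |fwdInt M n
        (fun x y => f y (P.weightFn false n x y * w) * h.incr n x y ^ (k - j)) x| ≤ B := fun j => by
    have hw : Measurable fun q : (X n × ℝ≥0) × X (n + 1) => P.weightFn false n q.1.1 q.2 :=
      (measurable_weightFn P false n).comp
        (f := fun q : (X n × ℝ≥0) × X (n + 1) => (q.1.1, q.2)) (by fun_prop)
    have hxy : Measurable fun q : (X n × ℝ≥0) × X (n + 1) => (q.1.1, q.2) := by fun_prop
    have h1 : BM fun q : (X n × ℝ≥0) × X (n + 1) => f q.2 (P.weightFn false n q.1.1 q.2 * q.1.2) :=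
      ⟨hf.comp (measurable_snd.prodMk (hw.mul (by fun_prop))), B, fun q => hB _ _⟩
    have h2 := ((A.bm_ell n).comp hxy).mul (h1.mul (((A.bm_incr n).comp hxy).pow (k - j)))
    have h3 := BM.integral_right (f := fun (r : X n × ℝ≥0) (y : X (n + 1)) => M.ell n r.1 y *
      (f y (P.weightFn false n r.1 y * r.2) * h.incr n r.1 y ^ (k - j))) h2 (M.μ (n + 1))
    exact ⟨h3.1, h3.2.imp fun _ hC x w => hC (x, w)⟩
  choose a K C hr1 using fun j => hr j _ (hL j).1 (hL j).2
  have h1 : ∀ j ∈ Finset.range (k + 1), RateFam (fun N => law P h ρ ε N n)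
      (fun (_ : Unit) _ s => emp (weightedMonomial j fun x w => fwdInt M n
        (fun x y => f y (P.weightFn false n x y * w) * h.incr n x y ^ (k - j)) x) s *
          (k.choose j)) fun _ => a j * k.choose j := fun j _ =>
    RateFam.mul_const ⟨K j, C j, fun _ => hr1 j⟩ _
  obtain ⟨K', C', h2⟩ := RateFam.sum (Finset.range (k + 1)) h1
  have e : ∀ N, ∀ᵐ s ∂(law P h ρ ε N n), stepMean P h (ρ n) (ε n) n (weightedMonomial k f) s =
      ∑ j ∈ Finset.range (k + 1), emp (weightedMonomial j fun x w => fwdInt M n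
        (fun x y => f y (P.weightFn false n x y * w) * h.incr n x y ^ (k - j)) x) s *
          (k.choose j) := fun N => by
    filter_upwards [A.ae_law N n] with s hs
    exact A.stepMean_eq_sum hρ hs k hf hB
  have h3 := (h2 ()).congr (fun N => measurable_stepMean P h _ _
      (measurable_weightedMonomial k hf)) (fun N _ => e N) fun N => by
    filter_upwards [e N, (h2 ()).bdd N] with s h5 h6
    rw [h5]
    exact h6
  obtain ⟨K'', C'', h4⟩ := A.rateFam_of_stepMean (ι := Unit) (g := fun _ => weightedMonomial k f)
    (fun _ => measurable_weightedMonomial k hf)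
    (fun _ => boundedOnGood_weightedMonomial hB) ⟨K', C', fun _ => h3⟩
  exact ⟨_, _, _, h4 ()⟩

end Regular

/-- The law of a particle of the initial sample. -/
noncomputable def initParticleLaw (P : Proposal M) (h : AdditiveTerms X) :
    Measure (X 0 × ℝ × ℝ≥0) :=
  ((M.μ 0).withDensity fun x => (P.ν x : ℝ≥0∞)).map fun x => (x, h.init x, P.initWeightFn x)

lemma measurable_initParticle (P : Proposal M) (h : AdditiveTerms X) :
    Measurable fun x => (x, h.init x, P.initWeightFn x) :=
  measurable_id.prodMk (h.measurable_init.prodMk (M.measurable_χ.div P.measurable_ν))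

instance isProbabilityMeasure_initParticleLaw (P : Proposal M) (h : AdditiveTerms X) :
    IsProbabilityMeasure (initParticleLaw P h) := by
  have h0 : IsProbabilityMeasure ((M.μ 0).withDensity fun x => (P.ν x : ℝ≥0∞)) :=
    ⟨by simp [P.ν_mass]⟩
  exact Measure.isProbabilityMeasure_map (measurable_initParticle P h).aemeasurable

lemma integral_weightedMonomial_init (P : Proposal M) (h : AdditiveTerms X) (k : ℕ)
    {f : X 0 → ℝ≥0 → ℝ} (hf : Measurable (Function.uncurry f)) :
    ∫ z, weightedMonomial k f z ∂(initParticleLaw P h) =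
      ∫ x, f x (P.initWeightFn x) * h.init x ^ k ∂(fwd M 0) := by
  rw [initParticleLaw, integral_map (measurable_initParticle P h).aemeasurable
    (measurable_weightedMonomial k hf).aestronglyMeasurable,
    integral_withDensity_eq_integral_smul P.measurable_ν, fwd,
    integral_withDensity_eq_integral_smul M.measurable_χ]
  refine integral_congr_ae (ae_of_all _ fun x => ?_)
  have : M.χ x = P.ν x * P.initWeightFn x := by
    unfold Proposal.initWeightFn
    rcases eq_or_ne (P.ν x) 0 with h0 | h0
    · rw [h0, P.ν_dominates x h0, zero_mul]
    · field_simp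
  simp only [NNReal.smul_def, smul_eq_mul, weightedMonomial, this, NNReal.coe_mul]
  ring

namespace Regular

lemma ae_initParticleLaw (A : Regular P h ρ ε εl εu δ γ H) :
    ∀ᵐ z ∂(initParticleLaw P h),
      (z.2.2 : ℝ) ≤ weightBound ρ δ 0 ∧ |z.2.1| ≤ ((0 : ℕ) + 2 : ℝ) * H := by
  rw [initParticleLaw, ae_map_iff (measurable_initParticle P h).aemeasurable (measurableSet_good 0)]
  refine ae_of_all _ fun x => ⟨?_, ?_⟩
  · simp only [weightBound]
    exact_mod_cast A.mix.initWeight_bound x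
  · simpa using A.abs_init_le x

lemma rateFam_init (A : Regular P h ρ ε εl εu δ γ H) {ι : Type*} {g : ι → X 0 × ℝ × ℝ≥0 → ℝ}
    (hg : ∀ i, Measurable (g i)) {G : ℝ} (hG : ∀ i, BoundedOnGood ρ δ H 0 (g i) G) :
    RateFam (fun N => law P h ρ ε N 0) (fun i _ s => emp (g i) s)
      fun i => ∫ z, g i z ∂(initParticleLaw P h) := by
  have hae : ∀ i, ∀ᵐ z ∂(initParticleLaw P h), |g i z| ≤ G := fun i => by
    filter_upwards [A.ae_initParticleLaw (ε := ε)] with z hz using hG i z hz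
  have hG0 : ∀ i : ι, 0 ≤ G := fun i => by
    obtain ⟨z, hz⟩ := (hae i).exists
    exact (abs_nonneg _).trans hz
  refine ⟨G, G ^ 2, fun i => ⟨fun N => measurable_emp (hg i), fun N => ?_, ?_, fun N hN => ?_⟩⟩
  · filter_upwards [A.ae_law N 0] with s hs
    exact abs_emp_le (hG0 i) fun j => hG i _ (hs j)
  · simpa using norm_integral_le_of_norm_le_const (f := g i) (C := G) (hae i)
  · have hN' : (N : ℝ) ≠ 0 := by positivity
    refine (integral_emp_sub_sq_le hN (fun _ => initParticleLaw P h) (hg i)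
      (fun _ => hae i) _).trans (le_of_eq ?_)
    simp
    field_simp
    simp

theorem positionRates (A : Regular P h ρ ε εl εu δ γ H) (n : ℕ) : PositionRates P h ρ ε n := by
  induction n with
  | zero =>
    intro ι k B f hf hB
    have hf' : ∀ i, Measurable (Function.uncurry fun (x : X 0) (_ : ℝ≥0) => f i x) :=
      fun i => (hf i).comp measurable_fst
    have := A.rateFam_init (fun i => measurable_weightedMonomial k (hf' i))
      fun i => boundedOnGood_weightedMonomial fun x _ => hB i x
    convert this using 2 with i
    refine Eq.trans ?_ (integral_weightedMonomial_init P h k (hf' i)).symm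
    simp [normConst, mom]
  | succ n ih =>
    cases hρ : ρ n
    · exact A.positionRates_succ_of_not_selection hρ ih
    · exact A.positionRates_succ_of_selection hρ ih

theorem weightRates (A : Regular P h ρ ε εl εu δ γ H) (n : ℕ) : WeightRates P h ρ ε n := by
  induction n with
  | zero =>
    rintro k f hf ⟨B, hB⟩
    obtain ⟨K, C, h1⟩ := A.rateFam_init (ι := Unit) (fun _ => measurable_weightedMonomial k hf)
      fun _ => boundedOnGood_weightedMonomial hB
    exact ⟨_, K, C, h1 ()⟩
  | succ n ih =>
    cases hρ : ρ n
    · exact A.weightRates_succ_of_not_selection hρ ih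
    · exact A.weightRates_succ_of_selection hρ (A.positionRates n)

end Regular

end RatesOfConvergence

/-! ### Quantitative Gaussian approximation of characteristic functions. -/

section CharacteristicFunctions

/-- The complex number of modulus one with argument `x`. -/
noncomputable def cis (x : ℝ) : ℂ := Complex.exp (x * Complex.I)

lemma norm_cis (x : ℝ) : ‖cis x‖ = 1 := Complex.norm_exp_ofReal_mul_I x

lemma cis_zero : cis 0 = 1 := by simp [cis]

lemma cis_add (x y : ℝ) : cis (x + y) = cis x * cis y := by
  unfold cis
  rw [← Complex.exp_add]
  push_cast
  ring_nf

lemma cis_sum {ι : Type*} (s : Finset ι) (f : ι → ℝ) : cis (∑ i ∈ s, f i) = ∏ i ∈ s, cis (f i) := by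
  induction s using Finset.cons_induction with
  | empty => simp [cis_zero]
  | cons a s ha ih => rw [Finset.sum_cons, Finset.prod_cons, cis_add, ih]

lemma measurable_cis : Measurable cis := by
  unfold cis
  fun_prop

lemma norm_cis_sub_one_le (x : ℝ) : ‖cis x - 1‖ ≤ |x| := by
  have := Real.norm_exp_I_mul_ofReal_sub_one_le (x := x)
  rwa [mul_comm, Real.norm_eq_abs] at this

lemma norm_cis_sub_cis_le (x y : ℝ) : ‖cis x - cis y‖ ≤ |x - y| := by
  have : cis x - cis y = cis y * (cis (x - y) - 1) := by
    rw [mul_sub, ← cis_add]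
    simp
  rw [this, norm_mul, norm_cis, one_mul]
  exact norm_cis_sub_one_le _

lemma norm_prod_sub_prod_le_sum {ι : Type*} (s : Finset ι) {f g : ι → ℂ} (hf : ∀ i, ‖f i‖ ≤ 1)
    (hg : ∀ i, ‖g i‖ ≤ 1) : ‖∏ i ∈ s, f i - ∏ i ∈ s, g i‖ ≤ ∑ i ∈ s, ‖f i - g i‖ := by
  induction s using Finset.cons_induction with
  | empty => simp
  | cons a s ha ih =>
    rw [Finset.prod_cons, Finset.prod_cons, Finset.sum_cons]
    have e : f a * ∏ i ∈ s, f i - g a * ∏ i ∈ s, g i =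
        (f a - g a) * ∏ i ∈ s, f i + g a * (∏ i ∈ s, f i - ∏ i ∈ s, g i) := by ring
    have h1 : ‖∏ i ∈ s, f i‖ ≤ 1 := by
      rw [norm_prod]
      exact Finset.prod_le_one (fun i _ => norm_nonneg _) fun i _ => hf i
    rw [e]
    refine (norm_add_le _ _).trans (add_le_add ?_ ?_)
    · rw [norm_mul]
      exact mul_le_of_le_one_right (norm_nonneg _) h1
    · rw [norm_mul]
      exact (mul_le_of_le_one_left (norm_nonneg _) (hg a)).trans ih

lemma norm_cis_sub_taylor_le {x : ℝ} (hx : |x| ≤ 1) :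
    ‖cis x - (1 + x * Complex.I - ((x ^ 2 / 2 : ℝ) : ℂ))‖ ≤ |x| ^ 3 * (2 / 9) := by
  have hn : ‖(x : ℂ) * Complex.I‖ = |x| := by simp
  have h1 := Complex.exp_bound (x := x * Complex.I) (by rwa [hn]) (n := 3) (by norm_num)
  rw [hn] at h1
  convert h1 using 2
  · unfold cis
    congr 1
    simp [Finset.sum_range_succ, mul_pow, Nat.factorial]
    ring
  · norm_num [Nat.factorial]

lemma abs_exp_neg_sub_le {x : ℝ} (hx0 : 0 ≤ x) (hx : x ≤ 1) :
    |Real.exp (-x) - (1 - x)| ≤ x ^ 2 * (3 / 4) := by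
  have h1 := Real.exp_bound (x := -x) (by rwa [abs_neg, abs_of_nonneg hx0]) (n := 2) (by norm_num)
  convert h1 using 2
  · simp [Finset.sum_range_succ]
    ring
  · rw [abs_neg, abs_of_nonneg hx0]
  · norm_num [Nat.factorial]

lemma abs_exp_neg_sub_exp_neg_le {x y : ℝ} (hx : 0 ≤ x) (hy : 0 ≤ y) :
    |Real.exp (-x) - Real.exp (-y)| ≤ |x - y| := by
  have key : ∀ a b : ℝ, 0 ≤ a → a ≤ b → |Real.exp (-a) - Real.exp (-b)| ≤ |a - b| := by
    intro a b ha hab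
    rw [abs_of_nonneg (sub_nonneg.2 (Real.exp_le_exp.2 (by linarith))), abs_sub_comm,
      abs_of_nonneg (sub_nonneg.2 hab)]
    have h1 : Real.exp (-a) - Real.exp (-b) = Real.exp (-a) * (1 - Real.exp (-(b - a))) := by
      rw [mul_sub, ← Real.exp_add]
      ring_nf
    have h2 : Real.exp (-a) ≤ 1 := Real.exp_le_one_iff.2 (by linarith)
    have h3 := Real.add_one_le_exp (-(b - a))
    have h4 : Real.exp (-(b - a)) ≤ 1 := Real.exp_le_one_iff.2 (by linarith)
    rw [h1]
    nlinarith [Real.exp_pos (-a)]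
  rcases le_total x y with h1 | h1
  · exact key x y hx h1
  · rw [abs_sub_comm, abs_sub_comm x]
    exact key y x hy h1

variable {E : Type*} [MeasurableSpace E]

lemma integrable_cis {α : Type*} [MeasurableSpace α] {μ : Measure α} [IsFiniteMeasure μ]
    {f : α → ℝ} (hf : Measurable f) : Integrable (fun x => cis (f x)) μ :=
  Integrable.of_bound (measurable_cis.comp hf).aestronglyMeasurable 1
    (ae_of_all _ fun x => (norm_cis _).le)

/-- Second-order expansion of the characteristic function of a bounded random variable. -/
lemma norm_integral_cis_sub_le (Q : Measure E) [IsProbabilityMeasure Q] {F : E → ℝ}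
    (hF : Measurable F) {G : ℝ} (hG : ∀ᵐ z ∂Q, |F z| ≤ G) {u : ℝ} (hu : |u| * (2 * G) ≤ 1) :
    ‖∫ z, cis (u * F z) ∂Q - cis (u * ∫ z, F z ∂Q) *
      (Real.exp (-(u ^ 2 * (∫ z, F z ^ 2 ∂Q - (∫ z, F z ∂Q) ^ 2) / 2)) : ℝ)‖ ≤
      (|u| * (2 * G)) ^ 3 := by
  set m := ∫ z, F z ∂Q with hm
  set v := ∫ z, F z ^ 2 ∂Q - m ^ 2 with hv
  set q := |u| * (2 * G) with hq
  have hG0 : 0 ≤ G := by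
    obtain ⟨z, hz⟩ := hG.exists
    exact (abs_nonneg _).trans hz
  have hq0 : 0 ≤ q := by positivity
  have iF := integrable_of_ae_abs_le hF hG
  have iF2 : Integrable (fun z => F z ^ 2) Q := by
    refine integrable_of_ae_abs_le (hF.pow_const 2) (C := G ^ 2) ?_
    filter_upwards [hG] with z hz
    rw [abs_pow]
    exact pow_le_pow_left₀ (abs_nonneg _) hz 2
  have hmG : |m| ≤ G := by
    simpa using norm_integral_le_of_norm_le_const (f := F) (C := G) hG
  have hfb : ∀ᵐ z ∂Q, |F z - m| ≤ 2 * G := by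
    filter_upwards [hG] with z hz
    exact (abs_sub _ _).trans (by linarith)
  have huf : ∀ᵐ z ∂Q, |u * (F z - m)| ≤ q := by
    filter_upwards [hfb] with z hz
    rw [abs_mul]
    exact mul_le_mul_of_nonneg_left hz (abs_nonneg _)
  have hfm : Measurable fun z => u * (F z - m) := (hF.sub_const m).const_mul u
  have hf1 : ∫ z, (F z - m) ∂Q = 0 := by
    rw [integral_sub iF (integrable_const _), ← hm]
    simp
  have if1 : Integrable (fun z => F z - m) Q := iF.sub (integrable_const _)
  have if2 : Integrable (fun z => (F z - m) ^ 2) Q := by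
    refine integrable_of_ae_abs_le ((hF.sub_const m).pow_const 2) (C := (2 * G) ^ 2) ?_
    filter_upwards [hfb] with z hz
    rw [abs_pow]
    exact pow_le_pow_left₀ (abs_nonneg _) hz 2
  have hf2 : ∫ z, (F z - m) ^ 2 ∂Q = v := by
    have : ∀ z, (F z - m) ^ 2 = F z ^ 2 - 2 * m * F z + m ^ 2 := fun z => by ring
    simp_rw [this]
    have i12 : Integrable (fun z => F z ^ 2 - 2 * m * F z) Q := iF2.sub (iF.const_mul _)
    rw [integral_add i12 (integrable_const _), integral_sub iF2 (iF.const_mul _),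
      integral_const_mul, ← hm]
    simp [hv]
    ring
  have hv0 : 0 ≤ v := by
    rw [← hf2]
    exact integral_nonneg fun z => sq_nonneg _
  have hvG : v ≤ (2 * G) ^ 2 := by
    rw [← hf2]
    calc _ ≤ ∫ _, (2 * G) ^ 2 ∂Q := by
          refine integral_mono_ae if2 (integrable_const _) ?_
          filter_upwards [hfb] with z hz
          exact sq_le_sq' (abs_le.1 hz).1 (abs_le.1 hz).2
      _ = _ := by simp
  set x := u ^ 2 * v / 2 with hx
  have hx0 : 0 ≤ x := by positivity
  have hxq : x ≤ q ^ 2 / 2 := by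
    have : q ^ 2 = u ^ 2 * (2 * G) ^ 2 := by rw [hq, mul_pow, sq_abs]
    rw [this, hx]
    gcongr
  have hq2 : q ^ 2 ≤ 1 := pow_le_one₀ hq0 hu
  -- Centering first makes the linear term vanish, so the expansion involves the variance only.
  have e1 : ∫ z, cis (u * F z) ∂Q = cis (u * m) * ∫ z, cis (u * (F z - m)) ∂Q := by
    rw [← integral_const_mul]
    refine integral_congr_ae (ae_of_all _ fun z => ?_)
    change cis _ = cis _ * cis _
    rw [← cis_add]
    ring_nf
  have ip : Integrable (fun z => (1 : ℂ) + (u * (F z - m) : ℝ) * Complex.I -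
      (((u * (F z - m)) ^ 2 / 2 : ℝ) : ℂ)) Q := by
    refine ((integrable_const _).add ((if1.const_mul u).ofReal.mul_const _)).sub ?_
    have : Integrable (fun z => (u * (F z - m)) ^ 2 / 2) Q := by
      simp only [mul_pow, mul_div_assoc]
      exact (if2.div_const 2).const_mul _
    exact this.ofReal
  have e2 : ∫ z, ((1 : ℂ) + (u * (F z - m) : ℝ) * Complex.I -
      (((u * (F z - m)) ^ 2 / 2 : ℝ) : ℂ)) ∂Q = ((1 - x : ℝ) : ℂ) := by
    have i1 : Integrable (fun z => ((u * (F z - m) : ℝ) : ℂ) * Complex.I) Q :=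
      (if1.const_mul u).ofReal.mul_const _
    have i2 : Integrable (fun z => (u * (F z - m)) ^ 2 / 2) Q := by
      simp only [mul_pow, mul_div_assoc]
      exact (if2.div_const 2).const_mul _
    have i3 : Integrable (fun z => (1 : ℂ) + ((u * (F z - m) : ℝ) : ℂ) * Complex.I) Q :=
      (integrable_const _).add i1
    have i4 : Integrable (fun z => (((u * (F z - m)) ^ 2 / 2 : ℝ) : ℂ)) Q := i2.ofReal
    rw [integral_sub i3 i4, integral_add (integrable_const _) i1, integral_mul_const,
      integral_complex_ofReal, integral_complex_ofReal, integral_const_mul, hf1]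
    simp only [mul_pow, mul_div_assoc, integral_const_mul, integral_div, hf2]
    simp [hx, mul_div_assoc]
  have e3 : ‖∫ z, cis (u * (F z - m)) ∂Q - ((1 - x : ℝ) : ℂ)‖ ≤ q ^ 3 * (2 / 9) := by
    rw [← e2, ← integral_sub (integrable_cis hfm) ip]
    have := norm_integral_le_of_norm_le_const (μ := Q) (f := fun z => cis (u * (F z - m)) -
      ((1 : ℂ) + (u * (F z - m) : ℝ) * Complex.I - (((u * (F z - m)) ^ 2 / 2 : ℝ) : ℂ)))
      (C := q ^ 3 * (2 / 9)) (by
        filter_upwards [huf] with z hz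
        refine (norm_cis_sub_taylor_le (hz.trans hu)).trans ?_
        gcongr)
    simpa using this
  -- From `x ≤ q ^ 2 / 2` the error `(3 / 4) x ^ 2` is at most `(3 / 16) q ^ 4`, and `q ≤ 1` lowers
  -- the exponent to three.
  have e4 : ‖((1 - x : ℝ) : ℂ) - (Real.exp (-x) : ℝ)‖ ≤ q ^ 3 * (3 / 16) := by
    rw [← Complex.ofReal_sub, Complex.norm_real, Real.norm_eq_abs, abs_sub_comm]
    refine (abs_exp_neg_sub_le hx0 (by linarith)).trans ?_
    have : x ^ 2 ≤ (q ^ 2 / 2) ^ 2 := pow_le_pow_left₀ hx0 hxq 2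
    have h5 : q ^ 4 ≤ q ^ 3 := pow_le_pow_of_le_one hq0 hu (by norm_num)
    nlinarith
  rw [e1, ← mul_sub, norm_mul, norm_cis, one_mul]
  calc _ ≤ ‖∫ z, cis (u * (F z - m)) ∂Q - ((1 - x : ℝ) : ℂ)‖ +
        ‖((1 - x : ℝ) : ℂ) - (Real.exp (-x) : ℝ)‖ := norm_sub_le_norm_sub_add_norm_sub _ _ _
    _ ≤ q ^ 3 * (2 / 9) + q ^ 3 * (3 / 16) := add_le_add e3 e4
    _ ≤ q ^ 3 := by
        have : 0 ≤ q ^ 3 := by positivity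
        linarith

/-- Gaussian approximation of the characteristic function of the normalized mean of independent
bounded random variables. -/
lemma norm_integral_cis_emp_sub_le {N : ℕ} (hN : 1 ≤ N) (Q : Fin N → Measure E)
    [∀ i, IsProbabilityMeasure (Q i)] {F : E → ℝ} (hF : Measurable F) {G : ℝ}
    (hG : ∀ i, ∀ᵐ z ∂(Q i), |F z| ≤ G) {t : ℝ} (ht : |t| * (2 * G) ≤ √N) :
    ‖∫ s, cis (t * (√N * emp F s)) ∂(Measure.pi Q) -
      cis (t * (√N * ((N : ℝ)⁻¹ * ∑ i, ∫ z, F z ∂(Q i)))) *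
      (Real.exp (-(t ^ 2 * ((N : ℝ)⁻¹ * ∑ i, (∫ z, F z ^ 2 ∂(Q i) - (∫ z, F z ∂(Q i)) ^ 2)) / 2))
        : ℝ)‖ ≤ (|t| * (2 * G)) ^ 3 / √N := by
  have hN' : (0 : ℝ) < N := by exact_mod_cast hN
  have hs : 0 < √(N : ℝ) := Real.sqrt_pos.2 hN'
  have hss : √(N : ℝ) * √N = N := Real.mul_self_sqrt hN'.le
  have hinv : (N : ℝ)⁻¹ = (√N)⁻¹ * (√N)⁻¹ := by rw [← mul_inv, hss]
  set u := t / √N with hu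
  have hun : ∀ c : ℝ, t * (√N * ((N : ℝ)⁻¹ * c)) = u * c := fun c => by
    rw [hu, hinv]
    field_simp
  have hu2 : t ^ 2 * (N : ℝ)⁻¹ = u ^ 2 := by
    rw [hu, div_pow, Real.sq_sqrt hN'.le, div_eq_mul_inv]
  have huq : |u| * (2 * G) = |t| * (2 * G) / √N := by
    rw [hu, abs_div, abs_of_pos hs]
    ring
  have hu1 : |u| * (2 * G) ≤ 1 := by
    rw [huq, div_le_one hs]
    exact ht
  have hG0 : 0 ≤ G := by
    obtain ⟨z, hz⟩ := (hG ⟨0, hN⟩).exists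
    exact (abs_nonneg _).trans hz
  have e1 : ∫ s, cis (t * (√N * emp F s)) ∂(Measure.pi Q) = ∏ i, ∫ z, cis (u * F z) ∂(Q i) := by
    rw [← integral_fintype_prod_eq_prod]
    refine integral_congr_ae (ae_of_all _ fun s => ?_)
    simp only [emp, hun, Finset.mul_sum, cis_sum]
  set v : Fin N → ℝ := fun i => ∫ z, F z ^ 2 ∂(Q i) - (∫ z, F z ∂(Q i)) ^ 2 with hv
  have hv0 : ∀ i, 0 ≤ v i := fun i => sub_nonneg.2 (sq_integral_le hF (hG i))
  have e2 : cis (t * (√N * ((N : ℝ)⁻¹ * ∑ i, ∫ z, F z ∂(Q i)))) *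
      (Real.exp (-(t ^ 2 * ((N : ℝ)⁻¹ * ∑ i, v i) / 2)) : ℝ) =
      ∏ i, (cis (u * ∫ z, F z ∂(Q i)) * (Real.exp (-(u ^ 2 * v i / 2)) : ℝ)) := by
    rw [hun, Finset.mul_sum, cis_sum, Finset.prod_mul_distrib, ← Complex.ofReal_prod,
      ← Real.exp_sum, ← mul_assoc, hu2]
    congr 4
    rw [Finset.sum_neg_distrib, Finset.mul_sum, Finset.sum_div]
  rw [e1, e2]
  refine (norm_prod_sub_prod_le_sum _ (fun i => ?_) fun i => ?_).trans ?_
  · have := norm_integral_le_of_norm_le_const (μ := Q i) (f := fun z => cis (u * F z)) (C := 1)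
      (ae_of_all _ fun z => (norm_cis _).le)
    simpa using this
  · rw [norm_mul, norm_cis, one_mul, Complex.norm_real, Real.norm_eq_abs, Real.abs_exp,
      Real.exp_le_one_iff]
    have := hv0 i
    have : 0 ≤ u ^ 2 * v i / 2 := by positivity
    linarith
  -- Lindeberg's replacement: `N` factors, each with an error of order `N ^ (-3 / 2)`.
  · calc _ ≤ ∑ _ : Fin N, (|u| * (2 * G)) ^ 3 :=
          Finset.sum_le_sum fun i _ => norm_integral_cis_sub_le (Q i) hF (hG i) hu1
      _ = N * (|u| * (2 * G)) ^ 3 := by simp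
      _ = √N * √N * ((|t| * (2 * G)) ^ 3 / √N ^ 3) := by rw [huq, div_pow, hss]
      _ = _ := by field_simp

end CharacteristicFunctions

/-! ### Consequences of rates for limits on the scale `√N`. -/

section RateLimits

variable {Ω : ℕ → Type*} [∀ N, MeasurableSpace (Ω N)] {m : ∀ N, Measure (Ω N)}
  [∀ N, IsProbabilityMeasure (m N)]

lemma Rate.tendsto_integral_abs_sub {u : ∀ N, Ω N → ℝ} {a K C : ℝ} (hu : Rate m u a K C) :
    Tendsto (fun N => ∫ s, |u N s - a| ∂(m N)) atTop (𝓝 0) := by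
  have h1 : Tendsto (fun N : ℕ => √(C / N)) atTop (𝓝 0) := by
    have := (tendsto_const_div_atTop_nhds_zero_nat C).sqrt
    simpa using this
  refine squeeze_zero' (Eventually.of_forall fun N => integral_nonneg fun s => abs_nonneg _) ?_ h1
  filter_upwards [eventually_ge_atTop 1] with N hN
  refine Real.le_sqrt_of_sq_le ?_
  refine le_trans ?_ (hu.rate N hN)
  refine (sq_integral_le (((hu.meas N).sub_const a).abs) (C := K + K) ?_).trans
    (le_of_eq (by simp only [sq_abs]))
  filter_upwards [hu.bdd N] with s hs
  rw [abs_abs]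
  exact (abs_sub _ _).trans (add_le_add hs hu.lim_le)

lemma Rate.tendsto_integral {u : ∀ N, Ω N → ℝ} {a K C : ℝ} (hu : Rate m u a K C) :
    Tendsto (fun N => ∫ s, u N s ∂(m N)) atTop (𝓝 a) := by
  rw [tendsto_iff_norm_sub_tendsto_zero]
  refine squeeze_zero (fun N => norm_nonneg _) (fun N => ?_) hu.tendsto_integral_abs_sub
  have i1 := integrable_of_ae_abs_le (hu.meas N) (hu.bdd N)
  have : ∫ s, u N s ∂(m N) - a = ∫ s, (u N s - a) ∂(m N) := by
    rw [integral_sub i1 (integrable_const _)]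
    simp
  rw [this, Real.norm_eq_abs]
  exact abs_integral_le_integral_abs

lemma Rate.le_of_ae_le {u v : ∀ N, Ω N → ℝ} {a b K C K' C' : ℝ} (hu : Rate m u a K C)
    (hv : Rate m v b K' C') (h : ∀ N, ∀ᵐ s ∂(m N), u N s ≤ v N s) : a ≤ b :=
  le_of_tendsto_of_tendsto' hu.tendsto_integral hv.tendsto_integral fun N =>
    integral_mono_ae (integrable_of_ae_abs_le (hu.meas N) (hu.bdd N))
      (integrable_of_ae_abs_le (hv.meas N) (hv.bdd N)) (h N)

lemma Rate.nonneg_of_ae_nonneg {u : ∀ N, Ω N → ℝ} {a K C : ℝ} (hu : Rate m u a K C)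
    (h : ∀ N, ∀ᵐ s ∂(m N), 0 ≤ u N s) : 0 ≤ a :=
  ge_of_tendsto' hu.tendsto_integral fun N => integral_nonneg_of_ae (h N)

/-- Used to identify constants obtained in two ways without computing them. -/
lemma Rate.unique {u : ∀ N, Ω N → ℝ} {a b K C K' C' : ℝ} (hu : Rate m u a K C)
    (hv : Rate m u b K' C') : a = b :=
  tendsto_nhds_unique hu.tendsto_integral hv.tendsto_integral

/-- The product of a random variable tending to zero and of one with a deterministic limit is
negligible at the scale of the square root of the sample size. -/
lemma Rate.tendsto_sqrt_mul {u v : ∀ N, Ω N → ℝ} {b K C K' C' : ℝ} (hu : Rate m u 0 K C)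
    (hv : Rate m v b K' C') :
    Tendsto (fun N : ℕ => ∫ s, √N * |u N s * (v N s - b)| ∂(m N)) atTop (𝓝 0) := by
  have h1 : Tendsto (fun N : ℕ => (C + C') / 2 * (1 / √N)) atTop (𝓝 0) := by
    have := (Real.tendsto_sqrt_atTop.comp tendsto_natCast_atTop_atTop).inv_tendsto_atTop.const_mul
      ((C + C') / 2)
    simpa using this
  refine squeeze_zero' (Eventually.of_forall fun N => integral_nonneg fun s => by positivity) ?_ h1
  filter_upwards [eventually_ge_atTop 1] with N hN
  have hN' : (0 : ℝ) < N := by exact_mod_cast hN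
  have hs : 0 < √(N : ℝ) := Real.sqrt_pos.2 hN'
  have i1 := hu.integrable_sq N 0
  have i2 := hv.integrable_sq N b
  calc ∫ s, √N * |u N s * (v N s - b)| ∂(m N)
      ≤ ∫ s, √N / 2 * ((u N s - 0) ^ 2 + (v N s - b) ^ 2) ∂(m N) := by
        refine integral_mono_of_nonneg (ae_of_all _ fun s => by positivity)
          ((i1.add i2).const_mul _) (ae_of_all _ fun s => ?_)
        -- Both factors are of order `N ^ (-1 / 2)` in mean square, so the product beats `√N`.
        have : |u N s * (v N s - b)| ≤ ((u N s - 0) ^ 2 + (v N s - b) ^ 2) / 2 := by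
          rw [abs_le]
          constructor <;> nlinarith [sq_nonneg (u N s + (v N s - b)), sq_nonneg (u N s - (v N s - b))]
        calc _ ≤ √N * (((u N s - 0) ^ 2 + (v N s - b) ^ 2) / 2) :=
              mul_le_mul_of_nonneg_left this hs.le
          _ = _ := by ring
    _ = √N / 2 * (∫ s, (u N s - 0) ^ 2 ∂(m N) + ∫ s, (v N s - b) ^ 2 ∂(m N)) := by
        rw [integral_const_mul, integral_add i1 i2]
    _ ≤ √N / 2 * (C / N + C' / N) := by
        gcongr
        · exact hu.rate N hN
        · exact hv.rate N hN
    _ = √N / 2 * ((C + C') * ((√N)⁻¹ * (√N)⁻¹)) := by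
        rw [← mul_inv, Real.mul_self_sqrt hN'.le]
        ring
    _ = _ := by field_simp

end RateLimits

/-! ### One step of the central limit theorem, conditionally on the past. -/

section CentralLimit

variable {X : ℕ → Type u} [∀ n, MeasurableSpace (X n)] {M : PathModel X} {P : Proposal M}
  {h : AdditiveTerms X} {ρ ε : ℕ → Bool} {εl εu δ γ H : ℝ≥0} {N n : ℕ}

lemma Rate.sub {Ω : ℕ → Type*} [∀ N, MeasurableSpace (Ω N)] {m : ∀ N, Measure (Ω N)}
    [∀ N, IsProbabilityMeasure (m N)] {u v : ∀ N, Ω N → ℝ} {a b K K' C C' : ℝ}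
    (hu : Rate m u a K C) (hv : Rate m v b K' C') :
    Rate m (fun N s => u N s - v N s) (a - b) (K + K') (2 * C + 2 * C') := by
  refine hu.of_le hv (fun N => (hu.meas N).sub (hv.meas N)) (fun N => ?_)
    ((abs_sub _ _).trans (add_le_add hu.lim_le hv.lim_le)) zero_le_two zero_le_two
    (fun N => ae_of_all _ fun s => ?_)
  · filter_upwards [hu.bdd N, hv.bdd N] with s h1 h2
    exact (abs_sub _ _).trans (add_le_add h1 h2)
  · nlinarith [sq_nonneg (u N s - a + (v N s - b))]

/-- The function `ω (τ g(ξ) + ψ(ξ))`. -/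
noncomputable def affineStat {E : Type*} (g ψ : E → ℝ) (z : E × ℝ × ℝ≥0) : ℝ :=
  z.2.2 * (z.2.1 * g z.1 + ψ z.1)

lemma affineStat_eq {E : Type*} (g ψ : E → ℝ) (z : E × ℝ × ℝ≥0) :
    affineStat g ψ z = weightedMonomial 1 (fun x _ => g x) z +
      weightedMonomial 0 (fun x _ => ψ x) z := by
  simp only [affineStat, weightedMonomial]
  ring

lemma measurable_affineStat {E : Type*} [MeasurableSpace E] {g ψ : E → ℝ} (hg : Measurable g)
    (hψ : Measurable ψ) : Measurable (affineStat g ψ) := by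
  have h1 : Measurable fun z : E × ℝ × ℝ≥0 => g z.1 := hg.comp measurable_fst
  have h2 : Measurable fun z : E × ℝ × ℝ≥0 => ψ z.1 := hψ.comp measurable_fst
  have h3 : Measurable fun z : E × ℝ × ℝ≥0 => (z.2.2 : ℝ) :=
    (measurable_snd.comp measurable_snd).coe_nnreal_real
  exact h3.mul (((by fun_prop : Measurable fun z : E × ℝ × ℝ≥0 => z.2.1).mul h1).add h2)

lemma exists_boundedOnGood_affineStat {g ψ : X n → ℝ} (hg : BM g) (hψ : BM ψ) :
    ∃ G, 0 ≤ G ∧ BoundedOnGood ρ δ H n (affineStat g ψ) G := by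
  obtain ⟨B, hB0, hB⟩ := hg.exists_pos
  obtain ⟨B', hB0', hB'⟩ := hψ.exists_pos
  have hW := weightBound_nonneg (ρ := ρ) (δ := δ) n
  refine ⟨weightBound ρ δ n * ((n + 2 : ℝ) * H * B + B'), by positivity, fun z hz => ?_⟩
  unfold affineStat
  rw [abs_mul, NNReal.abs_eq]
  have h1 : |z.2.1 * g z.1 + ψ z.1| ≤ (n + 2 : ℝ) * H * B + B' := by
    refine (abs_add_le _ _).trans (add_le_add ?_ (hB' _))
    rw [abs_mul]
    exact mul_le_mul hz.2 (hB _) (abs_nonneg _) (by positivity)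
  exact mul_le_mul hz.1 h1 (abs_nonneg _) hW

lemma BoundedOnGood.sq {F : X n × ℝ × ℝ≥0 → ℝ} {G : ℝ} (hG : BoundedOnGood ρ δ H n F G) :
    BoundedOnGood ρ δ H n (fun z => F z ^ 2) (G ^ 2) := fun z hz => by
  rw [abs_pow]
  exact pow_le_pow_left₀ (abs_nonneg _) (hG z hz) 2

/-- The mean of the conditional variances of the offspring. -/
noncomputable def stepVar (P : Proposal M) (h : AdditiveTerms X) (ρ ε : Bool) (n : ℕ)
    (F : X (n + 1) × ℝ × ℝ≥0 → ℝ) {N : ℕ} (s : Sample X N n) : ℝ :=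
  (N : ℝ)⁻¹ * ∑ i, (∫ z, F z ^ 2 ∂(particleLaw P h ρ ε n s i) -
    (∫ z, F z ∂(particleLaw P h ρ ε n s i)) ^ 2)

lemma measurable_stepVar (P : Proposal M) (h : AdditiveTerms X) (ρ ε : Bool)
    {F : X (n + 1) × ℝ × ℝ≥0 → ℝ} (hF : Measurable F) :
    Measurable fun s : Sample X N n => stepVar P h ρ ε n F s :=
  (Finset.measurable_fun_sum _ fun i _ =>
    (measurable_integral_particleLaw P h ρ ε i (hF.pow_const 2)).sub
      ((measurable_integral_particleLaw P h ρ ε i hF).pow_const 2)).const_mul _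

lemma stepVar_eq (P : Proposal M) (h : AdditiveTerms X) (ρ ε : Bool)
    (F : X (n + 1) × ℝ × ℝ≥0 → ℝ) (s : Sample X N n) :
    stepVar P h ρ ε n F s = stepMean P h ρ ε n (fun z => F z ^ 2) s -
      (N : ℝ)⁻¹ * ∑ i, (∫ z, F z ∂(particleLaw P h ρ ε n s i)) ^ 2 := by
  rw [stepVar, stepMean, Finset.sum_sub_distrib, mul_sub]

/-- With selection, neither the index law nor the new weight refers to `i`, so the offspring are
conditionally identically distributed. -/
lemma particleLaw_true (P : Proposal M) (h : AdditiveTerms X) (ε : Bool) (s : Sample X N n)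
    (i j : Fin N) : particleLaw P h true ε n s i = particleLaw P h true ε n s j := by
  simp [particleLaw, selectionLaw, newWeight]

/-- For every finite sample, averaging with a backward draw leaves the weighted first moment
unchanged: forward and backward index have the same law after weighting. This makes the linear
recursion exact. -/
lemma selectionMix_one (e : Bool) (g : X (n + 1) → ℝ) (y : X (n + 1)) (s : Sample X N n) :
    selectionMix M h e n (fun _ y => g y) 1 y s =
      g y * emp (movedMonomial M h n (fun _ _ => 1) 1 y) s := by
  rcases Nat.eq_zero_or_pos N with rfl | hN
  · simp [selectionMix_eq, emp]
  have h0 : backAvg M h n 0 y s = 1 := by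
    have := sum_catProb (fun j => (s j).2.2 * M.ell n (s j).1 y) ⟨0, hN⟩
    rw [← ENNReal.ofNNReal_finsetSum] at this
    have h1 : ∑ i, catProb (fun j => (s j).2.2 * M.ell n (s j).1 y) i = 1 := by exact_mod_cast this
    simp only [backAvg, pow_zero, mul_one]
    exact_mod_cast h1
  have e1 : ∀ i, emp (movedMonomial M h n (fun _ y => g y) i y) s =
      g y * emp (movedMonomial M h n (fun _ _ => 1) i y) s := fun i => by
    rw [mul_comm, ← emp_mul_const]
    congr 1
    funext z
    simp only [movedMonomial]
    ring
  have e2 := backAvg_mul (M := M) (h := h) 1 y s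
  unfold selectionMix
  split_ifs
  · simp only [Finset.sum_range_succ, Finset.sum_range_zero, h0, e1, ← e2]
    simp
    ring
  · exact e1 1

lemma selectionMix_zero (e : Bool) (g : X (n + 1) → ℝ) (y : X (n + 1)) (s : Sample X N n) :
    selectionMix M h e n (fun _ y => g y) 0 y s =
      g y * emp (movedMonomial M h n (fun _ _ => 1) 0 y) s := by
  have e1 : emp (movedMonomial M h n (fun _ y => g y) 0 y) s =
      g y * emp (movedMonomial M h n (fun _ _ => 1) 0 y) s := by
    rw [mul_comm, ← emp_mul_const]
    congr 1
    funext z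
    simp only [movedMonomial]
    ring
  have e2 := backAvg_mul (M := M) (h := h) 0 y s
  unfold selectionMix
  split_ifs
  · simp only [Finset.sum_range_succ, Finset.sum_range_zero, e1]
    simp
    rw [mul_assoc, mul_comm _ (backAvg M h n 0 y s), e2]
  · exact e1

namespace Regular

lemma ae_abs_particleLaw (A : Regular P h ρ ε εl εu δ γ H) {s : Sample X N n}
    (hs : GoodSample ρ δ H s) {F : X (n + 1) × ℝ × ℝ≥0 → ℝ} {G : ℝ}
    (hG : BoundedOnGood ρ δ H (n + 1) F G) (i : Fin N) :
    ∀ᵐ z ∂(particleLaw P h (ρ n) (ε n) n s i), |F z| ≤ G := by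
  filter_upwards [A.ae_particleLaw hs i] with z hz
  exact hG z (by exact_mod_cast hz)

lemma integrable_particleLaw (A : Regular P h ρ ε εl εu δ γ H) {s : Sample X N n}
    (hs : GoodSample ρ δ H s) {F : X (n + 1) × ℝ × ℝ≥0 → ℝ} (hF : Measurable F) {G : ℝ}
    (hG : BoundedOnGood ρ δ H (n + 1) F G) (i : Fin N) :
    Integrable F (particleLaw P h (ρ n) (ε n) n s i) :=
  integrable_of_ae_abs_le hF (A.ae_abs_particleLaw hs hG i)

lemma integral_stepLaw_emp (A : Regular P h ρ ε εl εu δ γ H) {s : Sample X N n}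
    (hs : GoodSample ρ δ H s) {F : X (n + 1) × ℝ × ℝ≥0 → ℝ} (hF : Measurable F) {G : ℝ}
    (hG : BoundedOnGood ρ δ H (n + 1) F G) :
    ∫ s', emp F s' ∂(stepLaw P h (ρ n) (ε n) n s) = stepMean P h (ρ n) (ε n) n F s := by
  unfold emp stepMean stepLaw
  rw [integral_const_mul, integral_finsetSum _ fun i _ =>
    integrable_comp_eval (A.integrable_particleLaw hs hF hG i)]
  congr 1
  exact Finset.sum_congr rfl fun i _ => integral_comp_eval hF.aestronglyMeasurable

/-- Mean square rates are inherited by conditional means. -/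
lemma rate_stepMean (A : Regular P h ρ ε εl εu δ γ H) {F : X (n + 1) × ℝ × ℝ≥0 → ℝ}
    (hF : Measurable F) {G : ℝ} (hG0 : 0 ≤ G) (hG : BoundedOnGood ρ δ H (n + 1) F G) {a K C : ℝ}
    (hr : Rate (fun N => law P h ρ ε N (n + 1)) (fun _ s => emp F s) a K C) :
    Rate (fun N => law P h ρ ε N n) (fun _ s => stepMean P h (ρ n) (ε n) n F s) a (max G K) C := by
  refine ⟨fun N => measurable_stepMean P h _ _ hF, fun N => ?_, hr.lim_le.trans (le_max_right _ _),
    fun N hN => ?_⟩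
  · filter_upwards [A.ae_law N n] with s hs
    exact (A.abs_stepMean_le hs hG hG0).trans (le_max_left _ _)
  · refine le_trans ?_ (hr.rate N hN)
    have hint := hr.integrable_sq N a
    rw [integral_law_succ P h ρ ε N n hint]
    have hbd : ∀ᵐ s ∂(law P h ρ ε N n), ∀ᵐ s' ∂(stepLaw P h (ρ n) (ε n) n s),
        |emp F s' - a| ≤ G + |a| := by
      filter_upwards [A.ae_law N n] with s hs
      filter_upwards [A.ae_stepLaw hs] with s' hs'
      exact (abs_sub _ _).trans (add_le_add (abs_emp_le hG0 fun j => hG _ (hs' j)) le_rfl)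
    have hm : Measurable fun s' : Sample X N (n + 1) => emp F s' - a :=
      (measurable_emp hF).sub_const a
    refine integral_mono_of_nonneg (ae_of_all _ fun s => sq_nonneg _) ?_ ?_
    · refine Integrable.of_bound (measurable_integral_stepLaw P h _ _
        (hm.pow_const 2).stronglyMeasurable).aestronglyMeasurable ((G + |a|) ^ 2) ?_
      filter_upwards [hbd] with s hs
      have := norm_integral_le_of_norm_le_const (μ := stepLaw P h (ρ n) (ε n) n s)
        (f := fun s' => (emp F s' - a) ^ 2) (C := (G + |a|) ^ 2) (by
          filter_upwards [hs] with s' hs'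
          rw [norm_pow]
          exact pow_le_pow_left₀ (norm_nonneg _) hs' 2)
      simpa using this
    · filter_upwards [A.ae_law N n, hbd] with s hs hb
      have i1 : Integrable (fun s' => emp F s') (stepLaw P h (ρ n) (ε n) n s) := by
        refine integrable_of_ae_abs_le (measurable_emp hF) (C := G) ?_
        filter_upwards [A.ae_stepLaw hs] with s' hs'
        exact abs_emp_le hG0 fun j => hG _ (hs' j)
      have e : stepMean P h (ρ n) (ε n) n F s - a =
          ∫ s', (emp F s' - a) ∂(stepLaw P h (ρ n) (ε n) n s) := by
        rw [integral_sub i1 (integrable_const _), A.integral_stepLaw_emp hs hF hG]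
        simp
      change (stepMean P h (ρ n) (ε n) n F s - a) ^ 2 ≤ _
      rw [e]
      exact sq_integral_le hm hb

lemma stepVar_nonneg (A : Regular P h ρ ε εl εu δ γ H) {s : Sample X N n}
    (hs : GoodSample ρ δ H s) {F : X (n + 1) × ℝ × ℝ≥0 → ℝ} (hF : Measurable F) {G : ℝ}
    (hG : BoundedOnGood ρ δ H (n + 1) F G) : 0 ≤ stepVar P h (ρ n) (ε n) n F s :=
  mul_nonneg (by positivity) (Finset.sum_nonneg fun i _ =>
    sub_nonneg.2 (sq_integral_le hF (A.ae_abs_particleLaw hs hG i)))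

/-- Convergence of characteristic functions is propagated by one step. -/
lemma tendsto_cis_succ (A : Regular P h ρ ε εl εu δ γ H) {F : X (n + 1) × ℝ × ℝ≥0 → ℝ}
    (hF : Measurable F) {G : ℝ} (hG0 : 0 ≤ G) (hG : BoundedOnGood ρ δ H (n + 1) F G)
    {Y : ∀ N, Sample X N n → ℝ} (hY : ∀ N, Measurable (Y N)) {KY : ℝ}
    (hYK : ∀ N, ∀ᵐ s ∂(law P h ρ ε N n), |Y N s| ≤ KY) {V S K C : ℝ}
    (hlim : ∀ t : ℝ, Tendsto (fun N : ℕ => ∫ s, cis (t * (√N * Y N s)) ∂(law P h ρ ε N n)) atTop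
      (𝓝 (Real.exp (-(t ^ 2 * V / 2)) : ℝ)))
    (hdiff : Tendsto (fun N : ℕ => ∫ s, √N * |stepMean P h (ρ n) (ε n) n F s - Y N s|
      ∂(law P h ρ ε N n)) atTop (𝓝 0))
    (hS : Rate (fun N => law P h ρ ε N n) (fun _ s => stepVar P h (ρ n) (ε n) n F s) S K C)
    (t : ℝ) :
    Tendsto (fun N : ℕ => ∫ s, cis (t * (√N * emp F s)) ∂(law P h ρ ε N (n + 1))) atTop
      (𝓝 (Real.exp (-(t ^ 2 * (V + S) / 2)) : ℝ)) := by
  have hS0 : 0 ≤ S := hS.nonneg_of_ae_nonneg fun N => by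
    filter_upwards [A.ae_law N n] with s hs
    exact A.stepVar_nonneg hs hF hG
  set e : ℂ := ((Real.exp (-(t ^ 2 * S / 2)) : ℝ) : ℂ) with he
  have he1 : ‖e‖ ≤ 1 := by
    rw [he, Complex.norm_real, Real.norm_eq_abs, Real.abs_exp, Real.exp_le_one_iff]
    have : 0 ≤ t ^ 2 * S / 2 := by positivity
    linarith
  have hmain : Tendsto (fun N : ℕ => ∫ s, cis (t * (√N * emp F s)) ∂(law P h ρ ε N (n + 1)) -
      e * ∫ s, cis (t * (√N * Y N s)) ∂(law P h ρ ε N n)) atTop (𝓝 0) := by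
    -- Three errors: the Gaussian approximation given the past, the replacement of the conditional
    -- mean by `Y`, and the replacement of the random conditional variance by its limit `S`.
    have hb : Tendsto (fun N : ℕ => (|t| * (2 * G)) ^ 3 * (1 / √N) +
        (|t| * (∫ s, √N * |stepMean P h (ρ n) (ε n) n F s - Y N s| ∂(law P h ρ ε N n)) +
        t ^ 2 / 2 * ∫ s, |stepVar P h (ρ n) (ε n) n F s - S| ∂(law P h ρ ε N n))) atTop (𝓝 0) := by
      have h1 := (Real.tendsto_sqrt_atTop.comp
        tendsto_natCast_atTop_atTop).inv_tendsto_atTop.const_mul ((|t| * (2 * G)) ^ 3)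
      have h2 := h1.add ((hdiff.const_mul |t|).add (hS.tendsto_integral_abs_sub.const_mul
        (t ^ 2 / 2)))
      simpa using h2
    refine squeeze_zero_norm' ?_ hb
    filter_upwards [eventually_ge_atTop 1, (Real.tendsto_sqrt_atTop.comp
      tendsto_natCast_atTop_atTop).eventually_ge_atTop (|t| * (2 * G))] with N hN hNt
    have hmF : Measurable fun s' : Sample X N (n + 1) => t * (√N * emp F s') :=
      ((measurable_emp hF).const_mul _).const_mul _
    have hmY : Measurable fun s : Sample X N n => t * (√N * Y N s) :=
      ((hY N).const_mul _).const_mul _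
    have hmM : Measurable fun s : Sample X N n => stepMean P h (ρ n) (ε n) n F s :=
      measurable_stepMean P h _ _ hF
    rw [integral_law_succ P h ρ ε N n (integrable_cis hmF), ← integral_const_mul]
    have i1 : Integrable (fun s => ∫ s', cis (t * (√N * emp F s'))
        ∂(stepLaw P h (ρ n) (ε n) n s)) (law P h ρ ε N n) := by
      refine Integrable.of_bound (measurable_integral_stepLaw P h _ _
        (measurable_cis.comp hmF).stronglyMeasurable).aestronglyMeasurable 1
        (ae_of_all _ fun s => ?_)
      have := norm_integral_le_of_norm_le_const (μ := stepLaw P h (ρ n) (ε n) n s)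
        (f := fun s' => cis (t * (√N * emp F s'))) (C := 1) (ae_of_all _ fun s' => (norm_cis _).le)
      simpa using this
    have i2 : Integrable (fun s => e * cis (t * (√N * Y N s))) (law P h ρ ε N n) :=
      (integrable_cis hmY).const_mul e
    have i3 : Integrable (fun s => √N * |stepMean P h (ρ n) (ε n) n F s - Y N s|)
        (law P h ρ ε N n) := by
      refine (integrable_of_ae_abs_le (hmM.sub (hY N)).abs (C := G + KY) ?_).const_mul _
      filter_upwards [A.ae_law N n, hYK N] with s hs hys
      rw [abs_abs]
      exact (abs_sub _ _).trans (add_le_add (A.abs_stepMean_le hs hG hG0) hys)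
    have i4 : Integrable (fun s => |stepVar P h (ρ n) (ε n) n F s - S|) (law P h ρ ε N n) := by
      refine integrable_of_ae_abs_le ((hS.meas N).sub_const S).abs (C := K + K) ?_
      filter_upwards [hS.bdd N] with s hs
      rw [abs_abs]
      exact (abs_sub _ _).trans (add_le_add hs hS.lim_le)
    rw [← integral_sub i1 i2]
    calc _ ≤ ∫ s, ‖∫ s', cis (t * (√N * emp F s')) ∂(stepLaw P h (ρ n) (ε n) n s) -
            e * cis (t * (√N * Y N s))‖ ∂(law P h ρ ε N n) := norm_integral_le_integral_norm _
      _ ≤ ∫ s, ((|t| * (2 * G)) ^ 3 * (1 / √N) +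
            (|t| * (√N * |stepMean P h (ρ n) (ε n) n F s - Y N s|) +
              t ^ 2 / 2 * |stepVar P h (ρ n) (ε n) n F s - S|)) ∂(law P h ρ ε N n) := by
          refine integral_mono_of_nonneg (ae_of_all _ fun s => norm_nonneg _)
            ((integrable_const _).add ((i3.const_mul _).add (i4.const_mul _))) ?_
          filter_upwards [A.ae_law N n] with s hs
          have hv0 := A.stepVar_nonneg hs hF hG
          set m := stepMean P h (ρ n) (ε n) n F s with hm
          set v := stepVar P h (ρ n) (ε n) n F s with hv
          have h1 : ‖∫ s', cis (t * (√N * emp F s')) ∂(stepLaw P h (ρ n) (ε n) n s) -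
              cis (t * (√N * m)) * (Real.exp (-(t ^ 2 * v / 2)) : ℝ)‖ ≤
                (|t| * (2 * G)) ^ 3 / √N :=
            norm_integral_cis_emp_sub_le hN _ hF (A.ae_abs_particleLaw hs hG) hNt
          have h2 : ‖cis (t * (√N * m)) * (Real.exp (-(t ^ 2 * v / 2)) : ℝ) -
              cis (t * (√N * m)) * e‖ ≤ t ^ 2 / 2 * |v - S| := by
            rw [← mul_sub, norm_mul, norm_cis, one_mul, he, ← Complex.ofReal_sub,
              Complex.norm_real, Real.norm_eq_abs]
            refine (abs_exp_neg_sub_exp_neg_le (by positivity) (by positivity)).trans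
              (le_of_eq ?_)
            have : t ^ 2 * v / 2 - t ^ 2 * S / 2 = t ^ 2 / 2 * (v - S) := by ring
            rw [this, abs_mul, abs_of_nonneg (by positivity)]
          have h3 : ‖cis (t * (√N * m)) * e - e * cis (t * (√N * Y N s))‖ ≤
              |t| * (√N * |m - Y N s|) := by
            rw [mul_comm e, ← sub_mul, norm_mul]
            refine (mul_le_of_le_one_right (norm_nonneg _) he1).trans
              ((norm_cis_sub_cis_le _ _).trans (le_of_eq ?_))
            rw [← mul_sub, ← mul_sub, abs_mul, abs_mul, abs_of_nonneg (Real.sqrt_nonneg _)]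
          calc _ ≤ _ := norm_sub_le_norm_sub_add_norm_sub _
                (cis (t * (√N * m)) * (Real.exp (-(t ^ 2 * v / 2)) : ℝ)) _
            _ ≤ _ := add_le_add h1 ((norm_sub_le_norm_sub_add_norm_sub _
                (cis (t * (√N * m)) * e) _).trans (add_le_add h2 h3))
            _ = _ := by ring
      _ = _ := by
          have i34 : Integrable (fun s => |t| * (√N * |stepMean P h (ρ n) (ε n) n F s - Y N s|) +
              t ^ 2 / 2 * |stepVar P h (ρ n) (ε n) n F s - S|) (law P h ρ ε N n) :=
            (i3.const_mul _).add (i4.const_mul _)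
          rw [integral_add (integrable_const _) i34, integral_add (i3.const_mul _) (i4.const_mul _)]
          simp [integral_const_mul]
  have h5 := hmain.add ((hlim t).const_mul e)
  simp only [sub_add_cancel, zero_add] at h5
  convert h5 using 2
  rw [he, ← Complex.ofReal_mul, ← Real.exp_add]
  congr 2
  ring

end Regular

end CentralLimit

/-! ### Asymptotic normality of the weighted sample and its variance recursion. -/

section AsymptoticNormality

variable {X : ℕ → Type u} [∀ n, MeasurableSpace (X n)] {M : PathModel X} {P : Proposal M}
  {h : AdditiveTerms X} {ρ ε : ℕ → Bool} {εl εu δ γ H : ℝ≥0} {N n : ℕ}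

/-- The normalized mean of `ω (τ g(ξ) + ψ(ξ))` is asymptotically normal with variance `V`, in terms
of characteristic functions. -/
def AsympNormal (P : Proposal M) (h : AdditiveTerms X) (ρ ε : ℕ → Bool) (n : ℕ) (g ψ : X n → ℝ)
    (V : ℝ) : Prop :=
  ∀ t : ℝ, Tendsto (fun N : ℕ => ∫ s, cis (t * (√N * emp (affineStat g ψ) s)) ∂(law P h ρ ε N n))
    atTop (𝓝 (Real.exp (-(t ^ 2 * V / 2)) : ℝ))

lemma emp_affineStat {E : Type*} {N : ℕ} (g ψ : E → ℝ) (s : Fin N → E × ℝ × ℝ≥0) :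
    emp (affineStat g ψ) s = emp (weightedMonomial 1 fun x _ => g x) s +
      emp (weightedMonomial 0 fun x _ => ψ x) s := by
  rw [← emp_add]
  congr 1
  funext z
  exact affineStat_eq g ψ z

namespace Regular

lemma exists_rate_weightedMonomial (A : Regular P h ρ ε εl εu δ γ H) (n k : ℕ) {f : X n → ℝ}
    (hf : BM f) : ∃ K C, Rate (fun N => law P h ρ ε N n)
      (fun _ s => emp (weightedMonomial k fun x _ => f x) s)
      (normConst P ρ n * ∫ x, f x * mom M h ε n k x ∂(fwd M n)) K C := by
  obtain ⟨B, hB⟩ := hf.2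
  obtain ⟨K, C, hr⟩ := A.positionRates n PUnit.{u + 1} k B (fun _ => f) (fun _ => hf.1) fun _ => hB
  exact ⟨K, C, hr PUnit.unit⟩

lemma exists_rate_affineStat (A : Regular P h ρ ε εl εu δ γ H) (n : ℕ) {g ψ : X n → ℝ}
    (hg : BM g) (hψ : BM ψ) : ∃ K C, Rate (fun N => law P h ρ ε N n)
      (fun _ s => emp (affineStat g ψ) s)
      (normConst P ρ n * ∫ x, (g x * mom M h ε n 1 x + ψ x) ∂(fwd M n)) K C := by
  have := A.isFiniteMeasure_fwd n
  obtain ⟨K, C, h1⟩ := A.exists_rate_weightedMonomial n 1 hg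
  obtain ⟨K', C', h2⟩ := A.exists_rate_weightedMonomial n 0 hψ
  have h3 := h1.add h2
  simp only [← emp_affineStat, A.mom_zero, mul_one, ← mul_add] at h3
  rw [← integral_add ((hg.mul (A.bm_mom n 1)).integrable _) (hψ.integrable _)] at h3
  exact ⟨_, _, h3⟩

lemma exists_rate_affineStat_sq (A : Regular P h ρ ε εl εu δ γ H) (n : ℕ) {g ψ : X n → ℝ}
    (hg : BM g) (hψ : BM ψ) : ∃ a K C, Rate (fun N => law P h ρ ε N n)
      (fun _ s => emp (fun z => affineStat g ψ z ^ 2) s) a K C := by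
  set W := weightBound ρ δ n with hW
  have hW0 : 0 ≤ W := weightBound_nonneg n
  -- The weight-dependent law of large numbers asks for bounded coefficients, so one factor `ω` of
  -- the square is truncated at the almost sure bound `W`, which changes nothing on good samples.
  have hr : ∀ k {f : X n → ℝ}, BM f → ∃ a K C, Rate (fun N => law P h ρ ε N n)
      (fun _ s => emp (weightedMonomial k fun x w => min (w : ℝ) W * f x) s) a K C := by
    intro k f hf
    obtain ⟨B, hB0, hB⟩ := hf.exists_pos
    have hm : Measurable fun q : X n × ℝ≥0 => (q.2 : ℝ) := measurable_snd.coe_nnreal_real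
    have hfm : Measurable fun q : X n × ℝ≥0 => f q.1 := hf.1.comp measurable_fst
    refine A.weightRates n k (fun x w => min (w : ℝ) W * f x)
      ((hm.min measurable_const).mul hfm) ⟨W * B, fun x w => ?_⟩
    rw [abs_mul, abs_of_nonneg (le_min w.coe_nonneg hW0)]
    exact mul_le_mul (min_le_right _ _) (hB x) (abs_nonneg _) hW0
  obtain ⟨a, K, C, h1⟩ := hr 2 (hg.mul hg)
  obtain ⟨a', K', C', h2⟩ := hr 1 ((BM.const 2).mul (hg.mul hψ))
  obtain ⟨a'', K'', C'', h3⟩ := hr 0 (hψ.mul hψ)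
  have h4 := (h1.add h2).add h3
  have e : ∀ N, ∀ᵐ s ∂(law P h ρ ε N n), emp (fun z => affineStat g ψ z ^ 2) s =
      emp (weightedMonomial 2 fun x w => min (w : ℝ) W * (g x * g x)) s +
      emp (weightedMonomial 1 fun x w => min (w : ℝ) W * (2 * (g x * ψ x))) s +
      emp (weightedMonomial 0 fun x w => min (w : ℝ) W * (ψ x * ψ x)) s := fun N => by
    filter_upwards [A.ae_law N n] with s hs
    rw [← emp_add, ← emp_add, emp, emp]
    congr 1
    refine Finset.sum_congr rfl fun i _ => ?_
    have hw : ((s i).2.2 : ℝ) ≤ W := (hs i).1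
    simp only [affineStat, weightedMonomial, min_eq_left hw]
    ring
  refine ⟨_, _, _, h4.congr (fun N => measurable_emp ((measurable_affineStat hg.1
    hψ.1).pow_const 2)) (fun N _ => e N) fun N => ?_⟩
  filter_upwards [e N, h4.bdd N] with s h5 h6
  rw [h5]
  exact h6

/-- Bound of the limiting second moments. -/
lemma sq_limit_le (A : Regular P h ρ ε εl εu δ γ H) (n : ℕ) {g ψ : X n → ℝ} (hg : BM g)
    (hψ : BM ψ) {a K C : ℝ} (hr : Rate (fun N => law P h ρ ε N n)
      (fun _ s => emp (fun z => affineStat g ψ z ^ 2) s) a K C) :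
    a ≤ weightBound ρ δ n * (normConst P ρ n * secondMoment M h ε n g ψ) := by
  have := A.isFiniteMeasure_fwd n
  have hW0 : 0 ≤ weightBound ρ δ n := weightBound_nonneg n
  have b1 := hg.mul hg
  have b2 := (BM.const (α := X n) 2).mul (hg.mul hψ)
  have b3 := hψ.mul hψ
  obtain ⟨K1, C1, h1⟩ := A.exists_rate_weightedMonomial n 2 b1
  obtain ⟨K2, C2, h2⟩ := A.exists_rate_weightedMonomial n 1 b2
  obtain ⟨K3, C3, h3⟩ := A.exists_rate_weightedMonomial n 0 b3
  have h4 := (Rate.const (m := fun N => law P h ρ ε N n) (c := weightBound ρ δ n)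
    le_rfl).mul ((h1.add h2).add h3)
  have e : normConst P ρ n * ∫ x, g x * g x * mom M h ε n 2 x ∂(fwd M n) +
      normConst P ρ n * ∫ x, 2 * (g x * ψ x) * mom M h ε n 1 x ∂(fwd M n) +
      normConst P ρ n * ∫ x, ψ x * ψ x * mom M h ε n 0 x ∂(fwd M n) =
      normConst P ρ n * secondMoment M h ε n g ψ := by
    rw [← mul_add, ← mul_add]
    have i1 := (b1.mul (A.bm_mom (ε := ε) n 2)).integrable (fwd M n)
    have i2 := (b2.mul (A.bm_mom (ε := ε) n 1)).integrable (fwd M n)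
    have i3 := (b3.mul (A.bm_mom (ε := ε) n 0)).integrable (fwd M n)
    have i12 : Integrable (fun x => g x * g x * mom M h ε n 2 x +
      2 * (g x * ψ x) * mom M h ε n 1 x) (fwd M n) := i1.add i2
    rw [← integral_add i1 i2, ← integral_add i12 i3, secondMoment]
    congr 1
    refine integral_congr_ae (ae_of_all _ fun x => ?_)
    simp only [condVar, A.mom_zero]
    ring
  rw [← e]
  refine hr.le_of_ae_le h4 fun N => ?_
  filter_upwards [A.ae_law N n] with s hs
  rw [← emp_add, ← emp_add, mul_comm, ← emp_mul_const, emp, emp]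
  refine mul_le_mul_of_nonneg_left (Finset.sum_le_sum fun i _ => ?_) (by positivity)
  -- Of the two factors `ω` in the square, one is bounded by its almost sure bound; the other serves
  -- as the weight in the law of large numbers.
  have e2 : affineStat g ψ (s i) ^ 2 =
      (s i).2.2 * ((s i).2.1 * g (s i).1 + ψ (s i).1) ^ 2 * (s i).2.2 := by
    unfold affineStat
    ring
  have e3 : (weightedMonomial 2 (fun x _ => g x * g x) (s i) +
      weightedMonomial 1 (fun x _ => 2 * (g x * ψ x)) (s i) +
      weightedMonomial 0 (fun x _ => ψ x * ψ x) (s i)) =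
      (s i).2.2 * ((s i).2.1 * g (s i).1 + ψ (s i).1) ^ 2 := by
    unfold weightedMonomial
    ring
  rw [e2, e3]
  exact mul_le_mul_of_nonneg_left (hs i).1 (by positivity)

/-- Integrating out the position after the mutation. -/
lemma integral_mutation_affineStat (A : Regular P h ρ ε εl εu δ γ H) {g ψ : X (n + 1) → ℝ}
    (hg : BM g) (hψ : BM ψ) (z : X n × ℝ × ℝ≥0) :
    ∫ y, z.2.2 * M.ell n z.1 y * ((z.2.1 + h.incr n z.1 y) * g y + ψ y) ∂(M.μ (n + 1)) =
      affineStat (pullFst M n g) (pullSnd M h n g ψ) z := by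
  have := A.prob n
  have hl := (A.bm_ell n).curry_left z.1
  have i1 := ((hl.mul hg).mul (BM.const z.2.1)).integrable (M.μ (n + 1))
  have i2 := (hl.mul ((((A.bm_incr n).curry_left z.1).mul hg).add hψ)).integrable (M.μ (n + 1))
  unfold affineStat pullFst pullSnd fwdInt
  rw [mul_comm z.2.1, ← integral_mul_const, ← integral_add i1 i2, ← integral_const_mul]
  refine integral_congr_ae (ae_of_all _ fun y => ?_)
  ring

lemma integral_particleLaw_affineStat (A : Regular P h ρ ε εl εu δ γ H) (hρ : ρ n = false)
    {g ψ : X (n + 1) → ℝ} (hg : BM g) (hψ : BM ψ) {s : Sample X N n} (hs : GoodSample ρ δ H s)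
    (i : Fin N) : ∫ z, affineStat g ψ z ∂(particleLaw P h (ρ n) (ε n) n s i) =
      affineStat (pullFst M n g) (pullSnd M h n g ψ) (s i) := by
  have := A.prob n
  have hε := A.backward n hρ
  obtain ⟨G, hG0, hG⟩ := exists_boundedOnGood_affineStat (ρ := ρ) (δ := δ) (H := H) hg hψ
  rw [A.integral_particleLaw_of_good hs i (measurable_affineStat hg.1 hψ.1) hG,
    ← A.integral_mutation_affineStat hg hψ]
  simp only [selProb, backProb, hρ, hε, Bool.false_eq_true, if_false]
  simp only [apply_ite NNReal.toReal, NNReal.coe_one, NNReal.coe_zero, ite_mul, one_mul, zero_mul,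
    Finset.sum_ite_eq', Finset.mem_univ, if_true]
  refine integral_congr_ae (ae_of_all _ fun y => ?_)
  have hw := A.p_mul_weightFn false (s i).1 y
  simp only [Bool.toNat_false, pow_zero, one_mul] at hw
  have ha : avgStat h n s i i y = (s i).2.1 + h.incr n (s i).1 y := by
    simp only [avgStat, movedStat]; ring
  simp only [offspring, newWeight, Bool.toNat_false, Nat.sub_zero, pow_one, ha, ← hw, affineStat,
    NNReal.coe_mul]
  ring

lemma stepMean_affineStat (A : Regular P h ρ ε εl εu δ γ H) (hρ : ρ n = false)
    {g ψ : X (n + 1) → ℝ} (hg : BM g) (hψ : BM ψ) {s : Sample X N n} (hs : GoodSample ρ δ H s) :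
    stepMean P h (ρ n) (ε n) n (affineStat g ψ) s =
      emp (affineStat (pullFst M n g) (pullSnd M h n g ψ)) s := by
  simp only [stepMean, emp, A.integral_particleLaw_affineStat hρ hg hψ hs]

lemma stepMean_affineStat_mul (A : Regular P h ρ ε εl εu δ γ H) (hρ : ρ n = true)
    {g ψ : X (n + 1) → ℝ} (hg : BM g) (hψ : BM ψ) {s : Sample X N n} (hs : GoodSample ρ δ H s) :
    stepMean P h (ρ n) (ε n) n (affineStat g ψ) s *
        emp (weightedMonomial 0 fun x _ => (P.ϑ n x : ℝ)) s =
      emp (affineStat (pullFst M n g) (pullSnd M h n g ψ)) s := by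
  have := A.prob n
  obtain ⟨B, hB⟩ := hg.2
  obtain ⟨B', hB'⟩ := hψ.2
  have hgm : Measurable (Function.uncurry fun (x : X (n + 1)) (_ : ℝ≥0) => g x) :=
    hg.1.comp measurable_fst
  have hψm : Measurable (Function.uncurry fun (x : X (n + 1)) (_ : ℝ≥0) => ψ x) :=
    hψ.1.comp measurable_fst
  have e0 : stepMean P h (ρ n) (ε n) n (affineStat g ψ) s =
      stepMean P h (ρ n) (ε n) n (weightedMonomial 1 fun x _ => g x) s +
      stepMean P h (ρ n) (ε n) n (weightedMonomial 0 fun x _ => ψ x) s := by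
    rw [← A.integral_stepLaw_emp hs (measurable_weightedMonomial 1 hgm)
        (boundedOnGood_weightedMonomial fun x _ => hB x),
      ← A.integral_stepLaw_emp hs (measurable_weightedMonomial 0 hψm)
        (boundedOnGood_weightedMonomial fun x _ => hB' x)]
    obtain ⟨G, hG0, hG⟩ := exists_boundedOnGood_affineStat (ρ := ρ) (δ := δ) (H := H) hg hψ
    rw [← A.integral_stepLaw_emp hs (measurable_affineStat hg.1 hψ.1) hG, ← integral_add]
    · simp only [emp_affineStat]
    · refine integrable_of_ae_abs_le (measurable_emp (measurable_weightedMonomial 1 hgm))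
        (C := |weightBound ρ δ (n + 1) * B * (((n + 1 : ℕ) + 2 : ℝ) * H) ^ 1|) ?_
      filter_upwards [A.ae_stepLaw hs] with s' hs'
      exact abs_emp_le (abs_nonneg _) fun j => (boundedOnGood_weightedMonomial (f := fun x _ => g x)
        (fun x _ => hB x) _ (hs' j)).trans (le_abs_self _)
    · refine integrable_of_ae_abs_le (measurable_emp (measurable_weightedMonomial 0 hψm))
        (C := |weightBound ρ δ (n + 1) * B' * (((n + 1 : ℕ) + 2 : ℝ) * H) ^ 0|) ?_
      filter_upwards [A.ae_stepLaw hs] with s' hs'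
      exact abs_emp_le (abs_nonneg _) fun j => (boundedOnGood_weightedMonomial (f := fun x _ => ψ x)
        (fun x _ => hB' x) _ (hs' j)).trans (le_abs_self _)
  have hT : ∀ i, BM fun y => ((s i).2.2 : ℝ) * M.ell n (s i).1 y *
      (((s i).2.1 + h.incr n (s i).1 y) * g y + ψ y) := fun i =>
    ((BM.const _).mul ((A.bm_ell n).curry_left _)).mul
      ((((BM.const _).add ((A.bm_incr n).curry_left _)).mul hg).add hψ)
  have hmv : ∀ k, BM fun y => emp (movedMonomial M h n (fun _ _ => 1) k y) s := fun k => by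
    unfold emp movedMonomial
    exact (BM.const _).mul (BM.sum _ fun i _ =>
      (((BM.const _).mul ((A.bm_ell n).curry_left _)).mul (BM.const _)).mul
        (((BM.const _).add ((A.bm_incr n).curry_left _)).pow k))
  rw [e0, add_mul, A.stepMean_mul hρ hs 1 hgm fun x _ => hB x,
    A.stepMean_mul hρ hs 0 hψm fun x _ => hB' x]
  simp only [selectionMix_one, selectionMix_zero]
  rw [← integral_add ((hg.mul (hmv 1)).integrable _) ((hψ.mul (hmv 0)).integrable _)]
  rw [emp]
  simp only [← A.integral_mutation_affineStat hg hψ]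
  rw [← integral_finsetSum _ fun i _ => (hT i).integrable _, ← integral_const_mul]
  refine integral_congr_ae (ae_of_all _ fun y => ?_)
  simp only [emp, movedMonomial]
  rw [mul_left_comm, mul_left_comm (ψ y), ← mul_add, Finset.mul_sum, Finset.mul_sum,
    ← Finset.sum_add_distrib]
  congr 1
  refine Finset.sum_congr rfl fun i _ => ?_
  ring

/-- Each offspring has its own parent and its conditional mean is the pulled-back function of that
parent. The conditional variance is thus a difference of second moments at two consecutive times,
the source of the telescoping. -/
lemma stepVar_of_not_selection (A : Regular P h ρ ε εl εu δ γ H) (hρ : ρ n = false)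
    {g ψ : X (n + 1) → ℝ} (hg : BM g) (hψ : BM ψ) {s : Sample X N n} (hs : GoodSample ρ δ H s) :
    stepVar P h (ρ n) (ε n) n (affineStat g ψ) s =
      stepMean P h (ρ n) (ε n) n (fun z => affineStat g ψ z ^ 2) s -
        emp (fun z => affineStat (pullFst M n g) (pullSnd M h n g ψ) z ^ 2) s := by
  simp only [stepVar_eq, A.integral_particleLaw_affineStat hρ hg hψ hs, emp]

lemma stepVar_of_selection (hρ : ρ n = true) (F : X (n + 1) × ℝ × ℝ≥0 → ℝ) (hN : 1 ≤ N)
    (s : Sample X N n) :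
    stepVar P h (ρ n) (ε n) n F s =
      stepMean P h (ρ n) (ε n) n (fun z => F z ^ 2) s -
        stepMean P h (ρ n) (ε n) n F s * stepMean P h (ρ n) (ε n) n F s := by
  have hN' : (N : ℝ) ≠ 0 := by positivity
  have e : ∀ i, particleLaw P h (ρ n) (ε n) n s i = particleLaw P h (ρ n) (ε n) n s ⟨0, hN⟩ :=
    fun i => by rw [hρ]; exact particleLaw_true P h (ε n) s i _
  rw [stepVar_eq]
  congr 1
  unfold stepMean
  simp only [e, Finset.sum_const, Finset.card_univ, Fintype.card_fin, nsmul_eq_mul]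
  field_simp

/-- The initial particles are iid; mean zero and variance `a` follow from the uniqueness of limits
of the same particle averages. -/
lemma asympNormal_zero (A : Regular P h ρ ε εl εu δ γ H) {g ψ : X 0 → ℝ} (hg : BM g) (hψ : BM ψ)
    (h0 : ∫ x, (g x * mom M h ε 0 1 x + ψ x) ∂(fwd M 0) = 0) {a K C : ℝ}
    (hr : Rate (fun N => law P h ρ ε N 0)
      (fun _ s => emp (fun z => affineStat g ψ z ^ 2) s) a K C) :
    AsympNormal P h ρ ε 0 g ψ a := by
  intro t
  have hF := measurable_affineStat hg.1 hψ.1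
  obtain ⟨G, hG0, hG⟩ := exists_boundedOnGood_affineStat (ρ := ρ) (δ := δ) (H := H) hg hψ
  obtain ⟨K', C', h1⟩ := A.exists_rate_affineStat 0 hg hψ
  rw [h0, mul_zero] at h1
  obtain ⟨K1, C1, h2⟩ := A.rateFam_init (ι := Unit) (fun _ => hF) fun _ => hG
  obtain ⟨K2, C2, h3⟩ := A.rateFam_init (ι := Unit) (fun _ => hF.pow_const 2) fun _ => hG.sq
  have e1 : ∫ z, affineStat g ψ z ∂(initParticleLaw P h) = 0 := (h2 ()).unique h1
  have e2 : ∫ z, affineStat g ψ z ^ 2 ∂(initParticleLaw P h) = a := (h3 ()).unique hr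
  rw [tendsto_iff_norm_sub_tendsto_zero]
  have hb : Tendsto (fun N : ℕ => (|t| * (2 * G)) ^ 3 * (1 / √N)) atTop (𝓝 0) := by
    have h1 := (Real.tendsto_sqrt_atTop.comp
      tendsto_natCast_atTop_atTop).inv_tendsto_atTop.const_mul ((|t| * (2 * G)) ^ 3)
    simpa using h1
  refine squeeze_zero' (Eventually.of_forall fun N => norm_nonneg _) ?_ hb
  filter_upwards [eventually_ge_atTop 1, (Real.tendsto_sqrt_atTop.comp
    tendsto_natCast_atTop_atTop).eventually_ge_atTop (|t| * (2 * G))] with N hN hNt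
  have hN' : (N : ℝ) ≠ 0 := by positivity
  have hae : ∀ _ : Fin N, ∀ᵐ z ∂(initParticleLaw P h), |affineStat g ψ z| ≤ G := fun _ => by
    filter_upwards [A.ae_initParticleLaw (ε := ε)] with z hz using hG z hz
  have := norm_integral_cis_emp_sub_le hN (fun _ => initParticleLaw P h) hF hae hNt
  simp only [e1, e2, Finset.sum_const, Finset.card_univ, Fintype.card_fin, nsmul_eq_mul, mul_zero,
    cis_zero, one_mul] at this
  have e3 : (N : ℝ)⁻¹ * (N * (a - 0 ^ 2)) = a := by field_simp; ring
  rw [e3] at this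
  rw [mul_one_div]
  exact this

/-- The step adds `a - a'` to the variance `a' + R`: the old second moment is exchanged for the new
one and `R` is untouched. -/
lemma asympNormal_succ_of_not_selection (A : Regular P h ρ ε εl εu δ γ H) (hρ : ρ n = false)
    {g ψ : X (n + 1) → ℝ} (hg : BM g) (hψ : BM ψ) {a K C a' K' C' R : ℝ}
    (hr : Rate (fun N => law P h ρ ε N (n + 1))
      (fun _ s => emp (fun z => affineStat g ψ z ^ 2) s) a K C)
    (hr' : Rate (fun N => law P h ρ ε N n) (fun _ s => emp
      (fun z => affineStat (pullFst M n g) (pullSnd M h n g ψ) z ^ 2) s) a' K' C')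
    (hlim : AsympNormal P h ρ ε n (pullFst M n g) (pullSnd M h n g ψ) (a' + R)) :
    AsympNormal P h ρ ε (n + 1) g ψ (a + R) := by
  intro t
  have hF := measurable_affineStat hg.1 hψ.1
  have hbf := A.bm_pullFst n hg
  have hbs := A.bm_pullSnd n hg hψ
  obtain ⟨G, hG0, hG⟩ := exists_boundedOnGood_affineStat (ρ := ρ) (δ := δ) (H := H) hg hψ
  obtain ⟨G', hG0', hG'⟩ := exists_boundedOnGood_affineStat (ρ := ρ) (δ := δ) (H := H) hbf hbs
  have hm2 := A.rate_stepMean (hF.pow_const 2) (sq_nonneg G) hG.sq hr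
  have hv := hm2.sub hr'
  have hvE : ∀ N, ∀ᵐ s ∂(law P h ρ ε N n), stepVar P h (ρ n) (ε n) n (affineStat g ψ) s =
      stepMean P h (ρ n) (ε n) n (fun z => affineStat g ψ z ^ 2) s -
        emp (fun z => affineStat (pullFst M n g) (pullSnd M h n g ψ) z ^ 2) s := fun N => by
    filter_upwards [A.ae_law N n] with s hs using A.stepVar_of_not_selection hρ hg hψ hs
  have hS := hv.congr (fun N => measurable_stepVar P h (ρ n) (ε n) hF) (fun N _ => hvE N)
    fun N => by
      filter_upwards [hvE N, hv.bdd N] with s h1 h2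
      rw [h1]
      exact h2
  have hdiff : Tendsto (fun N : ℕ => ∫ s, √N * |stepMean P h (ρ n) (ε n) n (affineStat g ψ) s -
      emp (affineStat (pullFst M n g) (pullSnd M h n g ψ)) s| ∂(law P h ρ ε N n)) atTop (𝓝 0) := by
    refine tendsto_const_nhds.congr fun N => ?_
    refine ((integral_congr_ae ?_).trans (integral_zero _ _)).symm
    filter_upwards [A.ae_law N n] with s hs
    simp [A.stepMean_affineStat hρ hg hψ hs]
  have := A.tendsto_cis_succ hF hG0 hG
    (Y := fun _ s => emp (affineStat (pullFst M n g) (pullSnd M h n g ψ)) s)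
    (fun N => measurable_emp (measurable_affineStat hbf.1 hbs.1)) (KY := G') (fun N => by
      filter_upwards [A.ae_law N n] with s hs
      exact abs_emp_le hG0' fun j => hG' _ (hs j)) hlim hdiff hS t
  convert this using 5
  ring

/-- Conditionally iid offspring have variance equal to their second moment minus a squared mean
tending to zero, so the full `a` is added. The past enters divided by the limit of the selection
normalizer. -/
lemma asympNormal_succ_of_selection (A : Regular P h ρ ε εl εu δ γ H) (hρ : ρ n = true)
    {g ψ : X (n + 1) → ℝ} (hg : BM g) (hψ : BM ψ)
    (h0 : ∫ x, (g x * mom M h ε (n + 1) 1 x + ψ x) ∂(fwd M (n + 1)) = 0) {a K C V : ℝ}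
    (hr : Rate (fun N => law P h ρ ε N (n + 1))
      (fun _ s => emp (fun z => affineStat g ψ z ^ 2) s) a K C)
    (hlim : AsympNormal P h ρ ε n (pullFst M n g) (pullSnd M h n g ψ) V) :
    AsympNormal P h ρ ε (n + 1) g ψ
      (a + V / (normConst P ρ n * ∫ x, (P.ϑ n x : ℝ) ∂(fwd M n)) ^ 2) := by
  intro t
  have hF := measurable_affineStat hg.1 hψ.1
  have hbf := A.bm_pullFst n hg
  have hbs := A.bm_pullSnd n hg hψ
  obtain ⟨G, hG0, hG⟩ := exists_boundedOnGood_affineStat (ρ := ρ) (δ := δ) (H := H) hg hψ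
  obtain ⟨G', hG0', hG'⟩ := exists_boundedOnGood_affineStat (ρ := ρ) (δ := δ) (H := H) hbf hbs
  have hm2 := A.rate_stepMean (hF.pow_const 2) (sq_nonneg G) hG.sq hr
  obtain ⟨K1, C1, h1⟩ := A.exists_rate_affineStat (n + 1) hg hψ
  rw [h0, mul_zero] at h1
  have hm := A.rate_stepMean hF hG0 hG h1
  obtain ⟨K2, C2, h2⟩ := A.exists_rate_weightedMonomial n 0 (A.bm_ϑ n)
  simp only [A.mom_zero, mul_one] at h2
  set c := normConst P ρ n * ∫ x, (P.ϑ n x : ℝ) ∂(fwd M n) with hc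
  have hc0 : 0 < c := mul_pos (A.normConst_pos n) (A.integral_ϑ_pos n)
  have hS : ∃ K C, Rate (fun N => law P h ρ ε N n)
      (fun _ s => stepVar P h (ρ n) (ε n) n (affineStat g ψ) s) a K C := by
    have hv := hm2.sub (hm.mul hm)
    rw [mul_zero, sub_zero] at hv
    have hv0 : ∀ N, 1 ≤ N → ∀ᵐ s ∂(law P h ρ ε N n),
        stepVar P h (ρ n) (ε n) n (affineStat g ψ) s = _ :=
      fun N hN => ae_of_all _ fun s => stepVar_of_selection hρ (affineStat g ψ) hN s
    refine ⟨_, _, hv.congr (fun N => measurable_stepVar P h (ρ n) (ε n) hF) hv0 fun N => ?_⟩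
    -- The bounds in `Rate` include `N = 0`, where the formula for the conditional variance is not
    -- available.
    rcases Nat.eq_zero_or_pos N with rfl | hN
    · exact ae_of_all _ fun s => by simpa [stepVar] using hv.nonneg
    · filter_upwards [hv0 N hN, hv.bdd N] with s h3 h4
      rw [h3]
      exact h4
  obtain ⟨K3, C3, hS⟩ := hS
  have hdiff : Tendsto (fun N : ℕ => ∫ s, √N * |stepMean P h (ρ n) (ε n) n (affineStat g ψ) s -
      c⁻¹ * emp (affineStat (pullFst M n g) (pullSnd M h n g ψ)) s| ∂(law P h ρ ε N n)) atTop
      (𝓝 0) := by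
    -- Slutsky: the conditional mean tends to zero and its normalizer to `c`, both with rates, so
    -- the normalizer may be replaced by `c`. Centering is indispensable here.
    have h3 := (hm.tendsto_sqrt_mul h2).const_mul c⁻¹
    rw [mul_zero] at h3
    refine h3.congr fun N => ?_
    rw [← integral_const_mul]
    refine integral_congr_ae ?_
    filter_upwards [A.ae_law N n] with s hs
    rw [← A.stepMean_affineStat_mul hρ hg hψ hs, mul_left_comm]
    congr 1
    rw [← abs_of_pos (inv_pos.2 hc0), ← abs_mul, abs_of_pos (inv_pos.2 hc0), abs_sub_comm]
    congr 1
    field_simp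
  have := A.tendsto_cis_succ hF hG0 hG
    (Y := fun _ s => c⁻¹ * emp (affineStat (pullFst M n g) (pullSnd M h n g ψ)) s)
    (fun N => (measurable_emp (measurable_affineStat hbf.1 hbs.1)).const_mul _) (KY := c⁻¹ * G')
    (fun N => by
      filter_upwards [A.ae_law N n] with s hs
      rw [abs_mul, abs_of_pos (inv_pos.2 hc0)]
      gcongr
      exact abs_emp_le hG0' fun j => hG' _ (hs j)) (V := V / c ^ 2) (fun t => by
      have h3 := hlim (t * c⁻¹)
      convert h3 using 4 with N
      · ring_nf
      · congr 2
        field_simp) hdiff hS t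
  convert this using 5
  ring

/-- Central limit theorem for the weighted sample. The variance is the limiting second moment plus
a nonnegative contribution of the selection steps. -/
theorem exists_asympNormal (A : Regular P h ρ ε εl εu δ γ H) (n : ℕ) {g ψ : X n → ℝ} (hg : BM g)
    (hψ : BM ψ) (h0 : ∫ x, (g x * mom M h ε n 1 x + ψ x) ∂(fwd M n) = 0) {a K C : ℝ}
    (hr : Rate (fun N => law P h ρ ε N n)
      (fun _ s => emp (fun z => affineStat g ψ z ^ 2) s) a K C) :
    ∃ R, 0 ≤ R ∧ R ≤ normConst P ρ n ^ 2 * selectionVar P h ρ ε δ n g ψ ∧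
      AsympNormal P h ρ ε n g ψ (a + R) := by
  induction n generalizing a K C with
  | zero =>
    refine ⟨0, le_rfl, by simp [selectionVar], ?_⟩
    rw [add_zero]
    exact A.asympNormal_zero hg hψ h0 hr
  | succ n ih =>
    have hbf := A.bm_pullFst n hg
    have hbs := A.bm_pullSnd n hg hψ
    have h0' := h0
    rw [A.integral_fwd_succ_affine n hg hψ] at h0'
    obtain ⟨a', K', C', hr'⟩ := A.exists_rate_affineStat_sq n hbf hbs
    obtain ⟨R, hR0, hR, hlim⟩ := ih hbf hbs h0' hr'
    have ha' : 0 ≤ a' := hr'.nonneg_of_ae_nonneg fun N => ae_of_all _ fun s =>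
      mul_nonneg (by positivity) (Finset.sum_nonneg fun i _ => sq_nonneg _)
    have ha'' := A.sq_limit_le n hbf hbs hr'
    have hκ := A.normConst_pos n
    have hϑ := A.integral_ϑ_pos n
    cases hρ : ρ n
    · refine ⟨R, hR0, ?_, A.asympNormal_succ_of_not_selection hρ hg hψ hr hr' hlim⟩
      simpa [selectionVar, normConst, hρ] using hR
    -- The new remainder is the whole previous variance `a' + R` divided by the squared normalizer.
    -- Its second moment `a'` no longer telescopes and becomes the contribution of this selection.
    · refine ⟨_, by positivity, ?_, A.asympNormal_succ_of_selection hρ hg hψ h0 hr hlim⟩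
      rw [selectionVar, normConst, if_pos hρ, if_pos hρ, mul_pow, div_le_iff₀ (by positivity)]
      set κ := normConst P ρ n with hκd
      set Θ := ∫ x, (P.ϑ n x : ℝ) ∂(fwd M n) with hΘ
      have e : ∀ B S : ℝ, Θ⁻¹ ^ 2 * (B + weightBound ρ δ n / κ * S) * (κ ^ 2 * Θ ^ 2) =
          weightBound ρ δ n * (κ * S) + κ ^ 2 * B := fun B S => by
        field_simp
        ring
      rw [e]
      exact add_le_add ha'' hR

end Regular

end AsymptoticNormality

/-! ### Passage to the self-normalized estimator and its asymptotic variance. -/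

section AsymptoticVariance

variable {X : ℕ → Type u} [∀ n, MeasurableSpace (X n)] {M : PathModel X} {P : Proposal M}
  {h : AdditiveTerms X} {ρ ε : ℕ → Bool} {εl εu δ γ H : ℝ≥0} {N n : ℕ}

lemma measurable_estimator : Measurable fun s : Sample X N n => estimator s := by
  have h1 : ∀ i, Measurable fun s : Sample X N n => ((s i).2.2 : ℝ) := fun i =>
    (by fun_prop : Measurable fun s : Sample X N n => (s i).2.2).coe_nnreal_real
  unfold estimator
  exact (Finset.measurable_fun_sum _ fun i _ => (h1 i).mul (by fun_prop)).div
    (Finset.measurable_fun_sum _ fun i _ => h1 i)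

/-- Valid for vanishing total weight too: then every weight is zero, and so are both sides. -/
lemma estimator_sub_mul (φ : ℝ) (s : Sample X N n) :
    (estimator s - φ) * emp (weightedMonomial 0 fun _ _ => (1 : ℝ)) s =
      emp (affineStat (fun _ => (1 : ℝ)) fun _ => -φ) s := by
  have e1 : emp (weightedMonomial 0 fun _ _ => (1 : ℝ)) s =
      (N : ℝ)⁻¹ * ∑ i, ((s i).2.2 : ℝ) := by
    simp [emp, weightedMonomial]
  have e2 : emp (affineStat (fun _ => (1 : ℝ)) fun _ => -φ) s =
      (N : ℝ)⁻¹ * (∑ i, ((s i).2.2 : ℝ) * (s i).2.1 - φ * ∑ i, ((s i).2.2 : ℝ)) := by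
    rw [Finset.mul_sum, ← Finset.sum_sub_distrib, emp]
    congr 1
    refine Finset.sum_congr rfl fun i _ => ?_
    simp only [affineStat]
    ring
  rw [e1, e2, mul_left_comm, sub_mul]
  congr 2
  unfold estimator
  rcases eq_or_ne (∑ i, ((s i).2.2 : ℝ)) 0 with h0 | h0
  · rw [h0, mul_zero, eq_comm]
    have h1 := (Finset.sum_eq_zero_iff_of_nonneg fun i _ => NNReal.coe_nonneg _).1 h0
    exact Finset.sum_eq_zero fun i hi => by rw [h1 i hi, zero_mul]
  · rw [div_mul_cancel₀ _ h0]

lemma abs_estimator_le {T : ℝ} (hT0 : 0 ≤ T) {s : Sample X N n} (hT : ∀ i, |(s i).2.1| ≤ T) :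
    |estimator s| ≤ T := by
  unfold estimator
  have h0 : 0 ≤ ∑ i, ((s i).2.2 : ℝ) := Finset.sum_nonneg fun i _ => NNReal.coe_nonneg _
  rw [abs_div, abs_of_nonneg h0]
  refine div_le_of_le_mul₀ h0 hT0 ?_
  rw [Finset.mul_sum]
  refine (Finset.abs_sum_le_sum_abs _ _).trans (Finset.sum_le_sum fun i _ => ?_)
  rw [abs_mul, NNReal.abs_eq, mul_comm]
  exact mul_le_mul_of_nonneg_right (hT i) (NNReal.coe_nonneg _)

/-- Characteristic functions determine the asymptotic variance. -/
lemma isAsymptoticVariance_of_tendsto {v : ℝ≥0}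
    (hlim : ∀ t : ℝ, Tendsto (fun N : ℕ => ∫ s, cis (t * (√N * (estimator s -
      ∫ x, h.functional n x ∂(M.smoothing n)))) ∂(law P h ρ ε N n)) atTop
      (𝓝 (Real.exp (-(t ^ 2 * v / 2)) : ℝ))) : IsAsymptoticVariance P h ρ ε n v := by
  have hm : ∀ N : ℕ, Measurable fun s : Sample X N n => √(N : ℝ) * (estimator s -
      ∫ x, h.functional n x ∂(M.smoothing n)) := fun N =>
    (measurable_estimator.sub_const _).const_mul _
  refine ⟨fun N => (hm N).aemeasurable, by fun_prop, ?_⟩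
  refine ProbabilityMeasure.tendsto_of_tendsto_charFun fun t => ?_
  convert hlim t using 2 with N
  · change charFun (Measure.map _ _) t = _
    rw [charFun_apply_real, integral_map (hm N).aemeasurable (by fun_prop)]
    refine integral_congr_ae (ae_of_all _ fun s => ?_)
    simp only [cis]
    push_cast
    rfl
  · change charFun (Measure.map (fun z => z) (gaussianReal 0 v)) t = _
    rw [Measure.map_id', charFun_gaussianReal]
    push_cast
    congr 1
    ring

namespace Regular

/-- The estimator inherits asymptotic normality from the weighted sample. -/
lemma isAsymptoticVariance_of_asympNormal (A : Regular P h ρ ε εl εu δ γ H) {φ V : ℝ} {v : ℝ≥0}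
    (hφ : ∫ x, h.functional n x ∂(M.smoothing n) = φ)
    (h0 : ∫ x, (1 * mom M h ε n 1 x + -φ) ∂(fwd M n) = 0)
    (hV : AsympNormal P h ρ ε n (fun _ => 1) (fun _ => -φ) V)
    (hv : (v : ℝ) = V / (normConst P ρ n * (fwd M n).real Set.univ) ^ 2) :
    IsAsymptoticVariance P h ρ ε n v := by
  refine isAsymptoticVariance_of_tendsto fun t => ?_
  rw [hφ]
  set c := normConst P ρ n * (fwd M n).real Set.univ with hc
  have hc0 : 0 < c := mul_pos (A.normConst_pos n) (A.fwd_pos n)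
  obtain ⟨K1, C1, h1⟩ := A.exists_rate_affineStat n (BM.const 1) (BM.const (-φ))
  rw [h0, mul_zero] at h1
  obtain ⟨K2, C2, h2⟩ := A.exists_rate_weightedMonomial n 0 (BM.const 1)
  have e2 : normConst P ρ n * ∫ x, 1 * mom M h ε n 0 x ∂(fwd M n) = c := by
    simp [A.mom_zero, hc]
  rw [e2] at h2
  have hmx : ∀ N, Measurable fun s : Sample X N n => estimator s - φ := fun N =>
    measurable_estimator.sub_const φ
  have hx := h1.div h2 (x := fun _ s => estimator s - φ) (Kx := (n + 2 : ℝ) * H + |φ|) hmx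
    (fun N => by
      filter_upwards [A.ae_law N n] with s hs
      exact (abs_sub _ _).trans
        (add_le_add (abs_estimator_le (by positivity) fun i => (hs i).2) le_rfl))
    (fun N => ae_of_all _ fun s => estimator_sub_mul φ s) hc0 le_rfl
  rw [zero_div] at hx
  -- The mean weight is replaced by its limit `c` at the scale `√N`, possible because the centered
  -- estimator also tends to zero at a rate.
  have h3 := (hx.tendsto_sqrt_mul h2).const_mul (|t| * c⁻¹)
  rw [mul_zero] at h3
  have hmy : ∀ N, Measurable fun s : Sample X N n =>
      emp (affineStat (fun _ => (1 : ℝ)) fun _ => -φ) s := fun N =>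
    measurable_emp (measurable_affineStat measurable_const measurable_const)
  have h4 : Tendsto (fun N : ℕ => ∫ s, cis (t * (√N * (estimator s - φ))) ∂(law P h ρ ε N n) -
      ∫ s, cis (t * c⁻¹ * (√N * emp (affineStat (fun _ => (1 : ℝ)) fun _ => -φ) s))
        ∂(law P h ρ ε N n)) atTop (𝓝 0) := by
    refine squeeze_zero_norm (fun N => ?_) h3
    rw [← integral_sub (integrable_cis (((hmx N).const_mul _).const_mul _))
      (integrable_cis (((hmy N).const_mul _).const_mul _)), ← integral_const_mul]
    refine (norm_integral_le_integral_norm _).trans (integral_mono_of_nonneg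
      (ae_of_all _ fun s => norm_nonneg _) ?_ (ae_of_all _ fun s => ?_))
    · refine ((integrable_of_ae_abs_le ((hx.meas N).mul ((h2.meas N).sub_const c)).abs
        (C := max ((n + 2 : ℝ) * H + |φ|) (K1 / c) * (K2 + K2)) ?_).const_mul _).const_mul _
      filter_upwards [hx.bdd N, h2.bdd N] with s h5 h6
      rw [abs_abs, Pi.mul_apply, abs_mul]
      exact mul_le_mul h5 ((abs_sub _ _).trans (add_le_add h6 h2.lim_le)) (abs_nonneg _) hx.nonneg
    · refine (norm_cis_sub_cis_le _ _).trans (le_of_eq ?_)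
      rw [← estimator_sub_mul]
      have e : ∀ x w : ℝ, t * (√N * x) - t * c⁻¹ * (√N * (x * w)) =
          -(t * c⁻¹ * (√N * (x * (w - c)))) := fun x w => by
        field_simp
        ring
      rw [e, abs_neg, abs_mul, abs_mul, abs_mul, abs_of_pos (inv_pos.2 hc0),
        abs_of_nonneg (Real.sqrt_nonneg _)]
  have h5 := h4.add (hV (t * c⁻¹))
  simp only [sub_add_cancel, zero_add] at h5
  convert h5 using 5
  rw [hv]
  field_simp

/-- The asymptotic variance exists and is controlled by the second moments of the pulled back
functions. -/
theorem exists_isAsymptoticVariance_le (A : Regular P h ρ ε εl εu δ γ H) (hlu : εl ≤ εu)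
    {d : ℕ} (hρ : ∀ n, ∃ k, 1 ≤ k ∧ k ≤ d ∧ ρ (n + k) = true) :
    ∃ (K : ℝ≥0) (σ : ℕ → ℝ≥0), (∀ n, IsAsymptoticVariance P h ρ ε n (σ n)) ∧
      ∀ n, (σ n : ℝ) ≤ K + ∑ j ∈ Finset.range (numSelections ρ n),
        (mixingConst εl εu δ d * H ^ 2 * γ : ℝ≥0) * (selectionWeight ρ ε (j + 1) + 1) := by
  obtain ⟨K, hK⟩ := A.variance_bound hlu hρ
  suffices ∀ n, ∃ v : ℝ≥0, IsAsymptoticVariance P h ρ ε n v ∧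
      (v : ℝ) ≤ K + ∑ j ∈ Finset.range (numSelections ρ n),
        (mixingConst εl εu δ d * H ^ 2 * γ : ℝ≥0) * (selectionWeight ρ ε (j + 1) + 1) by
    choose σ h1 h2 using this
    exact ⟨K, σ, h1, h2⟩
  intro n
  -- The estimation error is governed by `g = 1` and `ψ` equal to minus the smoothed expectation, a
  -- tame pair that starts the chain of pull-backs.
  have hT := A.tame_one (ε := ε) hlu n
  set G := (fwd M n).real Set.univ with hGd
  have hG : 0 < G := A.fwd_pos n
  have hκ := A.normConst_pos n
  obtain ⟨a, K', C', hr⟩ := A.exists_rate_affineStat_sq n hT.bm_fst hT.bm_snd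
  obtain ⟨R, hR0, hR, hV⟩ := A.exists_asympNormal n hT.bm_fst hT.bm_snd hT.centered hr
  have ha0 : 0 ≤ a := hr.nonneg_of_ae_nonneg fun N => ae_of_all _ fun s =>
    mul_nonneg (by positivity) (Finset.sum_nonneg fun i _ => sq_nonneg _)
  have ha := A.sq_limit_le n hT.bm_fst hT.bm_snd hr
  -- The denominator is the square of the limiting mean weight; its factor `normConst P ρ n ^ 2`
  -- cancels against the bounds for `a` and `R`.
  have hv0 : 0 ≤ (a + R) / (normConst P ρ n * G) ^ 2 := by positivity
  refine ⟨⟨_, hv0⟩, A.isAsymptoticVariance_of_asympNormal (A.integral_smoothing (ε := ε) n)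
    hT.centered hV rfl, ?_⟩
  refine le_trans ?_ (hK n G _ _ hG hT)
  change (a + R) / (normConst P ρ n * G) ^ 2 ≤ _
  rw [mul_pow, ← div_div]
  refine div_le_div_of_nonneg_right ?_ (sq_nonneg G)
  rw [div_le_iff₀ (by positivity)]
  refine (add_le_add ha hR).trans (le_of_eq ?_)
  field_simp

end Regular

end AsymptoticVariance

end AdaSmooth

/-! ### The main theorem. -/

theorem theorem3p3 (εl εu δ : ℝ≥0) (d : ℕ) (hεl : 0 < εl) (hε : εl < εu) (hδ : 0 < δ)
    (hd : 1 ≤ d) :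
    ∃ C₁ C₂ : ℝ≥0, 0 < C₁ ∧ 0 < C₂ ∧
      ∀ (X : ℕ → Type*) [∀ n, MeasurableSpace (X n)] (M : AdaSmooth.PathModel X)
        (P : AdaSmooth.Proposal M) (γ : ℝ≥0) (ρ ε : ℕ → Bool),
        0 < γ →
        -- from time one on, the reference measures are normalized to probability measures
        (∀ n, IsProbabilityMeasure (M.μ (n + 1))) →
        AdaSmooth.StrongMixing P εl εu δ γ →
        -- backward sampling takes place only when resampling does
        (∀ n, ρ n = false → ε n = false) →
        -- there are at most `d` steps until the next resampling time
        (∀ n, ∃ k, 1 ≤ k ∧ k ≤ d ∧ ρ (n + k) = true) →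
        ∀ (h : AdaSmooth.AdditiveTerms X) (H : ℝ≥0), 0 < H →
          (∀ n x y, |h.incr n x y| ≤ H) →
          (∀ x y, |h.init x + h.incr 0 x y| ≤ H) →
          ∃ σsq : ℕ → ℝ≥0,
            (∀ n, AdaSmooth.IsAsymptoticVariance P h ρ ε n (σsq n)) ∧
            limsup (fun n : ℕ => (σsq n : ℝ≥0∞) / (n : ℝ≥0∞)) atTop ≤
              (d : ℝ≥0∞) ^ 2 * (H : ℝ≥0∞) ^ 2 * γ *
                (C₁ + C₂ *
                  limsup (fun n : ℕ => (AdaSmooth.scheduleAverage ρ ε n : ℝ≥0∞)) atTop) := by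
  have hlu : (0 : ℝ≥0) < εu := hεl.trans hε
  have hC : 0 < AdaSmooth.mixingConst εl εu δ d := by
    unfold AdaSmooth.mixingConst
    positivity
  -- One constant serves for both, as each step was bounded by a multiple of the schedule weight
  -- plus one.
  refine ⟨AdaSmooth.mixingConst εl εu δ d, AdaSmooth.mixingConst εl εu δ d, hC, hC, ?_⟩
  intro X _ M P γ ρ ε hγ hμ hmix hback hρ h H hH hincr hinit
  have A : AdaSmooth.Regular P h ρ ε εl εu δ γ H := ⟨hεl, hμ, hmix, hback, hincr, hinit⟩
  obtain ⟨K, σ, h1, h2⟩ := A.exists_isAsymptoticVariance_le hε.le hρ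
  refine ⟨σ, h1, (AdaSmooth.limsup_div_le h2).trans ?_⟩
  -- The dependence on `d` is already contained in `mixingConst`; of the factor `d ^ 2` only that it
  -- is at least one is needed.
  have hd1 : (1 : ℝ≥0∞) ≤ (d : ℝ≥0∞) ^ 2 := one_le_pow₀ (by exact_mod_cast hd)
  set L := limsup (fun n : ℕ => (AdaSmooth.scheduleAverage ρ ε n : ℝ≥0∞)) atTop
  set C := AdaSmooth.mixingConst εl εu δ d
  calc ((C * H ^ 2 * γ : ℝ≥0) : ℝ≥0∞) * (1 + L)
      = 1 * ((H : ℝ≥0∞) ^ 2 * γ * (C + C * L)) := by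
        push_cast
        ring
    _ ≤ (d : ℝ≥0∞) ^ 2 * ((H : ℝ≥0∞) ^ 2 * γ * (C + C * L)) := by gcongr
    _ = _ := by ring
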